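/- **Setting.** Let $K$ be an algebraically closed field, $v\in K^*$ with $\delta:=v+v^{-1}\neq 0$, and $n\ge 3$. An affine $n$-diagram is an isotopy class of non-crossing diagrams in the strip $\mathbb R\times[0,1]$, invariant under horizontal shift by $n$, in which every node of $\mathbb Z\times\{0,1\}$ is the endpoint of exactly one edge and all other edges are finitely many infinite horizontal lines. $D_n$ is the $K$-algebra with basis the affine $n$-diagrams; the product $AB$ is obtained by putting $A$ on top of $B$ on the cylinder and replacing each closed contractible loop by a factor $\delta$. Let $u\in D_n$ be the diagram joining each bottom point $j$ to the top point $j+1$; $u^n$ is central. A diagram with $t>0$ vertical edges is determined by the triple $[S_1,S_2,w]$, where $S_1,S_2$ are the annular involutions of $\{1,\dots,n\}$ with $t$ fixed points that record the horizontal edges in the top and bottom circle, and $w\in\mathbb Z$ is the winding number (the number of edges crossing the line $x=1/2$ that run from bottom $j$ to top $i>j$, minus the number of those with $i<j$); all such triples occur. For $f=\sum_k c_kX^k\in K[X]$ put $f(S_1,S_2)=\sum_k c_k[S_1,S_2,k]$. Let $I_t$ be the ideal spanned by the diagrams with at most $t$ vertical edges (so $I_{-1}=0$), and for $t>0$ let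 $\tau$ be the linear map of $I_t/I_{t-2}$ with $\tau[S_1,S_2,w]=[S_1,S_2,w+1]$; it commutes with the left and right action of $D_n$. For $q\in K^*$ let $D_n(q)$ be the quotient of $D_n$ by the ideal generated by $u^n-q$ and $I_0$ (where $I_0=0$ if $n$ is odd). Let $0<t\le n$ with $t\equiv n \pmod 2$, write $X^t-q=\prod_{i=1}^t(X-r_i)$ and $f_j=\prod_{i>j}(X-r_i)$ for $1\le j\le t$. Fix $j$ and put $\alpha=r_j$. The standard module with label $(t,\alpha)$ is the $D_n(q)$-module spanned by the cosets of the elements $f_j(S,T^*)$, for a fixed annular involution $T$ with $t$ fixed points and $S$ running over all of these, modulo the ideal of $D_n(q)$ spanned by $I_{t-2}$ and all $f_i(S_1,S_2^*)$ with $i<j$; here $S^*=w_0Sw_0^{-1}$ with $w_0$ the order-reversing permutation. For such $(t,\alpha)$ let $$\mathcal I=\frac{I_t/I_{t-2}}{(\tau-\alpha)^2\,(I_t/I_{t-2})},$$ and for an annular involution $S$ with $t$ fixed points let $\mathcal I_M(S)\subseteq\mathcal I$ be the left $D_n$-submodule spanned by the images of all $[S_1,S,w]$. **Proposition.** Let $M$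 be a simple standard module with label $(t,\alpha)$ as above, and suppose that $M$ has no nontrivial self-extensions as a $D_n(q)$-module, i.e. every short exact sequence $0\to M\to E\to M\to 0$ of $D_n(q)$-modules splits. Let $0\to M\to N\to M\to 0$ be a short exact sequence of $D_n$-modules with $N$ indecomposable. Then $N\cong \mathcal I_M(S)$ as $D_n$-modules for every annular involution $S$ of $\{1,\dots,n\}$ with $t$ fixed points. Moreover, if $a\in K$ satisfies $(u^n-a)M=0$, then $(u^n-a)N\cong M$ as $D_n$-modules. -/

import Mathlib

set_option linter.unusedSectionVars false

namespace AffineTL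

/-- Nodes lie in rows: `(i, e)` is the node with horizontal coordinate `i` in the row `e`, rows
being numbered from top to bottom. The shift moves all nodes by a multiple of `n`. -/
def shift (n : ℕ) {r : ℕ} (k : ℤ) (x : ℤ × Fin r) : ℤ × Fin r := (x.1 + n * k, x.2)

/-- The position of a node on the boundary of the strip, walked along the top row from left to
right and then back along the bottom row from right to left. -/
def pos (x : ℤ × Fin 2) : ℤ ⊕ₗ ℤᵒᵈ :=
  if x.2 = 0 then Sum.inlₗ x.1 else Sum.inrₗ (OrderDual.toDual x.1)

/-- An affine `n`-diagram up to isotopy. The edges linking two nodes are given by the pairs of their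
end points: `mate` sends a node to the other end of its edge. It is invariant under the shift by `n`,
and no two edges cross: there are no two edges with end points alternating along the boundary of
the strip. Besides there are finitely many infinite horizontal lines, of which only the number
matters; they can be present only if no edge joins the top to the bottom. -/
@[ext]
structure Diagram (n : ℕ) where
  mate : ℤ × Fin 2 → ℤ × Fin 2
  lines : ℕ
  mate_mate : ∀ x, mate (mate x) = x
  mate_ne : ∀ x, mate x ≠ x
  mate_shift : ∀ k x, mate (shift n k x) = shift n k (mate x)
  noncrossing : ∀ x y, ¬ (pos x < pos y ∧ pos y < pos (mate x) ∧ pos (mate x) < pos (mate y))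
  lines_vertical : lines ≠ 0 → ∀ i, (mate (i, 0)).2 = 0

/-- `x` and `y` are joined by a path, all of whose steps are given by maps in `S`. In the sequel `S`
consists of the matchings of some diagrams stacked on each other. -/
def Conn {V : Type*} (S : Set (V → V)) : V → V → Prop :=
  Relation.ReflTransGen fun x y => ∃ f ∈ S, f x = y

section general

variable {V : Type*} {S : Set (V → V)}

theorem Conn.refl (x : V) : Conn S x x := Relation.ReflTransGen.refl

theorem Conn.trans {x y z : V} (h : Conn S x y) (h' : Conn S y z) : Conn S x z :=
  Relation.ReflTransGen.trans h h'

theorem Conn.step {f : V → V} (hf : f ∈ S) (x : V) : Conn S x (f x) :=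
  Relation.ReflTransGen.single ⟨f, hf, rfl⟩

theorem Conn.symm (hS : ∀ f ∈ S, Function.Involutive f) {x y : V} (h : Conn S x y) :
    Conn S y x := by
  induction h with
  | refl => exact Conn.refl _
  | tail _ hbc ih =>
    obtain ⟨f, hf, rfl⟩ := hbc
    refine Conn.trans (Relation.ReflTransGen.single ⟨f, hf, hS f hf _⟩) ih

theorem Conn.mono {S' : Set (V → V)} (h : S ⊆ S') {x y : V} (hc : Conn S x y) : Conn S' x y := by
  induction hc with
  | refl => exact Conn.refl _
  | tail _ hbc ih =>
    obtain ⟨f, hf, rfl⟩ := hbc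
    exact ih.trans (Conn.step (h hf) _)

theorem Conn.map {W : Type*} {S' : Set (W → W)} (φ : V → W)
    (h : ∀ f ∈ S, ∀ x, Conn S' (φ x) (φ (f x))) {x y : V} (hc : Conn S x y) :
    Conn S' (φ x) (φ y) := by
  induction hc with
  | refl => exact Conn.refl _
  | tail _ hbc ih =>
    obtain ⟨f, hf, rfl⟩ := hbc
    exact ih.trans (h f hf _)

theorem Conn.invariant (P : V → Prop) (h : ∀ f ∈ S, ∀ x, P x → P (f x)) {x y : V}
    (hc : Conn S x y) (hx : P x) : P y := by
  induction hc with
  | refl => exact hx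
  | tail _ hbc ih =>
    obtain ⟨f, hf, rfl⟩ := hbc
    exact h f hf _ ih

/-- Two involutions: the component of a fixed point of one of them has exactly one other end. -/
theorem dihedral (α β : Equiv.Perm V) (hα : Function.Involutive α) (hβ : Function.Involutive β)
    (p : V) (hp : β p = p) (hp' : α p ≠ p) (hfin : ∃ m : ℕ, 0 < m ∧ ((α * β) ^ m) p = p) :
    {x | Conn {⇑α, ⇑β} p x}.Finite ∧
    ∃ q, q ≠ p ∧ Conn {⇑α, ⇑β} p q ∧ (α q = q ∨ β q = q) ∧
      ∀ x, Conn {⇑α, ⇑β} p x → (α x = x ∨ β x = x) → x = p ∨ x = q := by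
  set c : Equiv.Perm V := α * β with hc
  have hαα : α * α = 1 := Equiv.ext hα
  have hββ : β * β = 1 := Equiv.ext hβ
  have hαi : α⁻¹ = α := inv_eq_of_mul_eq_one_left hαα
  have hβi : β⁻¹ = β := inv_eq_of_mul_eq_one_left hββ
  have hci : c⁻¹ = β * α := by rw [hc, mul_inv_rev, hαi, hβi]
  have hβc : ∀ k : ℤ, β * c ^ k = c ^ (-k) * β := by
    intro k
    have h1 : β * c * β⁻¹ = c⁻¹ := by rw [hci, hc, mul_assoc, mul_assoc, mul_inv_cancel, mul_one]
    have h2 : (β * c * β⁻¹) ^ k = β * c ^ k * β⁻¹ := conj_zpow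
    rw [h1, inv_zpow'] at h2
    rw [h2]; simp
  have hβk : ∀ k : ℤ, β ((c ^ k) p) = (c ^ (-k)) p := by
    intro k
    have := congrArg (fun e : Equiv.Perm V => e p) (hβc k)
    simpa [hp] using this
  have hαk : ∀ k : ℤ, α ((c ^ k) p) = (c ^ (1 - k)) p := by
    intro k
    have h1 : α = c * β := by rw [hc, mul_assoc, hββ, mul_one]
    have : α ((c ^ k) p) = c (β ((c ^ k) p)) := by
      conv_lhs => rw [h1]
      rfl
    rw [this, hβk, sub_eq_add_neg, zpow_add, zpow_one]; rfl
  have hconn : ∀ x, Conn {⇑α, ⇑β} p x → ∃ k : ℤ, x = (c ^ k) p := by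
    intro x hx
    refine Conn.invariant (fun x => ∃ k : ℤ, x = (c ^ k) p) ?_ hx ⟨0, by simp⟩
    rintro f hf x ⟨k, rfl⟩
    rcases hf with rfl | rfl
    · exact ⟨_, hαk k⟩
    · exact ⟨_, hβk k⟩
  have hcstep : ∀ x, Conn {⇑α, ⇑β} x (c x) := fun x =>
    (Conn.step (S := {⇑α, ⇑β}) (f := β) (by simp) x).trans (Conn.step (f := α) (by simp) (β x))
  have hcn : ∀ k : ℕ, Conn {⇑α, ⇑β} p ((c ^ k) p) := by
    intro k
    induction k with
    | zero => exact Conn.refl _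
    | succ k ih => rw [pow_succ']; exact ih.trans (hcstep _)
  set m := Function.minimalPeriod c p with hm
  have hm0 : 0 < m := by
    obtain ⟨k, hk, e⟩ := hfin
    refine Function.minimalPeriod_pos_of_mem_periodicPts ⟨k, hk, ?_⟩
    rw [Function.IsPeriodicPt, Function.IsFixedPt, Equiv.Perm.iterate_eq_pow]; exact e
  have hdvd : ∀ k : ℤ, (c ^ k) p = p ↔ (m : ℤ) ∣ k := by
    intro k
    exact MulAction.zpow_smul_eq_iff_minimalPeriod_dvd (a := c) (b := p) (n := k)
  have heq : ∀ k l : ℤ, (c ^ k) p = (c ^ l) p ↔ (m : ℤ) ∣ k - l := by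
    intro k l
    rw [← hdvd, sub_eq_neg_add, zpow_add, Equiv.Perm.mul_apply, zpow_neg,
      Equiv.Perm.inv_eq_iff_eq]
  constructor
  · refine Set.Finite.subset (Set.finite_range (fun k : Fin m => (c ^ (k : ℕ)) p)) ?_
    intro x hx
    obtain ⟨k, rfl⟩ := hconn x hx
    have h1 : 0 ≤ k % m := Int.emod_nonneg _ (by omega)
    have h2 : k % m < m := Int.emod_lt_of_pos _ (by omega)
    refine ⟨⟨(k % m).toNat, by omega⟩, ?_⟩
    show (c ^ ((k % m).toNat)) p = (c ^ k) p
    rw [← zpow_natCast, heq, Int.toNat_of_nonneg h1]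
    rw [Int.emod_def]
    exact ⟨- (k / m), by ring⟩
  · obtain ⟨l, hl | hl⟩ := Nat.even_or_odd' m
    · refine ⟨(c ^ l) p, ?_, hcn l, Or.inr ?_, ?_⟩
      · intro e
        have := (hdvd l).1 (by simpa using e)
        have := Int.le_of_dvd (by omega) this
        omega
      · have := hβk l
        rw [zpow_natCast] at this
        rw [this, ← zpow_natCast, heq]
        exact ⟨-1, by rw [hl]; push_cast; ring⟩
      · intro x hx hf
        obtain ⟨k, rfl⟩ := hconn x hx
        rw [hαk, hβk, heq, heq] at hf
        rw [hdvd, ← zpow_natCast, heq]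
        rw [hl] at hf ⊢
        push_cast at hf ⊢
        rcases hf with ⟨d, hd⟩ | ⟨d, hd⟩
        · exfalso
          have : (1 : ℤ) = 2 * (l * d + k) := by linarith
          omega
        · have hk : k = -(l * d) := by linarith
          obtain ⟨e, he | he⟩ := Int.even_or_odd' d
          · left; exact ⟨-e, by rw [hk, he]; ring⟩
          · right; exact ⟨-e - 1, by rw [hk, he]; ring⟩
    · refine ⟨(c ^ (l + 1)) p, ?_, hcn _, Or.inl ?_, ?_⟩
      · intro e
        apply hp'
        have h := hαk (l + 1 : ℕ)
        rw [zpow_natCast, e] at h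
        rw [h, hdvd]
        rw [← zpow_natCast, hdvd] at e
        have := Int.le_of_dvd (by omega) e
        have : l = 0 := by omega
        subst this; simp
      · have := hαk (l + 1 : ℕ)
        rw [zpow_natCast] at this
        rw [this, ← zpow_natCast, heq]
        exact ⟨-1, by rw [hl]; push_cast; ring⟩
      · intro x hx hf
        obtain ⟨k, rfl⟩ := hconn x hx
        rw [hαk, hβk, heq, heq] at hf
        rw [hdvd, ← zpow_natCast, heq]
        rw [hl] at hf ⊢
        push_cast at hf ⊢
        rcases hf with ⟨d, hd⟩ | ⟨d, hd⟩
        · right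
          obtain ⟨e, he | he⟩ := Int.even_or_odd' d
          · exfalso; rw [he] at hd; have : (1:ℤ) = 2 * (k + (2 * l + 1) * e) := by linarith
            omega
          · refine ⟨-e - 1, ?_⟩
            rw [he] at hd; linarith
        · left
          obtain ⟨e, he | he⟩ := Int.even_or_odd' d
          · refine ⟨-e, ?_⟩
            rw [he] at hd; linarith
          · exfalso; rw [he] at hd
            have : (1:ℤ) = 2 * (- k - l - (2 * l + 1) * e) := by linarith
            omega

/-- Eliminating the middle set `M`: the involutions `α, β` may be replaced by the involution
`ε` that joins the two ends of each of their components. -/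
theorem elim_conn {α β γ ε : V → V} (M : Set V)
    (hα : Function.Involutive α) (hβ : Function.Involutive β) (hγ : Function.Involutive γ)
    (h1 : ∀ x ∈ M, γ x = x)
    (h2 : ∀ x, x ∉ M → Conn {α, β} x (ε x) ∧ ε x ∉ M)
    (h3 : ∀ x y, x ∉ M → y ∉ M → Conn {α, β} x y → y = x ∨ y = ε x)
    {x y : V} (hx : x ∉ M) (hy : y ∉ M) : Conn {ε, γ} x y ↔ Conn {α, β, γ} x y := by
  have hab : ∀ f ∈ ({α, β} : Set (V → V)), Function.Involutive f := by
    rintro f (rfl | rfl) <;> assumption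
  have hγM : ∀ x, x ∉ M → γ x ∉ M := by
    intro x hx h
    have := h1 _ h
    rw [hγ x] at this
    exact hx (this ▸ h)
  constructor
  · intro h
    have : Conn {α, β, γ} x y ∧ y ∉ M := by
      refine Conn.invariant (fun y => Conn {α, β, γ} x y ∧ y ∉ M) ?_ h ⟨Conn.refl _, hx⟩
      rintro f (rfl | rfl) z ⟨hz, hzM⟩
      · exact ⟨hz.trans ((h2 z hzM).1.mono (by rintro g (rfl | rfl) <;> simp)), (h2 z hzM).2⟩
      · exact ⟨hz.trans (Conn.step (by simp) z), hγM z hzM⟩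
    exact this.1
  · intro h
    have key : ∀ w, w ∉ M → Conn {α, β} y w → Conn {ε, γ} x w := by
      refine Conn.invariant (fun z => ∀ w, w ∉ M → Conn {α, β} z w → Conn {ε, γ} x w) ?_ h ?_
      · rintro f (rfl | rfl | rfl) z hz w hw hzw
        · exact hz w hw ((Conn.step (by simp) z).trans hzw)
        · exact hz w hw ((Conn.step (by simp) z).trans hzw)
        · by_cases hzM : z ∈ M
          · rw [h1 z hzM] at hzw; exact hz w hw hzw
          · have hz1 := hz z hzM (Conn.refl _)
            have hz2 : Conn {ε, f} x (f z) := hz1.trans (Conn.step (by simp) z)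
            rcases h3 _ _ (hγM z hzM) hw hzw with e | e
            · rw [e]; exact hz2
            · rw [e]; exact hz2.trans (Conn.step (by simp) _)
      · intro w hw hxw
        rcases h3 _ _ hx hw hxw with e | e
        · rw [e]; exact Conn.refl _
        · rw [e]; exact Conn.step (by simp) _
    exact key y hy (Conn.refl _)

theorem elim_inner {α β γ : V → V} (M : Set V) (h1 : ∀ x ∈ M, γ x = x) {x y : V}
    (hx : ∀ z, Conn {α, β} x z → z ∈ M) : Conn {α, β, γ} x y ↔ Conn {α, β} x y := by
  constructor
  · intro h
    refine Conn.invariant (fun y => Conn {α, β} x y) ?_ h (Conn.refl _)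
    rintro f (rfl | rfl | rfl) z hz
    · exact hz.trans (Conn.step (by simp) z)
    · exact hz.trans (Conn.step (by simp) z)
    · show Conn _ _ _
      rw [h1 z (hx z hz)]; exact hz
  · exact Conn.mono (by rintro g (rfl | rfl) <;> simp)

/-- The number of classes of a relation that contain a point with property `P`. -/
noncomputable def classCount {X : Type*} (R : X → X → Prop) (P : X → Prop) : ℕ :=
  ((fun x => {y | R x y}) '' {x | P x}).ncard

theorem class_eq {X : Type*} {R : X → X → Prop} (hR : Equivalence R) {a b : X} :
    {y | R a y} = {y | R b y} ↔ R a b := by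
  constructor
  · intro h
    have : b ∈ {y | R b y} := hR.refl b
    rw [← h] at this; exact this
  · intro h
    ext y
    exact ⟨fun h' => hR.trans (hR.symm h) h', fun h' => hR.trans h h'⟩

theorem classCount_congr {X Y : Type*} {R : X → X → Prop} {R' : Y → Y → Prop}
    (hR : Equivalence R) (hR' : Equivalence R') {P : X → Prop} {Q : Y → Prop} (φ : X → Y)
    (hPQ : ∀ x, P x → Q (φ x)) (hφ : ∀ x x', P x → P x' → (R x x' ↔ R' (φ x) (φ x')))
    (hs : ∀ y, Q y → ∃ x, P x ∧ R' (φ x) y) : classCount R P = classCount R' Q := by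
  unfold classCount
  refine Set.ncard_congr (fun C hC => {y | R' (φ hC.choose) y}) ?_ ?_ ?_
  · intro C hC
    exact ⟨_, hPQ _ hC.choose_spec.1, rfl⟩
  · intro C C' hC hC' h
    have h' := (hφ _ _ hC.choose_spec.1 hC'.choose_spec.1).2 ((class_eq hR').1 h)
    have e1 := hC.choose_spec.2
    have e2 := hC'.choose_spec.2
    rw [← e1, ← e2]
    exact (class_eq hR).2 h'
  · rintro C ⟨y, hy, rfl⟩
    obtain ⟨x, hx, hxy⟩ := hs y hy
    have hC : {z | R x z} ∈ (fun x => {y | R x y}) '' {x | P x} := ⟨x, hx, rfl⟩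
    refine ⟨_, hC, (class_eq hR').2 ?_⟩
    refine hR'.trans ?_ hxy
    exact (hφ _ _ hC.choose_spec.1 hx).1 ((class_eq hR).1 hC.choose_spec.2)

theorem classCount_add {X : Type*} {R : X → X → Prop} (hR : Equivalence R)
    (hfin : (Set.range fun x => {y | R x y}).Finite) {P Q : X → Prop}
    (h : ∀ x y, P x → Q y → ¬ R x y) :
    classCount R (fun x => P x ∨ Q x) = classCount R P + classCount R Q := by
  unfold classCount
  rw [show {x | P x ∨ Q x} = {x | P x} ∪ {x | Q x} from rfl, Set.image_union]
  refine Set.ncard_union_eq ?_ (hfin.subset (Set.image_subset_range _ _))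
    (hfin.subset (Set.image_subset_range _ _))
  rw [Set.disjoint_left]
  rintro C ⟨x, hx, rfl⟩ ⟨y, hy, e⟩
  refine h x y hx hy ?_
  have : y ∈ {z | R y z} := hR.refl y
  rw [show {z | R y z} = {z | R x z} from e] at this
  exact this

end general

section shifts

variable {n r : ℕ}

theorem shift_shift (k l : ℤ) (x : ℤ × Fin r) : shift n k (shift n l x) = shift n (k + l) x := by
  ext
  · simp [shift]; ring
  · rfl

theorem shift_zero (x : ℤ × Fin r) : shift n 0 x = x := by simp [shift]

/-- `S` consists of shift-equivariant involutions. -/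
def Good (n : ℕ) {r : ℕ} (S : Set (ℤ × Fin r → ℤ × Fin r)) : Prop :=
  ∀ f ∈ S, Function.Involutive f ∧ ∀ k x, f (shift n k x) = shift n k (f x)

variable {S : Set (ℤ × Fin r → ℤ × Fin r)}

theorem Good.symm (hS : Good n S) {x y : ℤ × Fin r} (h : Conn S x y) : Conn S y x :=
  Conn.symm (fun f hf => (hS f hf).1) h

theorem Good.shift (hS : Good n S) (k : ℤ) {x y : ℤ × Fin r} (h : Conn S x y) :
    Conn S (shift n k x) (shift n k y) :=
  Conn.map _ (fun f hf x => by rw [← (hS f hf).2]; exact Conn.step hf _) h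

theorem Good.shift_iff (hS : Good n S) (k : ℤ) {x y : ℤ × Fin r} :
    Conn S (AffineTL.shift n k x) (AffineTL.shift n k y) ↔ Conn S x y := by
  refine ⟨fun h => ?_, hS.shift k⟩
  have := hS.shift (-k) h
  simpa [shift_shift, shift_zero] using this

/-- Lying in the same component on the cylinder. -/
def CylConn (n : ℕ) {r : ℕ} (S : Set (ℤ × Fin r → ℤ × Fin r)) (x y : ℤ × Fin r) : Prop :=
  ∃ k : ℤ, Conn S x (shift n k y)

theorem Good.equiv (hS : Good n S) : Equivalence (CylConn n S) where
  refl x := ⟨0, by rw [shift_zero]; exact Conn.refl _⟩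
  symm := by
    rintro x y ⟨k, h⟩
    refine ⟨-k, hS.symm ?_⟩
    simpa [shift_shift, shift_zero] using hS.shift (-k) h
  trans := by
    rintro x y z ⟨k, h⟩ ⟨l, h'⟩
    refine ⟨k + l, h.trans ?_⟩
    rw [← shift_shift]; exact hS.shift k h'

theorem Good.fin [NeZero n] (hS : Good n S) :
    (Set.range fun x => {y | CylConn n S x y}).Finite := by
  refine Set.Finite.subset (Set.finite_range
    (fun p : Fin n × Fin r => {y | CylConn n S ((p.1 : ℕ), p.2) y})) ?_
  rintro _ ⟨x, rfl⟩
  have hn : 0 < (n : ℤ) := by exact_mod_cast NeZero.pos n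
  have h1 := Int.emod_nonneg x.1 hn.ne'
  have h2 := Int.emod_lt_of_pos x.1 hn
  refine ⟨(⟨(x.1 % n).toNat, by omega⟩, x.2), (class_eq hS.equiv).2 ⟨-(x.1 / n), ?_⟩⟩
  have : AffineTL.shift n (-(x.1 / n)) x = (((x.1 % n).toNat : ℤ), x.2) := by
    ext
    · simp only [AffineTL.shift]
      rw [Int.toNat_of_nonneg h1, Int.emod_def]; ring
    · rfl
  rw [this]; exact Conn.refl _

/-- `x` lies on a closed loop or an infinite line: its component avoids `O`, and it is a closed
loop in the strip (`b` true) or not (`b` false). -/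
def OnLoop (n : ℕ) {r : ℕ} (S : Set (ℤ × Fin r → ℤ × Fin r)) (O : Set (ℤ × Fin r)) (b : Prop)
    (x : ℤ × Fin r) : Prop :=
  (∀ y, Conn S x y → y ∉ O) ∧ ((∀ k, Conn S x (shift n k x) → k = 0) ↔ b)

/-- The number of loops (`b` true) or lines (`b` false) on the cylinder. -/
noncomputable def loopCount (n : ℕ) {r : ℕ} (S : Set (ℤ × Fin r → ℤ × Fin r))
    (O : Set (ℤ × Fin r)) (b : Prop) : ℕ :=
  classCount (CylConn n S) (OnLoop n S O b)

theorem onLoop_congr (hS : Good n S) {O : Set (ℤ × Fin r)} {b : Prop} {x y : ℤ × Fin r}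
    (h : Conn S x y) (hx : OnLoop n S O b x) : OnLoop n S O b y := by
  refine ⟨fun z hz => hx.1 z (h.trans hz), ?_⟩
  rw [← hx.2]
  refine forall_congr' fun k => imp_congr_left ?_
  exact ⟨fun h' => (h.trans h').trans (hS.symm (hS.shift k h)),
    fun h' => ((hS.symm h).trans h').trans (hS.shift k h)⟩

theorem elim_loops [NeZero n] {α β γ ε : ℤ × Fin r → ℤ × Fin r} (M O : Set (ℤ × Fin r))
    (hG : Good n {α, β, γ}) (hε : Good n {ε})
    (hM : ∀ k x, shift n k x ∈ M ↔ x ∈ M) (hMO : ∀ x ∈ M, x ∉ O)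
    (h1 : ∀ x ∈ M, γ x = x)
    (h2 : ∀ x, x ∉ M → Conn {α, β} x (ε x) ∧ ε x ∉ M)
    (h3 : ∀ x y, x ∉ M → y ∉ M → Conn {α, β} x y → y = x ∨ y = ε x) (b : Prop) :
    loopCount n {α, β, γ} O b =
      loopCount n {α, β} Mᶜ b + loopCount n {ε, γ} (O ∪ M) b := by
  have hα := hG α (by simp)
  have hβ := hG β (by simp)
  have hγ := hG γ (by simp)
  have hε' := hε ε rfl
  have hG1 : Good n {α, β} := by rintro f (rfl | rfl) <;> assumption
  have hG2 : Good n {ε, γ} := by rintro f (rfl | rfl) <;> assumption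
  have hmono : ∀ {x y}, Conn {α, β} x y → Conn {α, β, γ} x y :=
    fun h => h.mono (by rintro g (rfl | rfl) <;> simp)
  have key := fun {x y} hx hy => elim_conn M hα.1 hβ.1 hγ.1 h1 h2 h3 (x := x) (y := y) hx hy
  have key2 := fun {x y} hx => elim_inner (α := α) (β := β) M h1 (x := x) (y := y) hx
  have hstay : ∀ x y, x ∉ M → Conn {ε, γ} x y → y ∉ M := by
    intro x y hx h
    refine Conn.invariant (fun y => y ∉ M) ?_ h hx
    rintro f (rfl | rfl) z hz
    · exact (h2 z hz).2
    · intro h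
      have := h1 _ h
      rw [hγ.1 z] at this
      exact hz (this ▸ h)
  have hsplit : loopCount n {α, β, γ} O b = classCount (CylConn n {α, β, γ}) (fun x =>
      (OnLoop n {α, β, γ} O b x ∧ ∀ y, Conn {α, β, γ} x y → y ∈ M) ∨
      (OnLoop n {α, β, γ} O b x ∧ ∃ y, Conn {α, β, γ} x y ∧ y ∉ M)) := by
    unfold loopCount
    congr 1
    ext x
    rw [← and_or_left]
    refine ⟨fun h => ⟨h, ?_⟩, fun h => h.1⟩
    by_cases h' : ∀ y, Conn {α, β, γ} x y → y ∈ M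
    · exact Or.inl h'
    · right; push Not at h'; exact h'
  rw [hsplit, classCount_add hG.equiv hG.fin]
  · congr 1
    · refine (classCount_congr hG1.equiv hG.equiv id ?_ ?_ ?_).symm
      · rintro x ⟨hx, hb⟩
        have hx' : ∀ z, Conn {α, β} x z → z ∈ M := fun z hz => by simpa using hx z hz
        refine ⟨⟨fun y hy => hMO _ (hx' y ((key2 hx').1 hy)), ?_⟩,
          fun y hy => hx' y ((key2 hx').1 hy)⟩
        rw [← hb]
        exact forall_congr' fun k => imp_congr_left (key2 hx')
      · rintro x y ⟨hx, -⟩ -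
        have hx' : ∀ z, Conn {α, β} x z → z ∈ M := fun z hz => by simpa using hx z hz
        exact exists_congr fun k => (key2 hx').symm
      · rintro y ⟨hy, hyM⟩
        have hx' : ∀ z, Conn {α, β} y z → z ∈ M := fun z hz => hyM z (hmono hz)
        refine ⟨y, ⟨fun z hz => by simpa using hx' z hz, ?_⟩, hG.equiv.refl _⟩
        rw [← hy.2]
        exact forall_congr' fun k => imp_congr_left (key2 hx').symm
    · refine (classCount_congr hG2.equiv hG.equiv id ?_ ?_ ?_).symm
      · rintro x ⟨hx, hb⟩
        have hxM : x ∉ M := fun h => hx x (Conn.refl _) (Or.inr h)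
        refine ⟨⟨fun y hy hyO => ?_, ?_⟩, x, Conn.refl _, hxM⟩
        · exact hx y ((key hxM (fun h => hMO _ h hyO)).2 hy) (Or.inl hyO)
        · rw [← hb]
          exact forall_congr' fun k =>
            imp_congr_left (key hxM (fun h => hxM ((hM k x).1 h))).symm
      · rintro x y ⟨hx, -⟩ ⟨hy, -⟩
        have hxM : x ∉ M := fun h => hx x (Conn.refl _) (Or.inr h)
        have hyM : y ∉ M := fun h => hy y (Conn.refl _) (Or.inr h)
        exact exists_congr fun k => key hxM (fun h => hyM ((hM k y).1 h))
      · rintro y ⟨hy, x, hyx, hxM⟩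
        have hx := onLoop_congr hG hyx hy
        refine ⟨x, ⟨fun z hz => ?_, ?_⟩, 0, by rw [shift_zero]; exact hG.symm hyx⟩
        · have hzM := hstay x z hxM hz
          rintro (h | h)
          · exact hx.1 z ((key hxM hzM).1 hz) h
          · exact hzM h
        · rw [← hx.2]
          exact forall_congr' fun k =>
            imp_congr_left (key hxM (fun h => hxM ((hM k x).1 h)))
  · rintro x y ⟨-, hx⟩ ⟨-, z, hyz, hz⟩ ⟨k, h⟩
    exact hz ((hM k z).1 (hx _ (h.trans (hG.shift k hyz))))

end shifts

section stacking

variable {n : ℕ}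

/-- Rename the top row to `a` and the bottom row to `b`. -/
def emb {r : ℕ} (a b : Fin r) (x : ℤ × Fin 2) : ℤ × Fin r := (x.1, if x.2 = 0 then a else b)

/-- A matching drawn between the rows `a` and `b`, the other rows being fixed. -/
def place {r : ℕ} (a b : Fin r) (σ : ℤ × Fin 2 → ℤ × Fin 2) (x : ℤ × Fin r) : ℤ × Fin r :=
  if x.2 = a then emb a b (σ (x.1, 0)) else if x.2 = b then emb a b (σ (x.1, 1)) else x

theorem place_emb {r : ℕ} {a b : Fin r} (hab : a ≠ b) (σ : ℤ × Fin 2 → ℤ × Fin 2)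
    (x : ℤ × Fin 2) : place a b σ (emb a b x) = emb a b (σ x) := by
  obtain ⟨i, e⟩ := x
  fin_cases e <;> simp [place, emb, hab.symm]

theorem place_other {r : ℕ} {a b : Fin r} (σ : ℤ × Fin 2 → ℤ × Fin 2)
    {x : ℤ × Fin r} (ha : x.2 ≠ a) (hb : x.2 ≠ b) : place a b σ x = x := by
  simp [place, ha, hb]

theorem emb_cases {r : ℕ} (a b : Fin r) (x : ℤ × Fin r) :
    (∃ y, x = emb a b y) ∨ (x.2 ≠ a ∧ x.2 ≠ b) := by
  obtain ⟨i, e⟩ := x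
  by_cases h : e = a
  · left; exact ⟨(i, 0), by simp [emb, h]⟩
  · by_cases h' : e = b
    · left; exact ⟨(i, 1), by simp [emb, h']⟩
    · right; exact ⟨h, h'⟩

theorem emb_injective {r : ℕ} {a b : Fin r} (hab : a ≠ b) : Function.Injective (emb a b) := by
  rintro ⟨i, e⟩ ⟨j, f⟩ h
  simp only [emb, Prod.mk.injEq] at h
  obtain ⟨rfl, h⟩ := h
  fin_cases e <;> fin_cases f <;> simp_all [hab.symm]

theorem emb_row {r : ℕ} (a b : Fin r) (x : ℤ × Fin 2) : (emb a b x).2 = a ∨ (emb a b x).2 = b := by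
  simp only [emb]; split_ifs <;> simp

theorem emb_shift {r : ℕ} (a b : Fin r) (k : ℤ) (x : ℤ × Fin 2) :
    emb a b (shift n k x) = shift n k (emb a b x) := rfl

theorem good_place {r : ℕ} {a b : Fin r} (hab : a ≠ b) {σ : ℤ × Fin 2 → ℤ × Fin 2}
    (h1 : Function.Involutive σ) (h2 : ∀ k x, σ (shift n k x) = shift n k (σ x)) :
    Good n {place a b σ} := by
  rintro f rfl
  constructor
  · intro x
    rcases emb_cases a b x with ⟨y, rfl⟩ | ⟨ha, hb⟩
    · rw [place_emb hab, place_emb hab, h1]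
    · rw [place_other σ ha hb, place_other σ ha hb]
  · intro k x
    rcases emb_cases a b x with ⟨y, rfl⟩ | ⟨ha, hb⟩
    · rw [← emb_shift, place_emb hab, place_emb hab, h2, emb_shift]
    · rw [place_other σ ha hb, place_other (x := shift n k x) σ ha hb]

theorem Diagram.good (A : Diagram n) {r : ℕ} {a b : Fin r} (hab : a ≠ b) :
    Good n {place a b A.mate} := good_place hab A.mate_mate A.mate_shift

theorem Good.pair {r : ℕ} {f g : ℤ × Fin r → ℤ × Fin r} (hf : Good n {f}) (hg : Good n {g}) :
    Good n {f, g} := by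
  rintro h (rfl | rfl)
  · exact hf _ rfl
  · exact hg _ rfl

/-- The diagrams `A` (rows `0, 1`) and `B` (rows `1, 2`) stacked on each other. -/
def stack (A B : Diagram n) : Set (ℤ × Fin 3 → ℤ × Fin 3) :=
  {place 0 1 A.mate, place 1 2 B.mate}

theorem stack_good (A B : Diagram n) : Good n (stack A B) :=
  (A.good (by decide)).pair (B.good (by decide))

theorem place_fix_iff (A : Diagram n) {r : ℕ} {a b : Fin r} (hab : a ≠ b) {x : ℤ × Fin r} :
    place a b A.mate x = x ↔ x.2 ≠ a ∧ x.2 ≠ b := by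
  constructor
  · intro h
    rcases emb_cases a b x with ⟨y, rfl⟩ | h'
    · rw [place_emb hab] at h
      exact absurd (emb_injective hab h) (A.mate_ne y)
    · exact h'
  · rintro ⟨ha, hb⟩; exact place_other _ ha hb

theorem periodic [NeZero n] {r : ℕ} {α β : Equiv.Perm (ℤ × Fin r)} (hG : Good n {⇑α, ⇑β})
    (p : ℤ × Fin r) (hp : β p = p) : ∃ m : ℕ, 0 < m ∧ ((α * β) ^ m) p = p := by
  have hα := hG α (by simp)
  have hβ := hG β (by simp)
  set c := α * β with hc
  have hcs : ∀ k x, c (shift n k x) = shift n k (c x) := by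
    intro k x; simp only [hc, Equiv.Perm.mul_apply, hβ.2, hα.2]
  have hcsm : ∀ (m : ℕ) k x, (c ^ m) (shift n k x) = shift n k ((c ^ m) x) := by
    intro m
    induction m with
    | zero => intros; rfl
    | succ m ih => intro k x; rw [pow_succ', Equiv.Perm.mul_apply, ih, hcs]; rfl
  obtain ⟨i, j, hij, h⟩ := Finite.exists_ne_map_eq_of_infinite
    (fun k : ℕ => (((((c ^ k) p).1 : ℤ) : ZMod n), ((c ^ k) p).2))
  have main : ∀ i j : ℕ, i < j → ((((c ^ i) p).1 : ℤ) : ZMod n) = (((c ^ j) p).1 : ℤ) →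
      ((c ^ i) p).2 = ((c ^ j) p).2 → ∃ m : ℕ, 0 < m ∧ (c ^ m) p = p := by
    intro i j hij e1 e2
    obtain ⟨k, hk⟩ := (ZMod.intCast_eq_intCast_iff_dvd_sub _ _ n).1 e1
    have h1 : (c ^ j) p = shift n k ((c ^ i) p) := by
      ext
      · simp only [shift]; linarith
      · exact congrArg (fun e : Fin r => (e : ℕ)) e2.symm
    obtain ⟨d, rfl⟩ := Nat.exists_eq_add_of_lt hij
    have h2 : (c ^ (d + 1)) p = shift n k p := by
      rw [← hcsm, add_assoc, pow_add, Equiv.Perm.mul_apply] at h1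
      exact (c ^ i).injective h1
    have hcb : ∀ m : ℕ, ∀ x, (c ^ m) (β ((c ^ m) x)) = β x := by
      intro m
      induction m with
      | zero => intros; rfl
      | succ m ih =>
        intro x
        have h3 : c (β (c ((c ^ m) x))) = β ((c ^ m) x) := by
          show α (β (β (α (β ((c ^ m) x))))) = β ((c ^ m) x)
          rw [hβ.1, hα.1]
        have e1 : ∀ y, (c ^ (m + 1)) y = (c ^ m) (c y) := fun y => by rw [pow_succ]; rfl
        have e2 : ∀ y, (c ^ (m + 1)) y = c ((c ^ m) y) := fun y => by rw [pow_succ']; rfl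
        rw [e2 x, e1, h3, ih]
    refine ⟨d + 1, by omega, ?_⟩
    have h3 := hcb (d + 1) p
    rw [h2, hβ.2, hp, hcsm, h2, shift_shift] at h3
    have h4 := congrArg Prod.fst h3
    simp only [shift] at h4
    have hn : (n : ℤ) ≠ 0 := by exact_mod_cast NeZero.ne n
    have h5 : (n : ℤ) * (k + k) = 0 := by linarith
    have h6 : k = 0 := by
      rcases mul_eq_zero.1 h5 with h | h
      · exact absurd h hn
      · omega
    rw [h2, h6, shift_zero]
  simp only [Prod.mk.injEq] at h
  rcases lt_or_gt_of_ne hij with hlt | hlt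
  · exact main i j hlt h.1 h.2
  · exact main j i hlt h.1.symm h.2.symm

/-- In a stack of two diagrams, every outer node is joined to exactly one other outer node. -/
theorem stack_partner [NeZero n] (A B : Diagram n) (p : ℤ × Fin 3) (hp : p.2 ≠ 1) :
    {x | Conn (stack A B) p x}.Finite ∧ ∃ q, q ≠ p ∧ Conn (stack A B) p q ∧ q.2 ≠ 1 ∧
      ∀ x, Conn (stack A B) p x → x.2 ≠ 1 → x = p ∨ x = q := by
  have hG := stack_good A B
  have hA := hG _ (Or.inl rfl)
  have hB := hG _ (Or.inr rfl)
  have fA : ∀ x : ℤ × Fin 3, place 0 1 A.mate x = x ↔ x.2 ≠ 0 ∧ x.2 ≠ 1 := fun x =>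
    place_fix_iff A (by decide)
  have fB : ∀ x : ℤ × Fin 3, place 1 2 B.mate x = x ↔ x.2 ≠ 1 ∧ x.2 ≠ 2 := fun x =>
    place_fix_iff B (by decide)
  have hout : ∀ x : ℤ × Fin 3, (place 0 1 A.mate x = x ∨ place 1 2 B.mate x = x) ↔ x.2 ≠ 1 := by
    intro x; rw [fA, fB]; generalize x.2 = e; revert e; decide
  let α := hA.1.toPerm
  let β := hB.1.toPerm
  have hS : stack A B = {⇑α, ⇑β} := rfl
  have hS' : stack A B = {⇑β, ⇑α} := by rw [hS, Set.pair_comm]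
  have hrow : p.2 = 0 ∨ p.2 = 2 := by
    revert hp; generalize p.2 = e; revert e; decide
  rcases hrow with h0 | h0
  · have hpB : β p = p := (fB p).2 (by rw [h0]; decide)
    have hpA : α p ≠ p := fun h => ((fA p).1 h).1 h0
    obtain ⟨h1, q, h2, h3, h4, h5⟩ :=
      dihedral α β hA.1 hB.1 p hpB hpA (periodic (n := n) (hS ▸ hG) p hpB)
    rw [← hS] at h1 h3 h5
    exact ⟨h1, q, h2, h3, (hout q).1 h4, fun x hx hx' => h5 x hx ((hout x).2 hx')⟩
  · have hpA : α p = p := (fA p).2 (by rw [h0]; decide)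
    have hpB : β p ≠ p := fun h => ((fB p).1 h).2 h0
    obtain ⟨h1, q, h2, h3, h4, h5⟩ :=
      dihedral β α hB.1 hA.1 p hpA hpB (periodic (n := n) (hS' ▸ hG) p hpA)
    rw [← hS'] at h1 h3 h5
    exact ⟨h1, q, h2, h3, (hout q).1 h4.symm, fun x hx hx' => h5 x hx ((hout x).2 hx').symm⟩

/-- The mate of an outer node in the product: the other end of the path through the stack. -/
noncomputable def compMate (A B : Diagram n) (x : ℤ × Fin 2) : ℤ × Fin 2 :=
  Classical.epsilon fun y => y ≠ x ∧ Conn (stack A B) (emb 0 2 x) (emb 0 2 y)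

theorem emb_ne_one (x : ℤ × Fin 2) : (emb (0 : Fin 3) 2 x).2 ≠ 1 := by
  rcases emb_row (0 : Fin 3) 2 x with h | h <;> rw [h] <;> decide

theorem outer_emb (x : ℤ × Fin 3) (hx : x.2 ≠ 1) : ∃ y, x = emb 0 2 y := by
  rcases emb_cases 0 2 x with h | ⟨h, h'⟩
  · exact h
  · exfalso; revert hx h h'; generalize x.2 = e; revert e; decide

theorem compMate_spec [NeZero n] (A B : Diagram n) (x : ℤ × Fin 2) :
    compMate A B x ≠ x ∧ Conn (stack A B) (emb 0 2 x) (emb 0 2 (compMate A B x)) := by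
  refine Classical.epsilon_spec
    (p := fun y => y ≠ x ∧ Conn (stack A B) (emb 0 2 x) (emb 0 2 y)) ?_
  obtain ⟨-, q, h1, h2, h3, -⟩ := stack_partner A B (emb 0 2 x) (emb_ne_one x)
  obtain ⟨y, rfl⟩ := outer_emb q h3
  exact ⟨y, fun h => h1 (by rw [h]), h2⟩

theorem compMate_unique [NeZero n] (A B : Diagram n) {x y : ℤ × Fin 2}
    (h : Conn (stack A B) (emb 0 2 x) (emb 0 2 y)) : y = x ∨ y = compMate A B x := by
  obtain ⟨-, q, h1, h2, h3, h4⟩ := stack_partner A B (emb 0 2 x) (emb_ne_one x)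
  obtain ⟨h5, h6⟩ := compMate_spec A B x
  have hinj := emb_injective (show (0 : Fin 3) ≠ 2 by decide)
  rcases h4 _ h6 (emb_ne_one _) with e | e
  · exact absurd (hinj e) h5
  · rcases h4 _ h (emb_ne_one _) with e' | e'
    · exact Or.inl (hinj e')
    · exact Or.inr (hinj (e'.trans e.symm))

theorem compMate_mate [NeZero n] (A B : Diagram n) (x : ℤ × Fin 2) :
    compMate A B (compMate A B x) = x := by
  obtain ⟨h1, h2⟩ := compMate_spec A B x
  rcases compMate_unique A B ((stack_good A B).symm h2) with e | e
  · exact absurd e.symm h1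
  · exact e.symm

theorem compMate_shift [NeZero n] (A B : Diagram n) (k : ℤ) (x : ℤ × Fin 2) :
    compMate A B (shift n k x) = shift n k (compMate A B x) := by
  obtain ⟨h1, h2⟩ := compMate_spec A B x
  have h3 := (stack_good A B).shift k h2
  rw [← emb_shift, ← emb_shift] at h3
  rcases compMate_unique A B h3 with e | e
  · exfalso; apply h1
    have := congrArg (shift n (-k)) e
    simpa [shift_shift, shift_zero] using this
  · exact e.symm

end stacking

section planarity

variable {n : ℕ}

@[simp] theorem pos_lt_00 (i j : ℤ) : pos (i, 0) < pos (j, 0) ↔ i < j := by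
  simp [pos]

@[simp] theorem pos_lt_01 (i j : ℤ) : pos (i, 0) < pos (j, 1) := by
  simp [pos]

@[simp] theorem pos_lt_10 (i j : ℤ) : ¬ pos (i, 1) < pos (j, 0) := by
  simp [pos]

@[simp] theorem pos_lt_11 (i j : ℤ) : pos (i, 1) < pos (j, 1) ↔ j < i := by
  simp [pos]

theorem pos_injective : Function.Injective pos := by
  rintro ⟨i, e⟩ ⟨j, f⟩ h
  have h1 := h.not_lt
  have h2 := h.not_gt
  fin_cases e <;> fin_cases f <;> simp at h1 h2 ⊢
  · omega
  · omega

/-- The order relation of the boundary, as a number modulo 2. -/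
def chi (x y : ℤ × Fin 2) : ZMod 2 := if pos x < pos y then 1 else 0

theorem two_zero (a : ZMod 2) : a + a = 0 := CharTwo.add_self_eq_zero a

theorem linear_even {L : Type*} [LinearOrder L] {a b c d : L} (hac : a ≠ c) (had : a ≠ d)
    (hbc : b ≠ c) (hbd : b ≠ d)
    (h1 : ¬ (a < c ∧ c < b ∧ b < d)) (h2 : ¬ (a < d ∧ d < b ∧ b < c))
    (h3 : ¬ (b < c ∧ c < a ∧ a < d)) (h4 : ¬ (b < d ∧ d < a ∧ a < c))
    (h5 : ¬ (c < a ∧ a < d ∧ d < b)) (h6 : ¬ (c < b ∧ b < d ∧ d < a))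
    (h7 : ¬ (d < a ∧ a < c ∧ c < b)) (h8 : ¬ (d < b ∧ b < c ∧ c < a)) :
    (if a < c then (1 : ZMod 2) else 0) + (if a < d then 1 else 0) + (if b < c then 1 else 0) +
      (if b < d then 1 else 0) = 0 := by
  rcases lt_or_gt_of_ne hac with e1 | e1 <;> rcases lt_or_gt_of_ne had with e2 | e2 <;>
  rcases lt_or_gt_of_ne hbc with e3 | e3 <;> rcases lt_or_gt_of_ne hbd with e4 | e4 <;>
  first
  | exact (h1 ⟨e1, e3, e4⟩).elim
  | exact (h2 ⟨e2, e4, e3⟩).elim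
  | exact (h3 ⟨e3, e1, e2⟩).elim
  | exact (h4 ⟨e4, e2, e1⟩).elim
  | exact (h5 ⟨e1, e2, e4⟩).elim
  | exact (h6 ⟨e3, e4, e2⟩).elim
  | exact (h7 ⟨e2, e1, e3⟩).elim
  | exact (h8 ⟨e4, e3, e1⟩).elim
  | (simp only [e1, e2, e3, e4, e1.not_gt, e2.not_gt, e3.not_gt, e4.not_gt, if_true, if_false]
     decide)

theorem Diagram.even (A : Diagram n) {x y : ℤ × Fin 2} (h : y ≠ x) (h' : y ≠ A.mate x) :
    chi x y + chi x (A.mate y) + chi (A.mate x) y + chi (A.mate x) (A.mate y) = 0 := by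
  have key := A.noncrossing
  have h1 : x ≠ A.mate y := fun e => h' (by rw [e, A.mate_mate])
  have h2 : A.mate x ≠ A.mate y := fun e => h (by rw [← A.mate_mate y, ← e, A.mate_mate])
  have k1 := key x y
  have k2 := key x (A.mate y)
  have k3 := key (A.mate x) y
  have k4 := key (A.mate x) (A.mate y)
  have k5 := key y x
  have k6 := key y (A.mate x)
  have k7 := key (A.mate y) x
  have k8 := key (A.mate y) (A.mate x)
  simp only [A.mate_mate] at k1 k2 k3 k4 k5 k6 k7 k8
  have hp := pos_injective
  exact linear_even (hp.ne h.symm) (hp.ne h1) (hp.ne h'.symm) (hp.ne h2) k1 k2 k3 k4 k5 k6 k7 k8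

/-- The embedding of the row `e`. -/
def rowEmb (e : Fin 2) : ℤ ↪ ℤ × Fin 2 where
  toFun i := (i, e)
  inj' _ _ h := congrArg Prod.fst h

@[simp] theorem rowEmb_apply (e : Fin 2) (i : ℤ) : rowEmb e i = (i, e) := rfl

/-- The nodes `R₀` of the upper and `R₁` of the lower row of a layer. -/
def layer (R₀ R₁ : Finset ℤ) : Finset (ℤ × Fin 2) := R₀.map (rowEmb 0) ∪ R₁.map (rowEmb 1)

@[simp] theorem mem_layer_zero {R₀ R₁ : Finset ℤ} {i : ℤ} : (i, 0) ∈ layer R₀ R₁ ↔ i ∈ R₀ := by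
  simp [layer]

@[simp] theorem mem_layer_one {R₀ R₁ : Finset ℤ} {i : ℤ} : (i, 1) ∈ layer R₀ R₁ ↔ i ∈ R₁ := by
  simp [layer]

theorem sum_layer {R₀ R₁ : Finset ℤ} (f : ℤ × Fin 2 → ZMod 2) :
    ∑ x ∈ layer R₀ R₁, f x = ∑ i ∈ R₀, f (i, 0) + ∑ i ∈ R₁, f (i, 1) := by
  rw [layer, Finset.sum_union]
  · simp
  · rw [Finset.disjoint_left]
    simp

theorem sum_closed (A : Diagram n) {F : Finset (ℤ × Fin 2)} (hF : ∀ x ∈ F, A.mate x ∈ F)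
    (f : ℤ × Fin 2 → ZMod 2) (hf : ∀ x ∈ F, f x + f (A.mate x) = 0) : ∑ x ∈ F, f x = 0 :=
  Finset.sum_involution (fun x _ => A.mate x) hf (fun x _ _ => A.mate_ne x) hF
    (fun x _ => A.mate_mate x)

theorem sum_cross (A : Diagram n) {F G : Finset (ℤ × Fin 2)} (hF : ∀ x ∈ F, A.mate x ∈ F)
    (hG : ∀ x ∈ G, A.mate x ∈ G) (hd : Disjoint F G) :
    ∑ x ∈ F, ∑ y ∈ G, chi x y = 0 := by
  refine sum_closed A hF _ fun x hx => ?_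
  rw [← Finset.sum_add_distrib]
  refine sum_closed A hG _ fun y hy => ?_
  have h1 : y ≠ x := fun e => Finset.disjoint_left.1 hd hx (e ▸ hy)
  have h2 : y ≠ A.mate x := fun e => Finset.disjoint_left.1 hd (hF x hx) (e ▸ hy)
  rw [← A.even h1 h2]; ring

theorem card_layer (A : Diagram n) {R₀ R₁ : Finset ℤ}
    (hF : ∀ x ∈ layer R₀ R₁, A.mate x ∈ layer R₀ R₁) :
    (R₀.card : ZMod 2) = R₁.card := by
  have h := sum_closed A hF (fun _ => 1) (fun _ _ => two_zero 1)
  rw [sum_layer] at h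
  simp only [Finset.sum_const, nsmul_eq_mul, mul_one] at h
  rw [eq_neg_of_add_eq_zero_left h, ZMod.neg_eq_self_mod_two]

/-- The nodes of row `e` in a finite set of nodes. -/
noncomputable def rowSet {C : Set (ℤ × Fin 3)} (hC : C.Finite) (e : Fin 3) : Finset ℤ :=
  (hC.preimage (f := fun i : ℤ => (i, e)) (fun _ _ _ _ h => by simpa using h)).toFinset

@[simp] theorem mem_rowSet {C : Set (ℤ × Fin 3)} {hC : C.Finite} {e : Fin 3} {i : ℤ} :
    i ∈ rowSet hC e ↔ (i, e) ∈ C := by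
  simp [rowSet]

theorem mem_layer_rowSet {C : Set (ℤ × Fin 3)} {hC : C.Finite} {a b : Fin 3} {x : ℤ × Fin 2} :
    x ∈ layer (rowSet hC a) (rowSet hC b) ↔ emb a b x ∈ C := by
  obtain ⟨i, e⟩ := x
  fin_cases e <;> simp [emb]

variable {A B : Diagram n} {p q : ℤ × Fin 3}

theorem closedA {hC : {x | Conn (stack A B) p x}.Finite} :
    ∀ x ∈ layer (rowSet hC 0) (rowSet hC 1), A.mate x ∈ layer (rowSet hC 0) (rowSet hC 1) := by
  intro x hx
  rw [mem_layer_rowSet] at hx ⊢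
  rw [← place_emb (by decide)]
  exact Conn.trans hx (Conn.step (by simp [stack]) _)

theorem closedB {hC : {x | Conn (stack A B) p x}.Finite} :
    ∀ x ∈ layer (rowSet hC 1) (rowSet hC 2), B.mate x ∈ layer (rowSet hC 1) (rowSet hC 2) := by
  intro x hx
  rw [mem_layer_rowSet] at hx ⊢
  rw [← place_emb (by decide)]
  exact Conn.trans hx (Conn.step (by simp [stack]) _)

theorem disjoint_layers (hp : {x | Conn (stack A B) p x}.Finite)
    (hq : {x | Conn (stack A B) q x}.Finite) (h : ¬ Conn (stack A B) p q) (a b : Fin 3) :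
    Disjoint (layer (rowSet hp a) (rowSet hp b)) (layer (rowSet hq a) (rowSet hq b)) := by
  rw [Finset.disjoint_left]
  intro x hx hy
  rw [mem_layer_rowSet] at hx hy
  exact h (Conn.trans hx ((stack_good A B).symm hy))

theorem comp_even [NeZero n] (A B : Diagram n) {x y : ℤ × Fin 2} (h : y ≠ x)
    (h' : y ≠ compMate A B x) :
    chi x y + chi x (compMate A B y) + chi (compMate A B x) y +
      chi (compMate A B x) (compMate A B y) = 0 := by
  have hnc : ¬ Conn (stack A B) (emb 0 2 x) (emb 0 2 y) := fun hc => by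
    rcases compMate_unique A B hc with e | e
    · exact h e
    · exact h' e
  have hx := (stack_partner A B (emb 0 2 x) (emb_ne_one x)).1
  have hy := (stack_partner A B (emb 0 2 y) (emb_ne_one y)).1
  have outer : ∀ z (hz : {w | Conn (stack A B) (emb 0 2 z) w}.Finite),
      layer (rowSet hz 0) (rowSet hz 2) = {z, compMate A B z} := by
    intro z hz
    ext w
    rw [mem_layer_rowSet, Finset.mem_insert, Finset.mem_singleton]
    constructor
    · exact compMate_unique A B
    · rintro (rfl | rfl)
      · exact Conn.refl _
      · exact (compMate_spec A B z).2
  have goal : ∑ z ∈ layer (rowSet hx 0) (rowSet hx 2), ∑ w ∈ layer (rowSet hy 0) (rowSet hy 2),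
      chi z w = 0 := by
    have e1 := sum_cross A closedA closedA (disjoint_layers hx hy hnc 0 1)
    have e2 := sum_cross B closedB closedB (disjoint_layers hx hy hnc 1 2)
    have d := disjoint_layers hx hy hnc 1 1
    have c1 := card_layer A (closedA (hC := hx))
    have c2 := card_layer B (closedB (hC := hx))
    have c3 := card_layer A (closedA (hC := hy))
    have c4 := card_layer B (closedB (hC := hy))
    generalize rowSet hx 0 = F0 at *
    generalize rowSet hx 1 = F1 at *
    generalize rowSet hx 2 = F2 at *
    generalize rowSet hy 0 = G0 at *
    generalize rowSet hy 1 = G1 at *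
    generalize rowSet hy 2 = G2 at *
    simp only [sum_layer, chi, pos_lt_00, pos_lt_01, pos_lt_10, pos_lt_11, if_true, if_false,
      Finset.sum_add_distrib, Finset.sum_const, nsmul_eq_mul, mul_one, mul_zero] at *
    have e3 : (∑ i ∈ F1, ∑ j ∈ G1, if i < j then (1 : ZMod 2) else 0) +
        (∑ i ∈ F1, ∑ j ∈ G1, if j < i then (1 : ZMod 2) else 0) = F1.card * G1.card := by
      rw [← Finset.sum_add_distrib]
      have : ∀ i ∈ F1, (∑ j ∈ G1, if i < j then (1 : ZMod 2) else 0) +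
          (∑ j ∈ G1, if j < i then (1 : ZMod 2) else 0) = G1.card := by
        intro i hi
        rw [← Finset.sum_add_distrib]
        rw [Finset.sum_congr rfl (g := fun _ => (1 : ZMod 2))]
        · simp
        · intro j hj
          have hij : i ≠ j := by
            rintro rfl
            exact Finset.disjoint_left.1 d (mem_layer_zero.2 hi) (mem_layer_zero.2 hj)
          rcases lt_or_gt_of_ne hij with e | e <;> simp [e, e.not_gt]
      rw [Finset.sum_congr rfl this]
      simp
    rw [← c4, ← c3] at e2 ⊢
    rw [← c3] at e1 e3
    rw [← c1] at e2 e3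
    linear_combination e1 + e2 - e3 - two_zero ((F0.card : ZMod 2) * G0.card)
  rw [outer, outer, Finset.sum_pair (compMate_spec A B x).1.symm,
    Finset.sum_pair (compMate_spec A B y).1.symm, Finset.sum_pair (compMate_spec A B y).1.symm]
    at goal
  rw [← goal]; ring

/-- If there is an infinite line in the stack, then no path joins the top to the bottom. -/
theorem line_no_vertical [NeZero n] (A B : Diagram n) {w : ℤ × Fin 3}
    (hw : OnLoop n (stack A B) {x | x.2 ≠ 1} False w) (i : ℤ) : (compMate A B (i, 0)).2 = 0 := by
  by_contra hv
  have hx := (stack_partner A B (emb 0 2 (i, 0)) (emb_ne_one _)).1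
  obtain ⟨j, hj⟩ : ∃ j, compMate A B (i, 0) = (j, 1) := by
    refine ⟨(compMate A B (i, 0)).1, ?_⟩
    ext
    · rfl
    · have : ∀ e : Fin 2, e ≠ 0 → e = 1 := by decide
      rw [this _ hv]
  have hG := stack_good A B
  have hconn := (compMate_spec A B (i, 0)).2
  have hw1 : ∀ z, Conn (stack A B) w z → z.2 = 1 := fun z hz => by simpa using hw.1 z hz
  have hdis : ∀ z, Conn (stack A B) w z → ¬ Conn (stack A B) (emb 0 2 (i, 0)) z := by
    intro z hz h
    have := hw1 _ (hz.trans (hG.symm h))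
    simp [emb] at this
  have hF0 : rowSet hx 0 = {i} := by
    ext k
    rw [mem_rowSet, Finset.mem_singleton]
    constructor
    · intro h
      have h' : Conn (stack A B) (emb 0 2 (i, 0)) (emb 0 2 (k, 0)) := h
      rcases compMate_unique A B h' with e | e
      · simpa using e
      · rw [hj] at e; simp at e
    · rintro rfl; exact Conn.refl _
  have hcard := card_layer A (closedA (hC := hx))
  rw [hF0] at hcard
  simp only [Finset.card_singleton, Nat.cast_one] at hcard
  set F := rowSet hx 1 with hF
  let side : ℤ → ZMod 2 := fun m => ∑ k ∈ F, if m < k then 1 else 0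
  have hmem : ∀ z, Conn (stack A B) w z → z.1 ∉ F := by
    intro z hz h
    rw [hF, mem_rowSet] at h
    have e : z = (z.1, 1) := by ext; · rfl
                                · rw [hw1 z hz]
    rw [← e] at h
    exact hdis z hz h
  have hside' : ∀ z, Conn (stack A B) w z →
      (∑ k ∈ F, if k < z.1 then (1 : ZMod 2) else 0) = F.card + side z.1 := by
    intro z hz
    have : (∑ k ∈ F, if k < z.1 then (1 : ZMod 2) else 0) + side z.1 = F.card := by
      rw [← Finset.sum_add_distrib, Finset.sum_congr rfl (g := fun _ => (1 : ZMod 2))]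
      · simp
      · intro k hk
        have hk' : k ≠ z.1 := fun e => hmem z hz (e ▸ hk)
        rcases lt_or_gt_of_ne hk' with e | e <;> simp [e, e.not_gt]
    rw [← this, add_assoc, two_zero, add_zero]
  have hconst : ∀ z, Conn (stack A B) w z → side z.1 = side w.1 ∧ Conn (stack A B) w z := by
    intro z hz
    refine Conn.invariant (fun z => side z.1 = side w.1 ∧ Conn (stack A B) w z) ?_ hz
      ⟨rfl, Conn.refl _⟩
    rintro f hf z ⟨h1, h2⟩
    have h3 : Conn (stack A B) w (f z) := h2.trans (Conn.step hf z)
    refine ⟨?_, h3⟩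
    rw [← h1]
    have hz1 : z = (z.1, 1) := by ext; · rfl
                                  · rw [hw1 z h2]
    rcases hf with rfl | rfl
    · have e1 : place 0 1 A.mate z = emb 0 1 (A.mate (z.1, 1)) := by
        conv_lhs => rw [hz1]
        exact place_emb (by decide) A.mate (z.1, 1)
      have e2 : A.mate (z.1, 1) = ((place 0 1 A.mate z).1, 1) := by
        ext
        · rw [e1]; rfl
        · have := hw1 _ h3
          rw [e1] at this
          simp only [emb] at this
          split_ifs at this with h
          · exact absurd this (by decide)
          · have h0 : ∀ e : Fin 2, e ≠ 0 → e = 1 := by decide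
            rw [h0 _ h]
      have hs := sum_closed A (closedA (hC := hx))
        (fun x => chi x (z.1, 1) + chi x (A.mate (z.1, 1))) ?_
      · rw [e2, sum_layer, hF0] at hs
        simp only [chi, pos_lt_01, pos_lt_11, if_true, Finset.sum_singleton, two_zero, zero_add,
          Finset.sum_add_distrib] at hs
        rw [← ZMod.neg_eq_self_mod_two (side z.1)]
        exact eq_neg_of_add_eq_zero_right hs
      · intro x hx'
        have h4 : (z.1, 1) ∉ layer (rowSet hx 0) (rowSet hx 1) := by
          rw [mem_layer_one]; exact hmem z h2
        have := A.even (x := x) (y := (z.1, 1)) (fun e => h4 (e ▸ hx'))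
          (fun e => h4 (e ▸ closedA x hx'))
        rw [← this]; ring
    · have e1 : place 1 2 B.mate z = emb 1 2 (B.mate (z.1, 0)) := by
        conv_lhs => rw [hz1]
        exact place_emb (by decide) B.mate (z.1, 0)
      have e2 : B.mate (z.1, 0) = ((place 1 2 B.mate z).1, 0) := by
        ext
        · rw [e1]; rfl
        · have := hw1 _ h3
          rw [e1] at this
          simp only [emb] at this
          split_ifs at this with h
          · rw [h]
          · exact absurd this (by decide)
      have hs := sum_closed B (closedB (hC := hx))
        (fun x => chi x (z.1, 0) + chi x (B.mate (z.1, 0))) ?_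
      · rw [e2, sum_layer] at hs
        simp only [chi, pos_lt_00, pos_lt_10, if_false, add_zero, Finset.sum_const_zero,
          Finset.sum_add_distrib] at hs
        rw [← hF, hside' z h2, hside' _ h3] at hs
        have h5 : side z.1 + side (place 1 2 B.mate z).1 = 0 := by
          have := two_zero (F.card : ZMod 2)
          linear_combination hs - this
        rw [← ZMod.neg_eq_self_mod_two (side z.1)]
        exact eq_neg_of_add_eq_zero_right h5
      · intro x hx'
        have h4 : (z.1, 0) ∉ layer (rowSet hx 1) (rowSet hx 2) := by
          rw [mem_layer_zero]; exact hmem z h2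
        have := B.even (x := x) (y := (z.1, 0)) (fun e => h4 (e ▸ hx'))
          (fun e => h4 (e ▸ closedB x hx'))
        rw [← this]; ring
  obtain ⟨k, hk, hk0⟩ : ∃ k, Conn (stack A B) w (shift n k w) ∧ k ≠ 0 := by
    have := hw.2
    rw [iff_false] at this
    push Not at this
    exact this
  have hmul : ∀ t : ℕ, Conn (stack A B) w (shift n (k * t) w) := by
    intro t
    induction t with
    | zero => simpa [shift_zero] using Conn.refl w
    | succ t ih =>
      refine ih.trans ?_
      rw [show k * ((t + 1 : ℕ) : ℤ) = k * t + k by push_cast; ring, ← shift_shift]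
      exact hG.shift _ hk
  have hmulZ : ∀ t : ℤ, Conn (stack A B) w (shift n (k * t) w) := by
    intro t
    obtain ⟨m, rfl | rfl⟩ := t.eq_nat_or_neg
    · exact hmul m
    · have := hG.symm (hG.shift (k * -m) (hmul m))
      simpa [shift_shift, shift_zero] using this
  obtain ⟨b, hb⟩ : ∃ b : ℕ, ∀ k ∈ F, |k| ≤ b := by
    refine ⟨∑ k ∈ F, k.natAbs, fun k hk => ?_⟩
    rw [Int.abs_eq_natAbs]
    exact_mod_cast Finset.single_le_sum (f := Int.natAbs) (fun _ _ => Nat.zero_le _) hk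
  have hn : 0 < (n : ℤ) := by exact_mod_cast NeZero.pos n
  have hkk : 0 < n * (k * k) := mul_pos hn (mul_self_pos.2 hk0)
  set s : ℤ := b + |w.1| + 1 with hs
  have hs0 : 0 < s := by positivity
  have ha := neg_abs_le w.1
  have ha' := le_abs_self w.1
  have h1 := (hconst _ (hmulZ (k * s))).1
  have h2 := (hconst _ (hmulZ (k * (-s)))).1
  have hle : s ≤ n * (k * k) * s := by nlinarith
  have v1 : side (shift n (k * (k * s)) w).1 = 0 := by
    refine Finset.sum_eq_zero fun l hl => if_neg ?_
    have := (abs_le.1 (hb l hl)).2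
    simp only [shift]
    have e : (n : ℤ) * (k * (k * s)) = n * (k * k) * s := by ring
    rw [e]; linarith
  have v2 : side (shift n (k * (k * -s)) w).1 = 1 := by
    have : ∀ l ∈ F, (if (shift n (k * (k * -s)) w).1 < l then (1 : ZMod 2) else 0) = 1 := by
      intro l hl
      refine if_pos ?_
      have := (abs_le.1 (hb l hl)).1
      simp only [shift]
      have e : (n : ℤ) * (k * (k * -s)) = -(n * (k * k) * s) := by ring
      rw [e]; linarith
    show ∑ l ∈ F, _ = _
    rw [Finset.sum_congr rfl this]
    rw [Finset.sum_const, nsmul_eq_mul, mul_one, ← hcard]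
  rw [v1] at h1
  rw [v2, ← h1] at h2
  exact absurd h2 (by decide)

end planarity

section product

variable {n : ℕ} [NeZero n]

/-- The number of closed loops in the cylinder arising when `A` is put on top of `B`. -/
noncomputable def Diagram.loops (A B : Diagram n) : ℕ :=
  loopCount n (stack A B) {x | x.2 ≠ 1} True

/-- The number of new lines around the cylinder arising when `A` is put on top of `B`. -/
noncomputable def Diagram.newLines (A B : Diagram n) : ℕ :=
  loopCount n (stack A B) {x | x.2 ≠ 1} False

theorem exists_of_loopCount {r : ℕ} {S : Set (ℤ × Fin r → ℤ × Fin r)} {O : Set (ℤ × Fin r)}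
    {b : Prop} (h : loopCount n S O b ≠ 0) : ∃ w, OnLoop n S O b w := by
  by_contra! hw
  apply h
  have : {x | OnLoop n S O b x} = ∅ := by
    ext x; simp [hw x]
  simp [loopCount, classCount, this]

theorem mate_up (A : Diagram n) (h : ∀ i, (A.mate (i, 0)).2 = 0) (i : ℤ) :
    (A.mate (i, 1)).2 = 1 := by
  by_contra h'
  have h0 : ∀ e : Fin 2, e ≠ 1 → e = 0 := by decide
  have h1 := h (A.mate (i, 1)).1
  have e : ((A.mate (i, 1)).1, 0) = A.mate (i, 1) := Prod.ext rfl (by simp only [h0 _ h'])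
  rw [e, A.mate_mate] at h1
  exact absurd h1 (show ¬ (1 : Fin 2) = 0 by decide)

theorem compMate_top (A B : Diagram n) {i j : ℤ} (h : A.mate (i, 0) = (j, 0)) :
    compMate A B (i, 0) = (j, 0) := by
  have h1 : Conn (stack A B) (emb 0 2 (i, 0)) (emb 0 2 (j, 0)) := by
    have := Conn.step (S := stack A B) (f := place 0 1 A.mate) (by simp [stack])
      (emb 0 1 (i, 0))
    rw [place_emb (by decide), h] at this
    exact this
  rcases compMate_unique A B h1 with e | e
  · exact absurd (h.trans e) (A.mate_ne _)
  · exact e.symm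

theorem compMate_bot (A B : Diagram n) {i j : ℤ} (h : B.mate (i, 1) = (j, 1)) :
    compMate A B (i, 1) = (j, 1) := by
  have h1 : Conn (stack A B) (emb 0 2 (i, 1)) (emb 0 2 (j, 1)) := by
    have := Conn.step (S := stack A B) (f := place 1 2 B.mate) (by simp [stack])
      (emb 1 2 (i, 1))
    rw [place_emb (by decide), h] at this
    exact this
  rcases compMate_unique A B h1 with e | e
  · exact absurd (h.trans e) (B.mate_ne _)
  · exact e.symm

/-- The diagram obtained by putting `A` on top of `B` and removing the closed loops. -/
noncomputable def Diagram.comp (A B : Diagram n) : Diagram n where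
  mate := compMate A B
  lines := A.lines + B.lines + A.newLines B
  mate_mate := compMate_mate A B
  mate_ne x := (compMate_spec A B x).1
  mate_shift := compMate_shift A B
  noncrossing x y := by
    rintro ⟨h1, h2, h3⟩
    have := comp_even A B (x := x) (y := y) (fun e => h1.ne (by rw [e])) (fun e => h2.ne (by rw [e]))
    simp only [chi, h1, h3, h1.trans (h2.trans h3), h2.not_gt, if_true, if_false] at this
    exact absurd this (by decide)
  lines_vertical h i := by
    by_cases hA : A.lines = 0
    · by_cases hB : B.lines = 0
      · have h' : A.newLines B ≠ 0 := by omega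
        obtain ⟨w, hw⟩ := exists_of_loopCount h'
        exact line_no_vertical A B hw i
      · by_contra hv
        have h0 : ∀ e : Fin 2, e ≠ 0 → e = 1 := by decide
        have e1 : compMate A B (i, 0) = ((compMate A B (i, 0)).1, 1) := Prod.ext rfl (by simp only [h0 _ hv])
        have e2 : B.mate ((compMate A B (i, 0)).1, 1) =
            ((B.mate ((compMate A B (i, 0)).1, 1)).1, 1) := Prod.ext rfl (by simp only [mate_up B (B.lines_vertical hB) _])
        have e3 := compMate_bot A B e2
        rw [← e1, compMate_mate] at e3
        simp at e3
    · have e1 : A.mate (i, 0) = ((A.mate (i, 0)).1, 0) := Prod.ext rfl (by simp only [A.lines_vertical hA _])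
      rw [compMate_top A B e1]

section rows

variable {r : ℕ} {a b c : Fin r}

/-- Renaming three rows. -/
def rows (a b c : Fin r) (x : ℤ × Fin 3) : ℤ × Fin r := (x.1, ![a, b, c] x.2)

theorem rows_injective (hab : a ≠ b) (hac : a ≠ c) (hbc : b ≠ c) :
    Function.Injective (rows a b c) := by
  rintro ⟨i, e⟩ ⟨j, f⟩ h
  simp only [rows, Prod.mk.injEq] at h
  obtain ⟨rfl, h⟩ := h
  fin_cases e <;> fin_cases f <;> simp_all [hab.symm, hac.symm, hbc.symm]

theorem rows_place01 (hab : a ≠ b) (hac : a ≠ c) (hbc : b ≠ c) (σ : ℤ × Fin 2 → ℤ × Fin 2)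
    (x : ℤ × Fin 3) : rows a b c (place 0 1 σ x) = place a b σ (rows a b c x) := by
  have he : ∀ y, rows a b c (emb 0 1 y) = emb a b y := by
    rintro ⟨i, e⟩; fin_cases e <;> simp [rows, emb]
  rcases emb_cases 0 1 x with ⟨y, rfl⟩ | ⟨h1, h2⟩
  · rw [place_emb (by decide), he, he, place_emb hab]
  · rw [place_other σ h1 h2]
    have h3 : x.2 = 2 := by revert h1 h2; generalize x.2 = e; revert e; decide
    rw [place_other] <;> simp [rows, h3, hac.symm, hbc.symm]

theorem rows_place12 (hab : a ≠ b) (hac : a ≠ c) (hbc : b ≠ c) (σ : ℤ × Fin 2 → ℤ × Fin 2)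
    (x : ℤ × Fin 3) : rows a b c (place 1 2 σ x) = place b c σ (rows a b c x) := by
  have he : ∀ y, rows a b c (emb 1 2 y) = emb b c y := by
    rintro ⟨i, e⟩; fin_cases e <;> simp [rows, emb]
  rcases emb_cases 1 2 x with ⟨y, rfl⟩ | ⟨h1, h2⟩
  · rw [place_emb (by decide), he, he, place_emb hbc]
  · rw [place_other σ h1 h2]
    have h3 : x.2 = 0 := by revert h1 h2; generalize x.2 = e; revert e; decide
    rw [place_other] <;> simp [rows, h3, hab, hac]

theorem conn_rows_image (hab : a ≠ b) (hac : a ≠ c) (hbc : b ≠ c) (A B : Diagram n)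
    {x : ℤ × Fin 3} {y : ℤ × Fin r}
    (h : Conn {place a b A.mate, place b c B.mate} (rows a b c x) y) :
    ∃ z, y = rows a b c z ∧ Conn (stack A B) x z := by
  refine Conn.invariant (fun y => ∃ z, y = rows a b c z ∧ Conn (stack A B) x z) ?_ h
    ⟨x, rfl, Conn.refl _⟩
  rintro f (rfl | rfl) _ ⟨z, rfl, hz⟩
  · exact ⟨_, (rows_place01 hab hac hbc _ _).symm, hz.trans (Conn.step (by simp [stack]) _)⟩
  · exact ⟨_, (rows_place12 hab hac hbc _ _).symm, hz.trans (Conn.step (by simp [stack]) _)⟩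

theorem conn_rows (hab : a ≠ b) (hac : a ≠ c) (hbc : b ≠ c) (A B : Diagram n)
    {x y : ℤ × Fin 3} :
    Conn {place a b A.mate, place b c B.mate} (rows a b c x) (rows a b c y) ↔
      Conn (stack A B) x y := by
  constructor
  · intro h
    obtain ⟨z, e, hz⟩ := conn_rows_image hab hac hbc A B h
    rw [rows_injective hab hac hbc e]; exact hz
  · refine Conn.map _ ?_
    rintro f (rfl | rfl) z
    · rw [rows_place01 hab hac hbc]; exact Conn.step (by simp) _
    · rw [rows_place12 hab hac hbc]; exact Conn.step (by simp) _

theorem loopCount_rows (hab : a ≠ b) (hac : a ≠ c) (hbc : b ≠ c) (A B : Diagram n) (t : Prop) :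
    loopCount n {place a b A.mate, place b c B.mate} {x : ℤ × Fin r | x.2 ≠ b} t =
      loopCount n (stack A B) {x | x.2 ≠ 1} t := by
  have key := fun {x y} => conn_rows (x := x) (y := y) hab hac hbc A B
  have hG : Good n {place a b A.mate, place b c B.mate} := (A.good hab).pair (B.good hbc)
  have hrow : ∀ x : ℤ × Fin 3, (rows a b c x).2 = b ↔ x.2 = 1 := by
    rintro ⟨i, e⟩
    fin_cases e <;> simp [rows, hab, hbc.symm]
  have hon : ∀ x, OnLoop n (stack A B) {x | x.2 ≠ 1} t x ↔
      OnLoop n {place a b A.mate, place b c B.mate} {x : ℤ × Fin r | x.2 ≠ b} t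
        (rows a b c x) := by
    intro x
    refine and_congr ?_ (iff_congr (forall_congr' fun k => imp_congr_left ?_) Iff.rfl)
    · constructor
      · intro h y hy
        obtain ⟨z, rfl, hz⟩ := conn_rows_image hab hac hbc A B hy
        have := h z hz
        simpa [hrow] using this
      · intro h y hy
        have := h _ (key.2 hy)
        simpa [hrow] using this
    · exact key.symm
  refine (classCount_congr (stack_good A B).equiv hG.equiv (rows a b c) ?_ ?_ ?_).symm
  · intro x hx; exact (hon x).1 hx
  · intro x y _ _
    exact exists_congr fun k => key.symm
  · intro y hy
    have h1 : y.2 = b := by simpa using hy.1 y (Conn.refl _)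
    have h2 : y = rows a b c (y.1, 1) := by
      ext
      · rfl
      · simp [rows, h1]
    refine ⟨(y.1, 1), (hon _).2 (h2 ▸ hy), ?_⟩
    rw [← h2]; exact hG.equiv.refl _

theorem rows_emb (x : ℤ × Fin 2) : rows a b c (emb 0 2 x) = emb a c x := by
  obtain ⟨i, e⟩ := x
  fin_cases e <;> simp [rows, emb]

theorem comp_h2 (hab : a ≠ b) (hac : a ≠ c) (hbc : b ≠ c) (A B : Diagram n) (x : ℤ × Fin r)
    (hx : x.2 ≠ b) : Conn {place a b A.mate, place b c B.mate} x (place a c (A.comp B).mate x) ∧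
      (place a c (A.comp B).mate x).2 ≠ b := by
  rcases emb_cases a c x with ⟨y, rfl⟩ | ⟨h1, h2⟩
  · rw [place_emb hac]
    constructor
    · rw [← rows_emb (b := b), ← rows_emb (b := b), conn_rows hab hac hbc]
      exact (compMate_spec A B y).2
    · rcases emb_row a c ((A.comp B).mate y) with e | e <;> rw [e]
      · exact hab
      · exact hbc.symm
  · rw [place_other _ h1 h2]
    exact ⟨Conn.refl _, hx⟩

theorem comp_h3 (hab : a ≠ b) (hac : a ≠ c) (hbc : b ≠ c) (A B : Diagram n) (x y : ℤ × Fin r)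
    (hx : x.2 ≠ b) (hy : y.2 ≠ b) (h : Conn {place a b A.mate, place b c B.mate} x y) :
    y = x ∨ y = place a c (A.comp B).mate x := by
  rcases emb_cases a c x with ⟨z, rfl⟩ | ⟨h1, h2⟩
  · rw [place_emb hac]
    rw [← rows_emb (b := b)] at h
    obtain ⟨w, rfl, hw⟩ := conn_rows_image hab hac hbc A B h
    have hw1 : w.2 ≠ 1 := by
      rintro e; apply hy; simp [rows, e]
    obtain ⟨w, rfl⟩ := outer_emb w hw1
    rw [rows_emb]
    rcases compMate_unique A B hw with e | e
    · left; rw [e]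
    · right; rw [e]; rfl
  · left
    refine Conn.invariant (fun y => y = x) ?_ h rfl
    rintro f (rfl | rfl) z rfl
    · exact place_other _ h1 hx
    · exact place_other _ hx h2

end rows

section assoc

variable (A B C : Diagram n)

/-- Three diagrams stacked on each other. -/
def stack4 : Set (ℤ × Fin 4 → ℤ × Fin 4) :=
  {place 0 1 A.mate, place 1 2 B.mate, place 2 3 C.mate}

theorem stack4_good : Good n (stack4 A B C) := by
  rintro f (rfl | rfl | rfl)
  · exact A.good (by decide) _ rfl
  · exact B.good (by decide) _ rfl
  · exact C.good (by decide) _ rfl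

theorem stack4_rev :
    ({place 2 3 C.mate, place 1 2 B.mate, place 0 1 A.mate} : Set (ℤ × Fin 4 → ℤ × Fin 4)) =
      stack4 A B C := by
  ext f; simp only [stack4, Set.mem_insert_iff, Set.mem_singleton_iff]; tauto

theorem stack4_left {x y : ℤ × Fin 4} (hx : x.2 ≠ 1) (hy : y.2 ≠ 1) :
    Conn {place 0 2 (A.comp B).mate, place 2 3 C.mate} x y ↔ Conn (stack4 A B C) x y :=
  elim_conn {x : ℤ × Fin 4 | x.2 = 1} (A.good (n := n) (by decide) _ rfl).1
    (B.good (n := n) (by decide) _ rfl).1 (C.good (n := n) (by decide) _ rfl).1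
    (fun x (hx : x.2 = 1) => place_other _ (by rw [hx]; decide) (by rw [hx]; decide))
    (comp_h2 (by decide) (by decide) (by decide) A B)
    (comp_h3 (by decide) (by decide) (by decide) A B) hx hy

theorem stack4_right {x y : ℤ × Fin 4} (hx : x.2 ≠ 2) (hy : y.2 ≠ 2) :
    Conn {place 0 1 A.mate, place 1 3 (B.comp C).mate} x y ↔ Conn (stack4 A B C) x y := by
  rw [← stack4_rev, Set.pair_comm]
  refine elim_conn {x : ℤ × Fin 4 | x.2 = 2} (C.good (n := n) (by decide) _ rfl).1
    (B.good (n := n) (by decide) _ rfl).1 (A.good (n := n) (by decide) _ rfl).1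
    (fun x (hx : x.2 = 2) => place_other _ (by rw [hx]; decide) (by rw [hx]; decide))
    ?_ ?_ hx hy
  · rw [Set.pair_comm]; exact comp_h2 (by decide) (by decide) (by decide) B C
  · rw [Set.pair_comm]; exact comp_h3 (by decide) (by decide) (by decide) B C

theorem loops_left (t : Prop) :
    loopCount n (stack4 A B C) {x | x.2 = 0 ∨ x.2 = 3} t =
      loopCount n (stack A B) {x | x.2 ≠ 1} t +
        loopCount n (stack (A.comp B) C) {x | x.2 ≠ 1} t := by
  have := elim_loops (n := n) (α := place 0 1 A.mate) (β := place 1 2 B.mate)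
    (γ := place 2 3 C.mate) (ε := place 0 2 (A.comp B).mate) {x : ℤ × Fin 4 | x.2 = 1}
    {x | x.2 = 0 ∨ x.2 = 3} (stack4_good A B C) ((A.comp B).good (by decide))
    (fun _ _ => Iff.rfl)
    (fun x (hx : x.2 = 1) => by
      show ¬ (x.2 = 0 ∨ x.2 = 3)
      rw [hx]; decide)
    (fun x (hx : x.2 = 1) => place_other _ (by rw [hx]; decide) (by rw [hx]; decide))
    (comp_h2 (by decide) (by decide) (by decide) A B)
    (comp_h3 (by decide) (by decide) (by decide) A B) t
  rw [← loopCount_rows (r := 4) (a := 0) (b := 1) (c := 2) (by decide) (by decide) (by decide) A B,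
    ← loopCount_rows (r := 4) (a := 0) (b := 2) (c := 3) (by decide) (by decide) (by decide) _ C]
  refine this.trans ?_
  congr 2
  ext x
  simp only [Set.mem_union, Set.mem_ofPred_eq]
  generalize x.2 = e; revert e; decide

theorem loops_right (t : Prop) :
    loopCount n (stack4 A B C) {x | x.2 = 0 ∨ x.2 = 3} t =
      loopCount n (stack B C) {x | x.2 ≠ 1} t +
        loopCount n (stack A (B.comp C)) {x | x.2 ≠ 1} t := by
  have := elim_loops (n := n) (α := place 2 3 C.mate) (β := place 1 2 B.mate)
    (γ := place 0 1 A.mate) (ε := place 1 3 (B.comp C).mate) {x : ℤ × Fin 4 | x.2 = 2}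
    {x | x.2 = 0 ∨ x.2 = 3} (stack4_rev A B C ▸ stack4_good A B C) ((B.comp C).good (by decide))
    (fun _ _ => Iff.rfl)
    (fun x (hx : x.2 = 2) => by
      show ¬ (x.2 = 0 ∨ x.2 = 3)
      rw [hx]; decide)
    (fun x (hx : x.2 = 2) => place_other _ (by rw [hx]; decide) (by rw [hx]; decide))
    (by rw [Set.pair_comm]; exact comp_h2 (by decide) (by decide) (by decide) B C)
    (by rw [Set.pair_comm]; exact comp_h3 (by decide) (by decide) (by decide) B C) t
  rw [stack4_rev, Set.pair_comm, Set.pair_comm (place 1 3 _)] at this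
  rw [← loopCount_rows (r := 4) (a := 1) (b := 2) (c := 3) (by decide) (by decide) (by decide) B C,
    ← loopCount_rows (r := 4) (a := 0) (b := 1) (c := 3) (by decide) (by decide) (by decide) A _]
  refine this.trans ?_
  congr 2
  ext x
  simp only [Set.mem_union, Set.mem_ofPred_eq]
  generalize x.2 = e; revert e; decide

theorem comp_assoc : (A.comp B).comp C = A.comp (B.comp C) := by
  have h3 : ∀ x : ℤ × Fin 2, (emb (0 : Fin 4) 3 x).2 = 0 ∨ (emb (0 : Fin 4) 3 x).2 = 3 :=
    emb_row _ _
  have hn : ∀ (x : ℤ × Fin 2) (e : Fin 4), e = 1 ∨ e = 2 → (emb (0 : Fin 4) 3 x).2 ≠ e := by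
    intro x e he
    rcases h3 x with h | h <;> rcases he with rfl | rfl <;> rw [h] <;> decide
  ext1
  · funext x
    obtain ⟨h1, h2⟩ := compMate_spec (A.comp B) C x
    rw [← conn_rows (r := 4) (a := 0) (b := 2) (c := 3) (by decide) (by decide) (by decide),
      rows_emb (a := 0) (b := 2) (c := 3), rows_emb, stack4_left A B C (hn _ _ (by simp)) (hn _ _ (by simp)),
      ← stack4_right A B C (hn _ _ (by simp)) (hn _ _ (by simp)), ← rows_emb (r := 4) (a := 0) (b := 1) (c := 3) x,
      ← rows_emb (r := 4) (a := 0) (b := 1) (c := 3) (compMate _ _ x), conn_rows (r := 4) (a := 0) (b := 1) (c := 3) (by decide) (by decide) (by decide)] at h2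
    exact (compMate_unique A (B.comp C) h2).resolve_left h1
  · have := (loops_left A B C False).symm.trans (loops_right A B C False)
    simp only [Diagram.comp, Diagram.newLines] at this ⊢
    omega

theorem loops_assoc : A.loops B + (A.comp B).loops C = B.loops C + A.loops (B.comp C) :=
  (loops_left A B C True).symm.trans (loops_right A B C True)

end assoc

/-- The identity diagram. -/
def Diagram.id (n : ℕ) : Diagram n where
  mate x := (x.1, 1 - x.2)
  lines := 0
  mate_mate x := by ext <;> simp
  mate_ne x h := by
    have := congrArg Prod.snd h
    revert this; simp only; generalize x.2 = e; revert e; decide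
  mate_shift k x := rfl
  noncrossing := by
    rintro ⟨i, e⟩ ⟨j, f⟩
    fin_cases e <;> fin_cases f <;> (simp; try omega)
  lines_vertical h := absurd rfl h

/-- The diagram `u`, joining the point `j` below to the point `j + 1` above. -/
def Diagram.rot (n : ℕ) : Diagram n where
  mate x := if x.2 = 0 then (x.1 - 1, 1) else (x.1 + 1, 0)
  lines := 0
  mate_mate := by rintro ⟨i, e⟩; fin_cases e <;> simp
  mate_ne := by rintro ⟨i, e⟩; fin_cases e <;> simp
  mate_shift := by rintro k ⟨i, e⟩; fin_cases e <;> (simp [shift]; ring)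
  noncrossing := by
    rintro ⟨i, e⟩ ⟨j, f⟩
    fin_cases e <;> fin_cases f <;> (simp; try omega)
  lines_vertical h := absurd rfl h

theorem loopCount_eq_zero {r : ℕ} {S : Set (ℤ × Fin r → ℤ × Fin r)} {O : Set (ℤ × Fin r)}
    {b : Prop} (h : ∀ x, ∃ y, Conn S x y ∧ y ∈ O) : loopCount n S O b = 0 := by
  by_contra h'
  obtain ⟨w, hw⟩ := exists_of_loopCount h'
  obtain ⟨y, h1, h2⟩ := h w
  exact hw.1 y h1 h2

theorem id_place01 {r : ℕ} {a b : Fin r} (hab : a ≠ b) (i : ℤ) :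
    place a b (Diagram.id n).mate (i, a) = (i, b) ∧
      place a b (Diagram.id n).mate (i, b) = (i, a) := by
  simp [place, Diagram.id, emb, hab.symm]

theorem id_loops (A : Diagram n) (t : Prop) :
    loopCount n (stack (Diagram.id n) A) {x | x.2 ≠ 1} t = 0 := by
  refine loopCount_eq_zero fun x => ?_
  by_cases h : x.2 = 1
  · refine ⟨(x.1, 0), ?_, by simp⟩
    have e : x = (x.1, 1) := Prod.ext rfl (by simp only [h])
    have h1 := Conn.step (S := stack (Diagram.id n) A) (f := place 0 1 (Diagram.id n).mate)
      (by simp [stack]) (x.1, 1)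
    rw [(id_place01 (by decide) x.1).2, ← e] at h1
    exact h1
  · exact ⟨x, Conn.refl _, h⟩

theorem loops_id (A : Diagram n) (t : Prop) :
    loopCount n (stack A (Diagram.id n)) {x | x.2 ≠ 1} t = 0 := by
  refine loopCount_eq_zero fun x => ?_
  by_cases h : x.2 = 1
  · refine ⟨(x.1, 2), ?_, by simp⟩
    have e : x = (x.1, 1) := Prod.ext rfl (by simp only [h])
    have h1 := Conn.step (S := stack A (Diagram.id n)) (f := place 1 2 (Diagram.id n).mate)
      (by simp [stack]) (x.1, 1)
    rw [(id_place01 (by decide) x.1).1, ← e] at h1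
    exact h1
  · exact ⟨x, Conn.refl _, h⟩

theorem id_comp (A : Diagram n) : (Diagram.id n).comp A = A := by
  have s0 : ∀ i : ℤ, Conn (stack (Diagram.id n) A) (i, 0) (i, 1) := fun i => by
    have h1 := Conn.step (S := stack (Diagram.id n) A) (f := place 0 1 (Diagram.id n).mate)
      (by simp [stack]) (i, 0)
    rwa [(id_place01 (by decide) i).1] at h1
  have s1 : ∀ x, Conn (stack (Diagram.id n) A) (emb 0 2 x) (emb 1 2 x) := by
    rintro ⟨i, e⟩
    fin_cases e
    · exact s0 i
    · exact Conn.refl _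
  have hG := stack_good (Diagram.id n) A
  ext1
  · funext x
    have h1 := Conn.step (S := stack (Diagram.id n) A) (f := place 1 2 A.mate)
      (by simp [stack]) (emb 1 2 x)
    rw [place_emb (by decide)] at h1
    have h2 := ((s1 x).trans h1).trans (hG.symm (s1 _))
    exact ((compMate_unique _ _ h2).resolve_left (A.mate_ne x)).symm
  · show 0 + A.lines + loopCount n (stack (Diagram.id n) A) {x | x.2 ≠ 1} False = A.lines
    rw [id_loops]; omega

theorem comp_id (A : Diagram n) : A.comp (Diagram.id n) = A := by
  have s0 : ∀ i : ℤ, Conn (stack A (Diagram.id n)) (i, 1) (i, 2) := fun i => by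
    have h1 := Conn.step (S := stack A (Diagram.id n)) (f := place 1 2 (Diagram.id n).mate)
      (by simp [stack]) (i, 1)
    rwa [(id_place01 (by decide) i).1] at h1
  have hG := stack_good A (Diagram.id n)
  have s1 : ∀ x, Conn (stack A (Diagram.id n)) (emb 0 2 x) (emb 0 1 x) := by
    rintro ⟨i, e⟩
    fin_cases e
    · exact Conn.refl _
    · exact hG.symm (s0 i)
  ext1
  · funext x
    have h1 := Conn.step (S := stack A (Diagram.id n)) (f := place 0 1 A.mate)
      (by simp [stack]) (emb 0 1 x)
    rw [place_emb (by decide)] at h1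
    have h2 := ((s1 x).trans h1).trans (hG.symm (s1 _))
    exact ((compMate_unique _ _ h2).resolve_left (A.mate_ne x)).symm
  · show A.lines + 0 + loopCount n (stack A (Diagram.id n)) {x | x.2 ≠ 1} False = A.lines
    rw [loops_id]; rfl

end product

section algebra

variable (n : ℕ) [NeZero n] {K : Type*} [CommRing K] (δ : K)

/-- The algebra `D_n` over `K` with loop parameter `δ`: the span of the diagrams. -/
def DAlg (n : ℕ) {K : Type*} [CommRing K] (_ : K) : Type _ := Diagram n →₀ K

namespace DAlg

noncomputable instance : AddCommGroup (DAlg n δ) := inferInstanceAs (AddCommGroup (Diagram n →₀ K))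

noncomputable instance : Module K (DAlg n δ) := inferInstanceAs (Module K (Diagram n →₀ K))

variable {n}

/-- The basis element of a diagram. -/
noncomputable def of (A : Diagram n) : DAlg n δ := Finsupp.single A (1 : K)

/-- The linear extension of a map from diagrams. -/
noncomputable def extend {V : Type*} [AddCommGroup V] [Module K V] (φ : Diagram n → V) :
    DAlg n δ →ₗ[K] V := Finsupp.linearCombination K φ

variable {δ}

@[simp] theorem extend_of {V : Type*} [AddCommGroup V] [Module K V] (φ : Diagram n → V)
    (A : Diagram n) : extend δ φ (of δ A) = φ A :=
  (Finsupp.linearCombination_single K (1 : K) A).trans (one_smul K _)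

theorem hom_ext {V : Type*} [AddCommGroup V] [Module K V] {f g : DAlg n δ →ₗ[K] V}
    (h : ∀ A, f (of δ A) = g (of δ A)) : f = g :=
  Finsupp.lhom_ext' fun A => LinearMap.ext_ring (h A)

@[elab_as_elim]
theorem ind {P : DAlg n δ → Prop} (a : DAlg n δ) (zero : P 0)
    (add : ∀ a b, P a → P b → P (a + b)) (smul : ∀ (k : K) A, P (k • of δ A)) : P a := by
  refine Finsupp.induction_linear (motive := P) a zero add fun A k => ?_
  have : k • of δ A = (Finsupp.single A k : Diagram n →₀ K) := by
    refine (Finsupp.smul_single k A (1 : K)).trans ?_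
    rw [smul_eq_mul, mul_one]
  exact this ▸ smul k A

variable (δ) in
/-- The product: put the diagrams on top of each other, and replace every closed loop by `δ`. -/
noncomputable def mulHom : DAlg n δ →ₗ[K] DAlg n δ →ₗ[K] DAlg n δ :=
  extend δ fun A => extend δ fun B => δ ^ A.loops B • of δ (A.comp B)

noncomputable instance : Mul (DAlg n δ) := ⟨fun a b => mulHom δ a b⟩

noncomputable instance : One (DAlg n δ) := ⟨of δ (Diagram.id n)⟩

theorem mul_def (a b : DAlg n δ) : a * b = mulHom δ a b := rfl

theorem of_mul_of (A B : Diagram n) :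
    of δ A * of δ B = δ ^ A.loops B • of δ (A.comp B) := by
  simp [mul_def, mulHom]

theorem one_def : (1 : DAlg n δ) = of δ (Diagram.id n) := rfl

theorem mul_assoc' (a b c : DAlg n δ) : a * b * c = a * (b * c) := by
  induction a using DAlg.ind with
  | zero => simp [mul_def]
  | add a a' ha ha' => simp only [mul_def, map_add, LinearMap.add_apply] at *; rw [ha, ha']
  | smul k A =>
    induction b using DAlg.ind with
    | zero => simp [mul_def]
    | add b b' hb hb' => simp only [mul_def, map_add, LinearMap.add_apply] at *; rw [hb, hb']
    | smul l B =>
      induction c using DAlg.ind with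
      | zero => simp [mul_def]
      | add c c' hc hc' => simp only [mul_def, map_add] at *; rw [hc, hc']
      | smul m C =>
        have hA := of_mul_of (δ := δ) A B
        have hB := of_mul_of (δ := δ) B C
        have hC := of_mul_of (δ := δ) (A.comp B) C
        have hD := of_mul_of (δ := δ) A (B.comp C)
        simp only [mul_def] at hA hB hC hD
        simp only [mul_def, map_smul, LinearMap.smul_apply, hA, hB, hC, hD, comp_assoc]
        simp only [smul_smul]
        congr 1
        have := congrArg (fun e => δ ^ e) (loops_assoc A B C)
        simp only [pow_add] at this
        linear_combination m * k * l * this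

noncomputable instance : Ring (DAlg n δ) where
  __ := (inferInstance : AddCommGroup (DAlg n δ))
  mul_assoc := mul_assoc'
  left_distrib a b c := by simp [mul_def]
  right_distrib a b c := by simp [mul_def]
  zero_mul a := by simp [mul_def]
  mul_zero a := by simp [mul_def]
  one_mul a := by
    have : mulHom δ (of δ (Diagram.id n)) = LinearMap.id := hom_ext fun A => by
      show of δ _ * of δ A = of δ A
      rw [of_mul_of, id_comp, Diagram.loops, id_loops, pow_zero, one_smul]
    exact congrArg (fun f => f a) this
  mul_one a := by
    have : (mulHom δ).flip (of δ (Diagram.id n)) = LinearMap.id := hom_ext fun A => by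
      show of δ A * of δ _ = of δ A
      rw [of_mul_of, comp_id, Diagram.loops, loops_id, pow_zero, one_smul]
    exact congrArg (fun f => f a) this

noncomputable instance : Algebra K (DAlg n δ) :=
  Algebra.ofModule (fun c a b => by simp [mul_def]) (fun c a b => by simp [mul_def])

end DAlg

end algebra

section modules

open Polynomial

variable {n : ℕ} [NeZero n]

/-- The number of through-strings (vertical edges) of a diagram on the cylinder, counted by their
lower end points `1, …, n`. -/
def Diagram.through (D : Diagram n) : ℕ :=
  (Finset.univ.filter fun i : Fin n => (D.mate ((i : ℤ) + 1, 1)).2 = 0).card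

theorem through_comp_le (A D : Diagram n) : (A.comp D).through ≤ D.through := by
  refine Finset.card_le_card fun i hi => ?_
  rw [Finset.mem_filter] at hi ⊢
  refine ⟨hi.1, ?_⟩
  by_contra h
  have h0 : ∀ e : Fin 2, e ≠ 0 → e = 1 := by decide
  have e : D.mate ((i : ℤ) + 1, 1) = ((D.mate ((i : ℤ) + 1, 1)).1, 1) :=
    Prod.ext rfl (h0 _ h)
  have h2 := hi.2
  rw [show (A.comp D).mate = compMate A D from rfl, compMate_bot A D e] at h2
  exact absurd h2 (show ¬ (1 : Fin 2) = 0 by decide)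

/-- The involution `S` of `{1, …, n}` (numbered from `0` here) exchanges the points that are joined
by the diagram `D` within the circle `e` (`0` is the top circle, `1` the bottom circle). -/
def Diagram.Exchanges (D : Diagram n) (e : Fin 2) (S : Equiv.Perm (Fin n)) : Prop :=
  ∀ i j : Fin n, i ≠ j →
    (S i = j ↔ ∃ k : ℤ, D.mate ((i : ℤ) + 1, e) = ((j : ℤ) + 1 + n * k, e))

/-- The winding number: the edges from `j` below to `i` above that cross the line `x = 1/2`,
counted positively if `i > j` and negatively if `i < j`. -/
noncomputable def Diagram.winding (D : Diagram n) : ℤ :=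
  ({p : ℤ × ℤ | D.mate (p.2, 1) = (p.1, 0) ∧ p.2 < p.1 ∧ p.2 ≤ 0 ∧ 1 ≤ p.1}.ncard : ℤ) -
    ({p : ℤ × ℤ | D.mate (p.2, 1) = (p.1, 0) ∧ p.1 < p.2 ∧ p.1 ≤ 0 ∧ 1 ≤ p.2}.ncard : ℤ)

/-- `D` is the diagram `[S₁, S₂, w]`. -/
def Diagram.Is (D : Diagram n) (S₁ S₂ : Equiv.Perm (Fin n)) (w : ℤ) : Prop :=
  0 < D.through ∧ D.Exchanges 0 S₁ ∧ D.Exchanges 1 S₂ ∧ D.winding = w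

/-- `S` is an annular involution with exactly `t` fixed points. -/
def IsAnnular (t : ℕ) (S : Equiv.Perm (Fin n)) : Prop :=
  S * S = 1 ∧
  (∀ i j, i < j → S i = j → S '' Set.Icc i j = Set.Icc i j ∧
    (Set.Icc i j ∩ Function.fixedPoints S = ∅ ∨ Function.fixedPoints S ⊆ Set.Icc i j)) ∧
  (Function.fixedPoints S).ncard = t

/-- `S ↦ w₀ S w₀⁻¹`, where `w₀` reverses the points. -/
def reverse (S : Equiv.Perm (Fin n)) : Equiv.Perm (Fin n) := Fin.revPerm * S * Fin.revPerm⁻¹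

variable {K : Type*} [CommRing K] (δ : K)

open DAlg

open Classical in
/-- The element `[S₁, S₂, w]` of `D_n`. -/
noncomputable def bracket (S₁ S₂ : Equiv.Perm (Fin n)) (w : ℤ) : DAlg n δ :=
  if h : ∃ D : Diagram n, D.Is S₁ S₂ w then of δ h.choose else 0

/-- `f(S₁, S₂)`: substitute `[S₁, S₂, k]` for `X ^ k`. -/
noncomputable def polyBracket (f : K[X]) (S₁ S₂ : Equiv.Perm (Fin n)) : DAlg n δ :=
  f.sum fun k c => c • bracket δ S₁ S₂ k

variable (n) in
/-- The ideal `I_t`: the span of the diagrams with at most `t` through-strings. -/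
noncomputable def levelIdeal (t : ℤ) : Ideal (DAlg n δ) where
  toAddSubmonoid :=
    (Submodule.span K {a : DAlg n δ | ∃ D : Diagram n, (D.through : ℤ) ≤ t ∧ a = of δ D}).toAddSubmonoid
  smul_mem' := by
    intro c x hx
    refine Submodule.span_induction (p := fun x _ => c * x ∈ Submodule.span K
      {a : DAlg n δ | ∃ D : Diagram n, (D.through : ℤ) ≤ t ∧ a = of δ D}) ?_ ?_ ?_ ?_ hx
    · rintro _ ⟨D, hD, rfl⟩
      induction c using DAlg.ind with
      | zero => rw [zero_mul]; exact Submodule.zero_mem _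
      | add a b ha hb => rw [add_mul]; exact Submodule.add_mem _ ha hb
      | smul k A =>
        rw [smul_mul_assoc, of_mul_of]
        refine Submodule.smul_mem _ _ (Submodule.smul_mem _ _ (Submodule.subset_span ⟨_, ?_, rfl⟩))
        exact le_trans (by exact_mod_cast through_comp_le A D) hD
    · rw [mul_zero]; exact Submodule.zero_mem _
    · intro x y _ _ hx hy; rw [mul_add]; exact Submodule.add_mem _ hx hy
    · intro k x _ hx; rw [mul_smul_comm]; exact Submodule.smul_mem _ _ hx

variable (n) in
/-- The two-sided ideal `ω(q) + I_0`, where `ω(q)` is generated by `u ^ n - q`. For odd `n` there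
are no diagrams without through-strings, so that `I_0 = 0`. -/
noncomputable def omegaIdeal (q : K) : TwoSidedIdeal (DAlg n δ) :=
  TwoSidedIdeal.span ({of δ (Diagram.rot n) ^ n - algebraMap K _ q} ∪ (levelIdeal n δ 0 : Set _))

variable (n) in
/-- The algebra `D_n(q)`: the quotient of `D_n` by `ω(q) + I_0`. -/
abbrev DQuot (q : K) : Type _ := DAlg n δ ⧸ (omegaIdeal n δ q).asIdeal

variable (n) in
/-- The quotient map from `D_n` to `D_n(q)`. -/
noncomputable def toDQuot (q : K) : DAlg n δ →+* DQuot n δ q :=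
  Ideal.Quotient.mk (omegaIdeal n δ q).asIdeal

/-- The polynomial `∏_{i > j} (X - r_i)`. -/
noncomputable def cellPoly {t : ℕ} (r : Fin t → K) (j : Fin t) : K[X] :=
  ∏ i ∈ Finset.univ.filter (fun i => j < i), (X - C (r i))

/-- The image in `D_n(q)` of the cell basis element `C_{S₁, S₂}` of weight `(t, j)`, for the
labelling `r` of the roots of `X ^ t - q`. -/
noncomputable def cellElement (q : K) {t : ℕ} (r : Fin t → K) (j : Fin t)
    (S₁ S₂ : Equiv.Perm (Fin n)) : DQuot n δ q :=
  toDQuot n δ q (polyBracket δ (cellPoly r j) S₁ (reverse S₂))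

variable (n) in
/-- The cell ideal of `D_n(q)` just below the weight `(t, j)`: it is generated (in fact spanned) by
`I_{t-2}` and the cell basis elements of the weights `(t, i)` with `i < j`. -/
noncomputable def cellIdealBelow (q : K) {t : ℕ} (r : Fin t → K) (j : Fin t) :
    Ideal (DQuot n δ q) :=
  Ideal.span (toDQuot n δ q '' (levelIdeal n δ ((t : ℤ) - 2) : Set _) ∪
    {a | ∃ i S₁ S₂, i < j ∧ IsAnnular t S₁ ∧ IsAnnular t S₂ ∧ a = cellElement δ q r i S₁ S₂})

/-- The standard module `W(t, j)` of `D_n(q)`: it is generated (in fact spanned) by the cosets of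
the cell basis elements `C_{S, T}` of weight `(t, j)` with fixed second index `T`, modulo the cell
ideal below. Its label is `(t, r_j)`. -/
noncomputable def standardModule (q : K) {t : ℕ} (r : Fin t → K) (j : Fin t)
    (T : Equiv.Perm (Fin n)) : Submodule (DQuot n δ q) (DQuot n δ q ⧸ cellIdealBelow n δ q r j) :=
  Submodule.span (DQuot n δ q)
    {x | ∃ S, IsAnnular t S ∧ x = Submodule.Quotient.mk (cellElement δ q r j S T)}

open Classical in
variable (n) in
/-- The linear map `τ`, given by `[S₁, S₂, w] ↦ [S₁, S₂, w + 1]`; diagrams without through-strings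
play no role and are fixed. -/
noncomputable def tau : Module.End K (DAlg n δ) :=
  extend δ fun D =>
    if h : ∃ S₁ S₂ : Equiv.Perm (Fin n), D.Is S₁ S₂ D.winding then
      bracket δ h.choose h.choose_spec.choose (D.winding + 1)
    else of δ D

variable (n) in
/-- The left ideal `(τ - α)² I_t + I_{t-2}`. (Modulo `I_{t-2}` the map `τ` commutes with the action
of `D_n`, so that the ideal generated here is just the sum of the two subspaces.) -/
noncomputable def squareIdeal (t : ℕ) (α : K) : Ideal (DAlg n δ) :=
  levelIdeal n δ ((t : ℤ) - 2) ⊔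
    Ideal.span (((tau n δ - algebraMap K _ α) ^ 2 : Module.End K (DAlg n δ)) ''
      (levelIdeal n δ t : Set _))

variable (n) in
/-- The left `D_n`-module `𝓘_M = (I_t / I_{t-2}) / (τ - α)² (I_t / I_{t-2})`, for `M` with label
`(t, α)`. -/
abbrev selfExt (t : ℕ) (α : K) : Type _ :=
  levelIdeal n δ t ⧸ (squareIdeal n δ t α).submoduleOf (levelIdeal n δ t)

/-- The submodule `𝓘_M(S)` of `𝓘_M`, generated (in fact spanned) by the images of the diagrams
`[S₁, S, w]`. -/
noncomputable def selfExtAt (t : ℕ) (α : K) (S : Equiv.Perm (Fin n)) :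
    Submodule (DAlg n δ) (selfExt n δ t α) :=
  Submodule.span (DAlg n δ)
    {x | ∃ S₁ w, ∃ h : bracket δ S₁ S w ∈ levelIdeal n δ (t : ℤ), IsAnnular t S₁ ∧
      x = Submodule.Quotient.mk ⟨bracket δ S₁ S w, h⟩}

/-- A module is indecomposable if it is nonzero and has no nontrivial direct summands. -/
def IsIndecomposable (R N : Type*) [Ring R] [AddCommGroup N] [Module R N] : Prop :=
  Nontrivial N ∧ ∀ P Q : Submodule R N, IsCompl P Q → P = ⊥ ∨ Q = ⊥

end modules

end AffineTL

universe u w w'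

open AffineTL Polynomial

/-! Write `u` for the rotation, `α = r_j`, and fix an annular involution `S` with `t` fixed points.
Since `δ ≠ 0`, each diagram `[S₁, S₂, w]` with `t` vertical edges can be divided by the power of `δ`
that belongs to its lower circle. The resulting elements `gunit` multiply like matrix units over
`K[X, X⁻¹]` whenever adjacent circles agree (`gunit_mul`). So the multiple `e` of `[S, S, 0]` is
idempotent, and `τ - α` is right multiplication by `x = nilp` on the diagrams with bottom `S`. In
particular `𝓘_M(S)` is generated by the image of `e`, and `d` annihilates this generator if and only
if `d e` lies in `squareIdeal`, the left ideal generated by `I_{t-2}` and the elements `x²` of all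
columns (`exists_selfExtAt_generator`, `squareIdeal_le`).

A simple standard module `M` is killed by `I_{t-2}` and by `x`, and it is generated by some `z = e
z` such that `d z = 0` forces `d e ∈ D_n x + I_{t-2}` (`standard_facts`). For the last point a
relation in `D_n(q)` is lifted to `D_n`. The cell elements below `(t, j)` come from multiples of `(X
- r_j) f_j`, and so does `u ^ n - q`, which acts as `τ ^ t - q` on `I_t` modulo `I_{t-2}`. The
factor `f_j(τ)` is then cancelled: `τ - r` is injective modulo `I_{t-2}`, because `τ` moves the
diagrams with vertical edges freely.

Now let `N` be an indecomposable self-extension of `M` (`exists_generator`). The ideal `I_{t-2}` is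
idempotent, so it kills `N`. Lift `z` to `y = e y`; then `x y` is the image of some `m'` in `M`. If
`m' = 0`, then `D_n y` is a complement of the submodule `M`, against indecomposability. Otherwise
`z` and `m'` have the same annihilator, `y` generates `N`, and two applications of the description
of the annihilator of `z` show that `d y = 0` forces `d e ∈ D_n x² + I_{t-2}`. Conversely
`squareIdeal` kills `N`. Hence `N` and `𝓘_M(S)` are cyclic with the same annihilator of the
generator.

For the second claim `a = q`, and `c = u ^ n - q` is central and kills `M`. So `c N` is a submodule
of the simple submodule `M` of `N`. It is not zero, since otherwise `N` would be a `D_n(q)`-module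
and the sequence would split by hypothesis (`exists_splitting`).

The combinatorial basis is that a diagram with vertical edges consists of two `Half`s and a winding
number (`exists_glue`), and that halves with fixed points correspond to annular involutions
(`exists_half`, `Half.perm_injective`). -/

namespace AffineTL

/-! ### Halves of diagrams and the numbering of their fixed points. -/

/-- The horizontal edges within one circle of a diagram: an involution of `ℤ` whose fixed points are
the end points of the vertical edges. -/
@[ext]
structure Half (n : ℕ) where
  arc : ℤ → ℤ
  arc_arc : ∀ i, arc (arc i) = i
  arc_add : ∀ i k, arc (i + n * k) = arc i + n * k
  noncrossing : ∀ i j, ¬ (i < j ∧ j < arc i ∧ arc i < arc j)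
  arc_ne : ∀ i j, i < j → j < arc i → arc j ≠ j

section halves

variable {n : ℕ}

theorem fin2_ne_zero {e : Fin 2} (h : e ≠ 0) : e = 1 := by revert h; revert e; decide

theorem fin2_ne_one {e : Fin 2} (h : e ≠ 1) : e = 0 := by revert h; revert e; decide

theorem Diagram.mate_inj (D : Diagram n) {x y : ℤ × Fin 2} : D.mate x = D.mate y ↔ x = y :=
  ⟨fun h => by rw [← D.mate_mate x, h, D.mate_mate], fun h => by rw [h]⟩

/-- The other end of a horizontal edge in the row `e`; end points of vertical edges are fixed. -/
def Diagram.arc (D : Diagram n) (e : Fin 2) (i : ℤ) : ℤ :=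
  if (D.mate (i, e)).2 = e then (D.mate (i, e)).1 else i

theorem Diagram.arc_eq_iff (D : Diagram n) (e : Fin 2) {i j : ℤ} (hij : i ≠ j) :
    D.arc e i = j ↔ D.mate (i, e) = (j, e) := by
  unfold Diagram.arc
  split_ifs with h
  · rw [Prod.ext_iff]; simp [h]
  · simp only [hij, false_iff]
    intro h'
    exact h (by rw [h'])

theorem Diagram.arc_fix_iff (D : Diagram n) (e : Fin 2) {i : ℤ} :
    D.arc e i = i ↔ (D.mate (i, e)).2 ≠ e := by
  unfold Diagram.arc
  split_ifs with h
  · simp only [h, ne_eq, not_true_eq_false, iff_false]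
    intro h'
    exact D.mate_ne (i, e) (Prod.ext h' h)
  · simp [h]

theorem Diagram.mate_arc (D : Diagram n) (e : Fin 2) {i : ℤ} (h : D.arc e i ≠ i) :
    D.mate (i, e) = (D.arc e i, e) := (D.arc_eq_iff e h.symm).1 rfl

theorem Diagram.arc_arc (D : Diagram n) (e : Fin 2) (i : ℤ) : D.arc e (D.arc e i) = i := by
  by_cases h : D.arc e i = i
  · rw [h, h]
  · rw [D.arc_eq_iff e h, ← D.mate_arc e h, D.mate_mate]

theorem Diagram.noncrossing' (D : Diagram n) {x y x' y' : ℤ × Fin 2} (hx : D.mate x = x')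
    (hy : D.mate y = y') : ¬ (pos x < pos y ∧ pos y < pos x' ∧ pos x' < pos y') := by
  subst hx hy; exact D.noncrossing x y

/-- The half of a diagram in the row `e`. -/
def Diagram.half (D : Diagram n) (e : Fin 2) : Half n where
  arc := D.arc e
  arc_arc := D.arc_arc e
  arc_add i k := by
    have h := D.mate_shift k (i, e)
    simp only [shift] at h
    unfold Diagram.arc
    rw [h]
    simp only
    split_ifs <;> rfl
  noncrossing i j := by
    rintro ⟨h1, h2, h3⟩
    have hi := D.mate_arc e (i := i) (by omega)
    have hj := D.mate_arc e (i := j) (by omega)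
    have hi' := D.mate_mate (i, e)
    have hj' := D.mate_mate (j, e)
    rw [hi] at hi'
    rw [hj] at hj'
    -- The boundary of the strip runs from right to left along the bottom row, so a crossing there
    -- shows up with the two edges in reverse order; both readings are supplied.
    have := D.noncrossing' hi hj
    have := D.noncrossing' hj' hi'
    fin_cases e <;> simp_all
  arc_ne i j h1 h2 h3 := by
    have hi := D.mate_arc e (i := i) (by omega)
    have hi' := D.mate_mate (i, e)
    rw [hi] at hi'
    have hj := (D.arc_fix_iff e).1 h3
    obtain ⟨k, hk⟩ : ∃ k, D.mate (j, e) = (k, 1 - e) := by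
      refine ⟨(D.mate (j, e)).1, Prod.ext rfl ?_⟩
      have key : ∀ f e : Fin 2, f ≠ e → f = 1 - e := by decide
      exact key _ _ hj
    have hk' := D.mate_mate (j, e)
    rw [hk] at hk'
    have := D.noncrossing' hi hk
    have := D.noncrossing' hk' hi'
    fin_cases e <;> simp_all

@[simp] theorem Diagram.half_arc (D : Diagram n) (e : Fin 2) (i : ℤ) :
    (D.half e).arc i = D.arc e i := rfl

namespace Half

theorem arc_ne_iff (h : Half n) (i : ℤ) : h.arc (h.arc i) ≠ h.arc i ↔ h.arc i ≠ i := by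
  rw [h.arc_arc]; exact ne_comm

theorem arc_add_ne (h : Half n) (i k : ℤ) : h.arc (i + n * k) ≠ i + n * k ↔ h.arc i ≠ i := by
  rw [h.arc_add, ne_eq, ne_eq, add_left_inj]

theorem arc_add_fix (h : Half n) (i k : ℤ) : h.arc (i + n * k) = i + n * k ↔ h.arc i = i := by
  rw [h.arc_add, add_left_inj]

/-- No horizontal edge winds around the cylinder. -/
theorem eq_zero_of_arc (h : Half n) [NeZero n] {i k : ℤ} (e : h.arc i = i + n * k) : k = 0 := by
  -- Applying the involution twice shifts `i` by `n * (k + k)`.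
  have h1 := h.arc_arc i
  rw [e, h.arc_add, e] at h1
  have h2 : (n : ℤ) * (k + k) = 0 := by linarith
  have hn : (n : ℤ) ≠ 0 := by exact_mod_cast NeZero.ne n
  rcases mul_eq_zero.1 h2 with h | h
  · exact absurd h hn
  · omega

/-- The fixed points among `1, …, n`. -/
def fixSet (h : Half n) : Finset ℤ :=
  (Finset.univ.filter fun i : Fin n => h.arc ((i : ℤ) + 1) = (i : ℤ) + 1).image
    fun i : Fin n => (i : ℤ) + 1

/-- The number of fixed points modulo `n`. -/
def thr (h : Half n) : ℕ :=
  (Finset.univ.filter fun i : Fin n => h.arc ((i : ℤ) + 1) = (i : ℤ) + 1).card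

theorem card_fixSet (h : Half n) : h.fixSet.card = h.thr := by
  refine Finset.card_image_of_injective _ fun i j e => ?_
  ext
  have : (i : ℤ) + 1 = j + 1 := e
  omega

theorem mem_fixSet (h : Half n) {i : ℤ} : i ∈ h.fixSet ↔ 1 ≤ i ∧ i ≤ n ∧ h.arc i = i := by
  simp only [fixSet, Finset.mem_image, Finset.mem_filter, Finset.mem_univ, true_and]
  constructor
  · rintro ⟨j, h1, rfl⟩
    exact ⟨by omega, by omega, h1⟩
  · rintro ⟨h1, h2, h3⟩
    refine ⟨⟨(i - 1).toNat, by omega⟩, ?_, ?_⟩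
    · have : (((i - 1).toNat : ℕ) : ℤ) + 1 = i := by omega
      show h.arc ((((i - 1).toNat : ℕ) : ℤ) + 1) = (((i - 1).toNat : ℕ) : ℤ) + 1
      rw [this, h3]
    · simp only; omega

/-- The fixed points in increasing order, the first positive one having number `0`. -/
noncomputable def en (h : Half n) (k : ℤ) : ℤ :=
  -- For `k = a + thr * m` with `0 ≤ a < thr` take the fixed point number `a` of the window `1, …,
  -- n` and move it by `m` periods. Without fixed points the value means nothing.
  if ht : 0 < h.thr then
    h.fixSet.orderEmbOfFin h.card_fixSet ⟨(k % h.thr).toNat, by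
      have := Int.emod_nonneg k (b := h.thr) (by omega)
      have := Int.emod_lt_of_pos k (b := h.thr) (by omega)
      omega⟩ + n * (k / h.thr)
  else 0

theorem en_eq (h : Half n) {k : ℤ} (m : ℤ) (a : Fin h.thr) (hk : k = a + h.thr * m) :
    h.en k = h.fixSet.orderEmbOfFin h.card_fixSet a + n * m := by
  have ht : 0 < h.thr := a.pos
  have ha : ((a : ℕ) : ℤ) < h.thr := by exact_mod_cast a.2
  have h1 : k % h.thr = a := by
    rw [hk, Int.add_mul_emod_self_left, Int.emod_eq_of_lt (by omega) ha]
  have h2 : k / h.thr = m := by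
    rw [hk, Int.add_mul_ediv_left _ _ (by omega), Int.ediv_eq_zero_of_lt (by omega) ha, zero_add]
  rw [en, dif_pos ht, h2]
  congr 2
  simp [h1]

theorem exists_en_index (h : Half n) (ht : 0 < h.thr) (k : ℤ) :
    ∃ (m : ℤ) (a : Fin h.thr), k = a + h.thr * m := by
  have h1 := Int.emod_nonneg k (b := h.thr) (by omega)
  have h2 := Int.emod_lt_of_pos k (b := h.thr) (by omega)
  refine ⟨k / h.thr, ⟨(k % h.thr).toNat, by omega⟩, ?_⟩
  simp only
  rw [Int.toNat_of_nonneg h1]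
  exact (Int.emod_add_mul_ediv k _).symm

theorem orderEmb_mem (h : Half n) (a : Fin h.thr) :
    1 ≤ h.fixSet.orderEmbOfFin h.card_fixSet a ∧ h.fixSet.orderEmbOfFin h.card_fixSet a ≤ n ∧
      h.arc (h.fixSet.orderEmbOfFin h.card_fixSet a) = h.fixSet.orderEmbOfFin h.card_fixSet a :=
  h.mem_fixSet.1 (Finset.orderEmbOfFin_mem _ _ _)

theorem en_add (h : Half n) (ht : 0 < h.thr) (k m : ℤ) : h.en (k + h.thr * m) = h.en k + n * m := by
  obtain ⟨l, a, hk⟩ := h.exists_en_index ht k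
  rw [h.en_eq l a hk, h.en_eq (l + m) a (by rw [hk]; ring)]
  ring

theorem arc_en (h : Half n) (ht : 0 < h.thr) (k : ℤ) : h.arc (h.en k) = h.en k := by
  obtain ⟨l, a, hk⟩ := h.exists_en_index ht k
  rw [h.en_eq l a hk, h.arc_add_fix]
  exact (h.orderEmb_mem a).2.2

theorem en_strictMono (h : Half n) (ht : 0 < h.thr) : StrictMono h.en := by
  refine strictMono_int_of_lt_succ fun k => ?_
  obtain ⟨l, a, hk⟩ := h.exists_en_index ht k
  by_cases ha : (a : ℕ) + 1 < h.thr
  · rw [h.en_eq l a hk, h.en_eq l ⟨a + 1, ha⟩ (by rw [hk]; push_cast; ring)]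
    have : h.fixSet.orderEmbOfFin h.card_fixSet a <
        h.fixSet.orderEmbOfFin h.card_fixSet ⟨a + 1, ha⟩ := by
      rw [OrderEmbedding.lt_iff_lt, Fin.lt_def]; simp
    omega
  -- From the last fixed point of one window `1, …, n` to the first one of the next window.
  · have h1 : (a : ℕ) + 1 = h.thr := by have := a.2; omega
    have h2 : ((a : ℕ) : ℤ) + 1 = h.thr := by exact_mod_cast h1
    rw [h.en_eq l a hk, h.en_eq (l + 1) ⟨0, ht⟩ (by rw [hk]; push_cast; linarith)]
    have h3 := h.orderEmb_mem a
    have h4 := h.orderEmb_mem ⟨0, ht⟩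
    have : (n : ℤ) * (l + 1) = n * l + n := by ring
    omega

/-- This links the numbering to winding numbers: the line `x = 1/2` separates the fixed points with
negative number from the others. -/
theorem en_pos_iff (h : Half n) (ht : 0 < h.thr) (k : ℤ) : 1 ≤ h.en k ↔ 0 ≤ k := by
  have h0 : 1 ≤ h.en 0 := by
    rw [h.en_eq 0 ⟨0, ht⟩ (by simp), mul_zero, add_zero]; exact (h.orderEmb_mem _).1
  have h1 : h.en (-1) ≤ 0 := by
    have hr : ((h.thr - 1 : ℕ) : ℤ) = h.thr - 1 := by omega
    rw [h.en_eq (-1) ⟨h.thr - 1, by omega⟩ (by simp only [hr]; ring)]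
    have := (h.orderEmb_mem ⟨h.thr - 1, by omega⟩).2.1
    linarith
  have hm := (h.en_strictMono ht).monotone
  constructor
  · intro hk
    by_contra hc
    have := hm (show k ≤ -1 by omega)
    omega
  · intro hk
    have := hm hk
    omega

theorem exists_en (h : Half n) [NeZero n] {i : ℤ} (hi : h.arc i = i) : 0 < h.thr ∧ ∃ k, h.en k = i := by
  have hn : 0 < (n : ℤ) := by exact_mod_cast NeZero.pos n
  have h1 := Int.emod_nonneg (i - 1) hn.ne'
  have h2 := Int.emod_lt_of_pos (i - 1) hn
  set m := (i - 1) / n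
  have h3 : i = ((i - 1) % n + 1) + n * m := by
    have := Int.emod_add_mul_ediv (i - 1) n
    linarith
  set j := (i - 1) % n + 1
  have hj : j ∈ h.fixSet := by
    rw [mem_fixSet]
    refine ⟨by omega, by omega, ?_⟩
    rw [← h.arc_add_fix j m, ← h3, hi]
  have hj' : j ∈ Set.range (h.fixSet.orderEmbOfFin h.card_fixSet) := by
    rw [Finset.range_orderEmbOfFin]; exact hj
  obtain ⟨a, ha⟩ := hj'
  refine ⟨a.pos, a + h.thr * m, ?_⟩
  rw [h.en_eq m a rfl, ha, ← h3]

/-- The number of a fixed point. -/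
noncomputable def idx (h : Half n) (i : ℤ) : ℤ := Function.invFun h.en i

theorem idx_en (h : Half n) (ht : 0 < h.thr) (k : ℤ) : h.idx (h.en k) = k :=
  Function.leftInverse_invFun (h.en_strictMono ht).injective k

theorem en_idx (h : Half n) [NeZero n] {i : ℤ} (hi : h.arc i = i) : h.en (h.idx i) = i :=
  Function.invFun_eq (h.exists_en hi).2

theorem idx_add (h : Half n) [NeZero n] {i : ℤ} (hi : h.arc i = i) (m : ℤ) :
    h.idx (i + n * m) = h.idx i + h.thr * m := by
  obtain ⟨ht, k, rfl⟩ := h.exists_en hi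
  rw [← h.en_add ht, h.idx_en ht, h.idx_en ht]

theorem idx_lt (h : Half n) [NeZero n] {i j : ℤ} (hi : h.arc i = i) (hj : h.arc j = j) :
    h.idx i < h.idx j ↔ i < j := by
  obtain ⟨ht, k, rfl⟩ := h.exists_en hi
  obtain ⟨-, l, rfl⟩ := h.exists_en hj
  rw [h.idx_en ht, h.idx_en ht, (h.en_strictMono ht).lt_iff_lt]

end Half

end halves

/-! ### Diagrams glued from two halves; classification of the diagrams with vertical edges. -/

section matchings

variable {n : ℕ}

/-- A monotone periodic bijection between the fixed points of two halves. -/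
structure Matching (a b : Half n) where
  up : ℤ → ℤ
  down : ℤ → ℤ
  up_fix : ∀ i, b.arc i = i → a.arc (up i) = up i
  down_fix : ∀ i, a.arc i = i → b.arc (down i) = down i
  down_up : ∀ i, b.arc i = i → down (up i) = i
  up_down : ∀ i, a.arc i = i → up (down i) = i
  up_lt : ∀ i j, b.arc i = i → b.arc j = j → i < j → up i < up j
  up_add : ∀ i k, b.arc i = i → up (i + n * k) = up i + n * k

namespace Matching

variable {a b : Half n} (s : Matching a b)

theorem down_lt {i j : ℤ} (hi : a.arc i = i) (hj : a.arc j = j) (h : i < j) :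
    s.down i < s.down j := by
  by_contra hc
  rcases (not_lt.1 hc).lt_or_eq with h' | h'
  · have := s.up_lt _ _ (s.down_fix j hj) (s.down_fix i hi) h'
    rw [s.up_down i hi, s.up_down j hj] at this
    omega
  · have := congrArg s.up h'
    rw [s.up_down i hi, s.up_down j hj] at this
    omega

theorem down_add {i : ℤ} (k : ℤ) (hi : a.arc i = i) : s.down (i + n * k) = s.down i + n * k := by
  have h1 := s.up_add (s.down i) k (s.down_fix i hi)
  rw [s.up_down i hi] at h1
  rw [← h1, s.down_up _ ((b.arc_add_fix _ _).2 (s.down_fix i hi))]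

/-- The other end of an edge of the diagram given by two halves and a matching. -/
def mate (x : ℤ × Fin 2) : ℤ × Fin 2 :=
  if x.2 = 0 then (if a.arc x.1 = x.1 then (s.down x.1, 1) else (a.arc x.1, 0))
  else (if b.arc x.1 = x.1 then (s.up x.1, 0) else (b.arc x.1, 1))

theorem mate_top {i : ℤ} (h : a.arc i = i) : s.mate (i, 0) = (s.down i, 1) := by simp [mate, h]

theorem mate_top_arc {i : ℤ} (h : a.arc i ≠ i) : s.mate (i, 0) = (a.arc i, 0) := by simp [mate, h]

theorem mate_bot {i : ℤ} (h : b.arc i = i) : s.mate (i, 1) = (s.up i, 0) := by simp [mate, h]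

theorem mate_bot_arc {i : ℤ} (h : b.arc i ≠ i) : s.mate (i, 1) = (b.arc i, 1) := by simp [mate, h]

theorem node_cases (a b : Half n) (P : ℤ × Fin 2 → Prop) (h1 : ∀ i, a.arc i = i → P (i, 0))
    (h2 : ∀ i, a.arc i ≠ i → P (i, 0)) (h3 : ∀ i, b.arc i = i → P (i, 1))
    (h4 : ∀ i, b.arc i ≠ i → P (i, 1)) (x : ℤ × Fin 2) : P x := by
  obtain ⟨i, e⟩ := x
  fin_cases e
  · by_cases h : a.arc i = i
    · exact h1 i h
    · exact h2 i h
  · by_cases h : b.arc i = i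
    · exact h3 i h
    · exact h4 i h

/-- The diagram given by two halves and a matching of their fixed points. -/
def diagram : Diagram n where
  mate := s.mate
  lines := 0
  mate_mate := by
    refine node_cases a b _ (fun i h => ?_) (fun i h => ?_) (fun i h => ?_) (fun i h => ?_)
    · rw [s.mate_top h, s.mate_bot (s.down_fix i h), s.up_down i h]
    · rw [s.mate_top_arc h, s.mate_top_arc ((a.arc_ne_iff i).2 h), a.arc_arc]
    · rw [s.mate_bot h, s.mate_top (s.up_fix i h), s.down_up i h]
    · rw [s.mate_bot_arc h, s.mate_bot_arc ((b.arc_ne_iff i).2 h), b.arc_arc]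
  mate_ne := by
    refine node_cases a b _ (fun i h => ?_) (fun i h => ?_) (fun i h => ?_) (fun i h => ?_)
    · rw [s.mate_top h]; simp
    · rw [s.mate_top_arc h]; simpa using h
    · rw [s.mate_bot h]; simp
    · rw [s.mate_bot_arc h]; simpa using h
  mate_shift k := by
    refine node_cases a b _ (fun i h => ?_) (fun i h => ?_) (fun i h => ?_) (fun i h => ?_) <;>
      simp only [shift]
    · rw [s.mate_top h, s.mate_top ((a.arc_add_fix i k).2 h), s.down_add k h]
    · rw [s.mate_top_arc h, s.mate_top_arc ((a.arc_add_ne i k).2 h), a.arc_add]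
    · rw [s.mate_bot h, s.mate_bot ((b.arc_add_fix i k).2 h), s.up_add i k h]
    · rw [s.mate_bot_arc h, s.mate_bot_arc ((b.arc_add_ne i k).2 h), b.arc_add]
  noncrossing := by
    refine node_cases a b _ (fun i h => ?_) (fun i h => ?_) (fun i h => ?_) (fun i h => ?_) <;>
    refine node_cases a b _ (fun j h' => ?_) (fun j h' => ?_) (fun j h' => ?_) (fun j h' => ?_) <;>
    simp only [s.mate_top, s.mate_top_arc, s.mate_bot, s.mate_bot_arc, h, h', ne_eq,
      not_false_eq_true, pos_lt_00, pos_lt_01, pos_lt_10, pos_lt_11, true_and, false_and, and_false,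
      and_true, not_and, not_lt]
    -- The positions on the boundary settle all but five cases: two vertical edges, a vertical edge
    -- and an arc below, an arc above and a vertical edge, two arcs above, two arcs below.
    · intro h1; exact (s.down_lt h h' h1).le
    · intro h1
      by_contra hc
      refine b.arc_ne (b.arc j) (s.down i) (not_le.1 hc) ?_ (s.down_fix i h)
      rw [b.arc_arc]; exact h1
    · intro h1
      by_contra hc
      exact a.arc_ne i j h1 (not_le.1 hc) h'
    · intro h1 h2
      have := a.noncrossing i j
      omega
    · intro h1 h2
      have := b.noncrossing (b.arc j) (b.arc i)
      rw [b.arc_arc, b.arc_arc] at this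
      omega
  lines_vertical h := absurd rfl h

@[simp] theorem diagram_mate : s.diagram.mate = s.mate := rfl

theorem half_zero : s.diagram.half 0 = a := by
  ext i
  show s.diagram.arc 0 i = a.arc i
  by_cases h : a.arc i = i
  · rw [h, Diagram.arc_fix_iff, diagram_mate, s.mate_top h]; simp
  · rw [Diagram.arc_eq_iff _ _ (Ne.symm h), diagram_mate, s.mate_top_arc h]

theorem half_one : s.diagram.half 1 = b := by
  ext i
  show s.diagram.arc 1 i = b.arc i
  by_cases h : b.arc i = i
  · rw [h, Diagram.arc_fix_iff, diagram_mate, s.mate_bot h]; simp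
  · rw [Diagram.arc_eq_iff _ _ (Ne.symm h), diagram_mate, s.mate_bot_arc h]

/-- The identity matching. -/
def refl (a : Half n) : Matching a a where
  up := _root_.id
  down := _root_.id
  up_fix _ h := h
  down_fix _ h := h
  down_up _ _ := rfl
  up_down _ _ := rfl
  up_lt _ _ _ _ h := h
  up_add _ _ _ := rfl

variable [NeZero n]

/-- The fixed point number `k` below is joined to the fixed point number `k + w` above. -/
noncomputable def rotate (a b : Half n) (hab : a.thr = b.thr) (ht : 0 < b.thr) (w : ℤ) :
    Matching a b where
  up i := a.en (b.idx i + w)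
  down i := b.en (a.idx i - w)
  up_fix i _ := a.arc_en (hab ▸ ht) _
  down_fix i _ := b.arc_en ht _
  down_up i h := by rw [a.idx_en (hab ▸ ht), add_sub_cancel_right, b.en_idx h]
  up_down i h := by rw [b.idx_en ht, sub_add_cancel, a.en_idx h]
  up_lt i j hi hj h := by
    rw [(a.en_strictMono (hab ▸ ht)).lt_iff_lt]
    have := (b.idx_lt hi hj).2 h
    omega
  up_add i k h := by
    rw [← a.en_add (hab ▸ ht), b.idx_add h, hab]
    congr 1; ring

end Matching

/-- The diagram with halves `a` and `b` and winding number `w`. -/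
noncomputable def glue [NeZero n] (a b : Half n) (hab : a.thr = b.thr) (ht : 0 < b.thr) (w : ℤ) : Diagram n :=
  (Matching.rotate a b hab ht w).diagram

/-- The diagram whose halves are both `h`, with straight vertical edges. -/
def mirror (h : Half n) : Diagram n := (Matching.refl h).diagram

section glue

variable [NeZero n] {a b : Half n} (hab : a.thr = b.thr) (ht : 0 < b.thr) (w : ℤ)

@[simp] theorem glue_half_zero : (glue a b hab ht w).half 0 = a := Matching.half_zero _

@[simp] theorem glue_half_one : (glue a b hab ht w).half 1 = b := Matching.half_one _

@[simp] theorem mirror_half_zero (h : Half n) : (mirror h).half 0 = h := Matching.half_zero _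

@[simp] theorem mirror_half_one (h : Half n) : (mirror h).half 1 = h := Matching.half_one _

theorem glue_bot (k : ℤ) : (glue a b hab ht w).mate (b.en k, 1) = (a.en (k + w), 0) := by
  refine (Matching.mate_bot _ (b.arc_en ht k)).trans ?_
  simp only [Matching.rotate]
  rw [b.idx_en ht]

theorem glue_bot_iff {i j : ℤ} : (glue a b hab ht w).mate (i, 1) = (j, 0) ↔
    ∃ k, i = b.en k ∧ j = a.en (k + w) := by
  constructor
  · intro h
    have h1 : b.arc i = i := by
      have := (glue a b hab ht w).arc_fix_iff 1 (i := i)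
      rw [← Diagram.half_arc, glue_half_one] at this
      rw [this, h]; simp
    obtain ⟨-, k, rfl⟩ := b.exists_en h1
    refine ⟨k, rfl, ?_⟩
    rw [glue_bot] at h
    exact (congrArg Prod.fst h).symm
  · rintro ⟨k, rfl, rfl⟩
    exact glue_bot hab ht w k

theorem through_eq (D : Diagram n) : D.through = (D.half 1).thr := by
  unfold Diagram.through Half.thr
  congr 1
  ext i
  rw [Finset.mem_filter, Finset.mem_filter]
  refine and_congr_right fun _ => ?_
  rw [Diagram.half_arc, Diagram.arc_fix_iff]
  generalize (D.mate ((i : ℤ) + 1, 1)).2 = e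
  revert e; decide

@[simp] theorem glue_through : (glue a b hab ht w).through = b.thr := by
  rw [through_eq, glue_half_one]

@[simp] theorem mirror_through (h : Half n) : (mirror h).through = h.thr := by
  rw [through_eq, mirror_half_one]

/-- The edge number `k` runs from `b.en k` to `a.en (k + w)`. By `en_pos_iff` it crosses `x = 1/2`
to the right if `-w ≤ k < 0` and to the left if `0 ≤ k < -w`, and the sizes of these intervals
differ by `w`. -/
theorem glue_winding : (glue a b hab ht w).winding = w := by
  have ha : 0 < a.thr := hab ▸ ht
  have h1 : {p : ℤ × ℤ | (glue a b hab ht w).mate (p.2, 1) = (p.1, 0) ∧ p.2 < p.1 ∧ p.2 ≤ 0 ∧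
      1 ≤ p.1} = (fun k => (a.en (k + w), b.en k)) '' Set.Ico (-w) 0 := by
    ext ⟨i, j⟩
    simp only [Set.mem_ofPred_eq, Set.mem_image, Set.mem_Ico, Prod.mk.injEq, glue_bot_iff]
    constructor
    · rintro ⟨⟨k, rfl, rfl⟩, -, h2, h3⟩
      have := b.en_pos_iff ht k
      have := a.en_pos_iff ha (k + w)
      exact ⟨k, ⟨by omega, by omega⟩, rfl, rfl⟩
    · rintro ⟨k, ⟨h2, h3⟩, rfl, rfl⟩
      have := b.en_pos_iff ht k
      have := a.en_pos_iff ha (k + w)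
      exact ⟨⟨k, rfl, rfl⟩, by omega, by omega, by omega⟩
  have h2 : {p : ℤ × ℤ | (glue a b hab ht w).mate (p.2, 1) = (p.1, 0) ∧ p.1 < p.2 ∧ p.1 ≤ 0 ∧
      1 ≤ p.2} = (fun k => (a.en (k + w), b.en k)) '' Set.Ico 0 (-w) := by
    ext ⟨i, j⟩
    simp only [Set.mem_ofPred_eq, Set.mem_image, Set.mem_Ico, Prod.mk.injEq, glue_bot_iff]
    constructor
    · rintro ⟨⟨k, rfl, rfl⟩, -, h2, h3⟩
      have := b.en_pos_iff ht k
      have := a.en_pos_iff ha (k + w)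
      exact ⟨k, ⟨by omega, by omega⟩, rfl, rfl⟩
    · rintro ⟨k, ⟨h2, h3⟩, rfl, rfl⟩
      have := b.en_pos_iff ht k
      have := a.en_pos_iff ha (k + w)
      exact ⟨⟨k, rfl, rfl⟩, by omega, by omega, by omega⟩
  have hinj : Function.Injective fun k => (a.en (k + w), b.en k) := fun k l e =>
    (b.en_strictMono ht).injective (congrArg Prod.snd e)
  rw [Diagram.winding, h1, h2, Set.ncard_image_of_injective _ hinj,
    Set.ncard_image_of_injective _ hinj, ← Finset.coe_Ico, ← Finset.coe_Ico,
    Set.ncard_coe_finset, Set.ncard_coe_finset, Int.card_Ico, Int.card_Ico]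
  omega

/-- The halves fix all horizontal edges, and each vertical edge is seen from its lower end point. -/
theorem half_ext {D D' : Diagram n} (h0 : D.half 0 = D'.half 0) (h1 : D.half 1 = D'.half 1)
    (hl : D.lines = D'.lines)
    (hm : ∀ i, (D.half 1).arc i = i → D.mate (i, 1) = D'.mate (i, 1)) : D = D' := by
  have key : ∀ x, D.mate x = D'.mate x := by
    refine Matching.node_cases (D.half 0) (D.half 1) _ (fun i h => ?_) (fun i h => ?_)
      (fun i h => hm i h) (fun i h => ?_)
    · have h2 := (D.arc_fix_iff 0).1 h
      have h3 : D.mate (i, 0) = ((D.mate (i, 0)).1, 1) := Prod.ext rfl (fin2_ne_zero h2)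
      have h4 : D.mate ((D.mate (i, 0)).1, 1) = (i, 0) := by rw [← h3, D.mate_mate]
      have h5 := hm (D.mate (i, 0)).1 (by
        rw [Diagram.half_arc, Diagram.arc_fix_iff, h4]; simp)
      rw [h4] at h5
      have h6 := congrArg D'.mate h5
      rw [D'.mate_mate] at h6
      rw [h3]; exact h6.symm
    · rw [D.mate_arc 0 h, ← D.half_arc, h0]
      rw [h0] at h
      exact (D'.mate_arc 0 h).symm
    · rw [D.mate_arc 1 h, ← D.half_arc, h1]
      rw [h1] at h
      exact (D'.mate_arc 1 h).symm
  exact Diagram.ext (funext key) hl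

/-- A diagram with vertical edges is determined by its halves and its winding number. -/
theorem exists_glue (D : Diagram n) (hD : 0 < D.through) :
    ∃ (hab : (D.half 0).thr = (D.half 1).thr) (ht : 0 < (D.half 1).thr),
      D = glue (D.half 0) (D.half 1) hab ht D.winding := by
  have ht : 0 < (D.half 1).thr := by rwa [← through_eq]
  set a := D.half 0 with ha
  set b := D.half 1 with hb
  have hbot : ∀ i, b.arc i = i → ∃ j, D.mate (i, 1) = (j, 0) ∧ a.arc j = j := by
    intro i hi
    have h1 := fin2_ne_one ((D.arc_fix_iff 1).1 hi)
    refine ⟨(D.mate (i, 1)).1, Prod.ext rfl h1, ?_⟩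
    rw [ha, Diagram.half_arc, Diagram.arc_fix_iff]
    have : ((D.mate (i, 1)).1, 0) = D.mate (i, 1) := Prod.ext rfl h1.symm
    rw [this, D.mate_mate]; simp
  -- An infinite line would leave no room for vertical edges.
  have hl : D.lines = 0 := by
    by_contra hl
    obtain ⟨j, h1, h2⟩ := hbot _ (b.arc_en ht 0)
    exact (D.arc_fix_iff 0).1 h2 (D.lines_vertical hl j)
  have ha0 : 0 < a.thr := by
    obtain ⟨j, -, h2⟩ := hbot _ (b.arc_en ht 0)
    exact (a.exists_en h2).1
  have hp : ∀ k, ∃ l, D.mate (b.en k, 1) = (a.en l, 0) := by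
    intro k
    obtain ⟨j, h1, h2⟩ := hbot _ (b.arc_en ht k)
    obtain ⟨-, l, rfl⟩ := a.exists_en h2
    exact ⟨l, h1⟩
  choose p hp using hp
  -- Two vertical edges whose end points are ordered differently above and below would cross.
  have hmono : StrictMono p := by
    intro k l hkl
    by_contra hc
    have hne : p k ≠ p l := by
      intro e
      have := hp l
      rw [← e, ← hp k, D.mate_inj, Prod.mk.injEq] at this
      have := (b.en_strictMono ht).injective this.1
      omega
    have h1 : a.en (p l) < a.en (p k) := a.en_strictMono ha0 (by omega)
    have h2 : b.en k < b.en l := b.en_strictMono ht hkl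
    have h3 : D.mate (a.en (p l), 0) = (b.en l, 1) := by rw [← hp, D.mate_mate]
    have h4 : D.mate (a.en (p k), 0) = (b.en k, 1) := by rw [← hp, D.mate_mate]
    have := D.noncrossing' h3 h4
    simp at this
    omega
  have hsurj : Function.Surjective p := by
    intro l
    have h1 := fin2_ne_zero ((D.arc_fix_iff 0).1 (a.arc_en ha0 l))
    have h2 : D.mate (a.en l, 0) = ((D.mate (a.en l, 0)).1, 1) := Prod.ext rfl h1
    have h3 : D.mate ((D.mate (a.en l, 0)).1, 1) = (a.en l, 0) := by rw [← h2, D.mate_mate]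
    have h4 : b.arc (D.mate (a.en l, 0)).1 = (D.mate (a.en l, 0)).1 := by
      rw [hb, Diagram.half_arc, Diagram.arc_fix_iff, h3]; simp
    obtain ⟨-, k, hk⟩ := b.exists_en h4
    refine ⟨k, ?_⟩
    rw [← hk, hp] at h3
    exact (a.en_strictMono ha0).injective (congrArg Prod.fst h3)
  -- A strictly monotone surjection of `ℤ` leaves no gaps, so it is a translation.
  have hsucc : ∀ k, p (k + 1) = p k + 1 := by
    intro k
    have h1 := hmono (show k < k + 1 by omega)
    obtain ⟨m, hm⟩ := hsurj (p k + 1)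
    have h2 : k < m := hmono.lt_iff_lt.1 (by omega)
    have h3 := hmono.monotone (show k + 1 ≤ m by omega)
    omega
  have htrans : ∀ k, p k = k + p 0 := by
    intro k
    induction k using Int.induction_on with
    | zero => simp
    | succ k ih => rw [hsucc, ih]; ring
    | pred k ih =>
      have := hsucc (-(k : ℤ) - 1)
      rw [sub_add_cancel, ih] at this
      linarith
  -- A shift by `n` raises the numbers of lower end points by `b.thr` and those of upper ones by
  -- `a.thr`; as `p` is a translation, the two agree.
  have hab : a.thr = b.thr := by
    have h1 := hp (0 + b.thr * 1)
    have h2 := D.mate_shift 1 (b.en 0, 1)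
    simp only [shift] at h2
    rw [b.en_add ht, h2, hp 0] at h1
    simp only at h1
    rw [← a.en_add ha0] at h1
    have h3 := (a.en_strictMono ha0).injective (congrArg Prod.fst h1)
    rw [htrans (0 + b.thr * 1)] at h3
    omega
  have key : D = glue a b hab ht (p 0) := by
    refine half_ext (by simp [ha]) (by simp [hb]) hl fun i hi => ?_
    obtain ⟨-, k, rfl⟩ := b.exists_en hi
    rw [glue_bot, hp, htrans]
  refine ⟨hab, ht, ?_⟩
  have : D.winding = p 0 := by
    conv_lhs => rw [key]
    exact glue_winding hab ht (p 0)
  rw [this, ← key]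

end glue

end matchings

/-! ### The involution of `{1, …, n}` induced by a half. -/

section residues

variable {n : ℕ} [NeZero n]

/-- The point of `Fin n` representing an integer modulo `n`; the points are numbered from `1`. -/
def res (x : ℤ) : Fin n :=
  ⟨((x - 1) % n).toNat, by
    have hn : 0 < (n : ℤ) := by exact_mod_cast NeZero.pos n
    have h1 := Int.emod_nonneg (x - 1) hn.ne'
    have h2 := Int.emod_lt_of_pos (x - 1) hn
    omega⟩

theorem res_spec (x : ℤ) : ∃ k : ℤ, x = ((res x : Fin n) : ℤ) + 1 + n * k := by
  have hn : 0 < (n : ℤ) := by exact_mod_cast NeZero.pos n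
  have h1 := Int.emod_nonneg (x - 1) hn.ne'
  refine ⟨(x - 1) / n, ?_⟩
  have := Int.emod_add_mul_ediv (x - 1) n
  simp only [res]
  rw [Int.toNat_of_nonneg h1]
  linarith

theorem fin_eq_of_add {i j : Fin n} {k l : ℤ} (h : (i : ℤ) + 1 + n * k = j + 1 + n * l) :
    i = j ∧ k = l := by
  have hi : ((i : ℕ) : ℤ) < n := by exact_mod_cast i.2
  have hj : ((j : ℕ) : ℤ) < n := by exact_mod_cast j.2
  have hkl : k = l := by
    rcases lt_trichotomy k l with h1 | h1 | h1
    · nlinarith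
    · exact h1
    · nlinarith
  subst hkl
  exact ⟨Fin.ext (by omega), rfl⟩

theorem res_eq (i : Fin n) (k : ℤ) : res ((i : ℤ) + 1 + n * k) = i := by
  obtain ⟨l, hl⟩ := res_spec (n := n) ((i : ℤ) + 1 + n * k)
  exact (fin_eq_of_add hl).1.symm

theorem res_add (x k : ℤ) : (res (x + n * k) : Fin n) = res x := by
  obtain ⟨l, hl⟩ := res_spec (n := n) x
  conv_lhs => rw [hl, add_assoc, ← mul_add, res_eq]

theorem res_eq_iff {x y : ℤ} : (res x : Fin n) = res y ↔ ∃ k : ℤ, y = x + n * k := by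
  constructor
  · intro h
    obtain ⟨k, hk⟩ := res_spec (n := n) x
    obtain ⟨l, hl⟩ := res_spec (n := n) y
    rw [← h] at hl
    exact ⟨l - k, by rw [mul_sub]; linarith⟩
  · rintro ⟨k, rfl⟩
    rw [res_add]

namespace Half

theorem res_arc_res (h : Half n) (x : ℤ) :
    (res (h.arc ((res x : Fin n) + 1)) : Fin n) = res (h.arc x) := by
  obtain ⟨k, hk⟩ := res_spec (n := n) x
  conv_rhs => rw [hk, h.arc_add, res_add]

/-- The involution induced on the points modulo `n`. -/
def perm (h : Half n) : Equiv.Perm (Fin n) :=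
  Function.Involutive.toPerm (fun i => res (h.arc ((i : ℤ) + 1))) fun i => by
    show res (h.arc ((res (h.arc ((i : ℤ) + 1)) : Fin n) + 1)) = i
    rw [h.res_arc_res, h.arc_arc]
    have := res_eq i 0
    rwa [mul_zero, add_zero] at this

theorem perm_apply (h : Half n) (i : Fin n) : h.perm i = res (h.arc ((i : ℤ) + 1)) := rfl

theorem perm_eq_iff (h : Half n) (i j : Fin n) :
    h.perm i = j ↔ ∃ k : ℤ, h.arc ((i : ℤ) + 1) = j + 1 + n * k := by
  rw [perm_apply]
  constructor
  · rintro rfl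
    exact res_spec _
  · rintro ⟨k, hk⟩
    rw [hk, res_eq]

theorem perm_fix_iff (h : Half n) (i : Fin n) :
    h.perm i = i ↔ h.arc ((i : ℤ) + 1) = (i : ℤ) + 1 := by
  rw [perm_eq_iff]
  constructor
  · rintro ⟨k, hk⟩
    have := h.eq_zero_of_arc hk
    rw [hk, this]; ring
  · intro e
    exact ⟨0, by rw [e]; ring⟩

/-- An involution pairs off the points that it moves. It follows that losing vertical edges means
losing at least two. -/
theorem thr_mod_two (h : Half n) : h.thr % 2 = n % 2 := by
  have h1 := Equiv.Perm.card_compl_support_modEq (p := 2) (n := 1) (σ := h.perm) (by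
    rw [pow_one, pow_two]
    ext1 i
    exact h.perm.left_inv i)
  rw [Fintype.card_fin] at h1
  refine Eq.trans ?_ h1
  congr 1
  rw [thr]
  congr 1
  ext i
  simp only [Finset.mem_filter, Finset.mem_univ, true_and, Finset.mem_compl,
    Equiv.Perm.mem_support, not_not]
  exact (h.perm_fix_iff i).symm

theorem thr_le {a b : Half n} (h : ∀ i, a.arc i ≠ i → b.arc i = a.arc i) : b.thr ≤ a.thr := by
  refine Finset.card_le_card fun i hi => ?_
  rw [Finset.mem_filter] at hi ⊢
  refine ⟨hi.1, ?_⟩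
  by_contra hc
  exact hc ((h _ hc).symm.trans hi.2)

/-- All fixed points of `b` are fixed by `a`, so if `b` has at least as many, the fixed points
agree, and nothing is left for further arcs. This identifies the circles of a product that has lost
no vertical edges. -/
theorem eq_of_thr_le {a b : Half n} (h : ∀ i, a.arc i ≠ i → b.arc i = a.arc i)
    (ht : a.thr ≤ b.thr) : b = a := by
  have h1 : (Finset.univ.filter fun i : Fin n => b.arc ((i : ℤ) + 1) = (i : ℤ) + 1) =
      Finset.univ.filter fun i : Fin n => a.arc ((i : ℤ) + 1) = (i : ℤ) + 1 := by
    refine Finset.eq_of_subset_of_card_le (fun i hi => ?_) ht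
    rw [Finset.mem_filter] at hi ⊢
    refine ⟨hi.1, ?_⟩
    by_contra hc
    exact hc ((h _ hc).symm.trans hi.2)
  ext i
  by_cases hi : a.arc i = i
  · obtain ⟨k, hk⟩ := res_spec (n := n) i
    rw [hk, a.arc_add_fix] at hi
    have h2 : res i ∈ Finset.univ.filter fun i : Fin n => a.arc ((i : ℤ) + 1) = (i : ℤ) + 1 := by
      rw [Finset.mem_filter]; exact ⟨Finset.mem_univ _, hi⟩
    rw [← h1, Finset.mem_filter] at h2
    rw [hk, b.arc_add, a.arc_add, h2.2, hi]
  · exact h i hi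

end Half

end residues

/-! ### Products of diagrams, in particular when the adjacent circles agree. -/

section composition

variable {n : ℕ} [NeZero n]

theorem half_eq_of (D : Diagram n) (e : Fin 2) (h : Half n)
    (h1 : ∀ i, h.arc i ≠ i → D.mate (i, e) = (h.arc i, e))
    (h2 : ∀ i, h.arc i = i → (D.mate (i, e)).2 ≠ e) : D.half e = h := by
  ext i
  rw [Diagram.half_arc]
  by_cases hi : h.arc i = i
  · rw [hi, Diagram.arc_fix_iff]; exact h2 i hi
  · rw [Diagram.arc_eq_iff _ _ (Ne.symm hi)]; exact h1 i hi

theorem comp_arc_top (A B : Diagram n) (i : ℤ) (h : (A.half 0).arc i ≠ i) :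
    ((A.comp B).half 0).arc i = (A.half 0).arc i := by
  rw [Diagram.half_arc, Diagram.arc_eq_iff _ _ (Ne.symm h)]
  exact compMate_top A B (A.mate_arc 0 h)

theorem comp_arc_bot (A B : Diagram n) (i : ℤ) (h : (B.half 1).arc i ≠ i) :
    ((A.comp B).half 1).arc i = (B.half 1).arc i := by
  rw [Diagram.half_arc, Diagram.arc_eq_iff _ _ (Ne.symm h)]
  exact compMate_bot A B (B.mate_arc 1 h)

theorem through_mod_two (D : Diagram n) : D.through % 2 = n % 2 := by
  rw [through_eq, Half.thr_mod_two]

/-- `through` counts lower end points. With vertical edges both counts agree by `exists_glue`;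
without, a fixed point above would be the upper end of a vertical edge. -/
theorem thr_top_le (D : Diagram n) : (D.half 0).thr ≤ D.through := by
  by_cases hD : 0 < D.through
  · obtain ⟨hab, -, -⟩ := exists_glue D hD
    rw [hab, through_eq]
  · by_contra h
    have ht : 0 < (D.half 0).thr := by omega
    have h1 := fin2_ne_zero ((D.arc_fix_iff 0).1 ((D.half 0).arc_en ht 0))
    have h2 : D.mate ((D.half 0).en 0, 0) = ((D.mate ((D.half 0).en 0, 0)).1, 1) := Prod.ext rfl h1
    have h3 := D.mate_mate ((D.half 0).en 0, 0)
    rw [h2] at h3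
    have h4 : (D.half 1).arc (D.mate ((D.half 0).en 0, 0)).1 = (D.mate ((D.half 0).en 0, 0)).1 := by
      rw [Diagram.half_arc, Diagram.arc_fix_iff, h3]; simp
    have := ((D.half 1).exists_en h4).1
    rw [← through_eq] at this
    exact hD this

theorem through_comp_le_left (A B : Diagram n) : (A.comp B).through ≤ A.through := by
  by_cases h : 0 < (A.comp B).through
  · obtain ⟨hab, -, -⟩ := exists_glue _ h
    rw [through_eq, ← hab]
    exact (Half.thr_le (comp_arc_top A B)).trans (thr_top_le A)
  · omega

/-- The nodes of a stack of two diagrams whose adjacent halves agree. -/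
theorem stack_conn_iff {A B : Diagram n} (h : A.half 1 = B.half 0) {i : ℤ}
    (hi : (B.half 0).arc i ≠ i) (y : ℤ × Fin 3) :
    Conn (stack A B) (i, 1) y ↔ y = (i, 1) ∨ y = ((B.half 0).arc i, 1) := by
  -- Both layers join `(j, 1)` to the same node, so the path closes up after two steps.
  have hA : ∀ j, (B.half 0).arc j ≠ j →
      place 0 1 A.mate ((j, 1) : ℤ × Fin 3) = ((B.half 0).arc j, 1) := by
    intro j hj
    have h1 := place_emb (show (0 : Fin 3) ≠ 1 by decide) A.mate (j, 1)
    rw [← h] at hj ⊢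
    rw [A.mate_arc 1 hj] at h1
    exact h1
  have hB : ∀ j, (B.half 0).arc j ≠ j →
      place 1 2 B.mate ((j, 1) : ℤ × Fin 3) = ((B.half 0).arc j, 1) := by
    intro j hj
    have h1 := place_emb (show (1 : Fin 3) ≠ 2 by decide) B.mate (j, 0)
    rw [B.mate_arc 0 hj] at h1
    exact h1
  constructor
  · intro hc
    refine Conn.invariant (fun y => y = (i, 1) ∨ y = ((B.half 0).arc i, 1)) ?_ hc (Or.inl rfl)
    rintro f (rfl | rfl) z (rfl | rfl)
    · exact Or.inr (hA i hi)
    · left; rw [hA _ (((B.half 0).arc_ne_iff i).2 hi), (B.half 0).arc_arc]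
    · exact Or.inr (hB i hi)
    · left; rw [hB _ (((B.half 0).arc_ne_iff i).2 hi), (B.half 0).arc_arc]
  · rintro (rfl | rfl)
    · exact Conn.refl _
    · rw [← hA i hi]
      exact Conn.step (by simp [stack]) _

/-- Each arc of the common half closes up with its mirror image, while a fixed point is led to an
outer row. Such a loop does not wind around the cylinder (`Half.eq_zero_of_arc`), so for `b` false
there is nothing. -/
theorem onLoop_iff {A B : Diagram n} (h : A.half 1 = B.half 0) (b : Prop) (x : ℤ × Fin 3) :
    OnLoop n (stack A B) {x | x.2 ≠ 1} b x ↔ b ∧ x.2 = 1 ∧ (B.half 0).arc x.1 ≠ x.1 := by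
  have main : ∀ i, (B.half 0).arc i ≠ i → ∀ k, Conn (stack A B) (i, 1) (shift n k (i, 1)) →
      k = 0 := by
    intro i hi k hk
    rw [stack_conn_iff h hi] at hk
    simp only [shift, Prod.mk.injEq, and_true] at hk
    rcases hk with e | e
    · have hn : (n : ℤ) ≠ 0 := by exact_mod_cast NeZero.ne n
      have : (n : ℤ) * k = 0 := by omega
      exact (mul_eq_zero.1 this).resolve_left hn
    · exact (B.half 0).eq_zero_of_arc e.symm
  obtain ⟨i, e⟩ := x
  constructor
  · intro hx
    have h1 : e = 1 := by simpa using hx.1 _ (Conn.refl _)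
    subst h1
    have h2 : (B.half 0).arc i ≠ i := by
      intro hi
      rw [← h] at hi
      have h3 := fin2_ne_one ((A.arc_fix_iff 1).1 hi)
      have h4 := hx.1 (place 0 1 A.mate (i, 1)) (Conn.step (by simp [stack]) _)
      have h5 := place_emb (show (0 : Fin 3) ≠ 1 by decide) A.mate (i, 1)
      have h6 : emb (0 : Fin 3) 1 (i, 1) = (i, 1) := rfl
      rw [h6] at h5
      rw [h5] at h4
      simp [emb, h3] at h4
    exact ⟨hx.2.1 (main i h2), rfl, h2⟩
  · rintro ⟨hb, h1, h2⟩
    simp only at h1 h2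
    subst h1
    refine ⟨fun y hy => ?_, fun _ => hb, fun _ => main i h2⟩
    rw [stack_conn_iff h h2] at hy
    rcases hy with rfl | rfl <;> simp

/-- The number of loops arising when two equal halves meet. -/
noncomputable def Half.loopNumber (h : Half n) : ℕ := (mirror h).loops (mirror h)

/-- The loops are the arcs of the common half modulo `n`. That their number depends on this half
alone is what makes the normalisation in `gunit` work. -/
theorem loops_eq {A B : Diagram n} (h : A.half 1 = B.half 0) :
    A.loops B = (B.half 0).loopNumber := by
  set c := B.half 0 with hc
  have hm : (mirror c).half 1 = (mirror c).half 0 := by simp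
  unfold Half.loopNumber Diagram.loops loopCount
  refine classCount_congr (stack_good _ _).equiv (stack_good _ _).equiv _root_.id ?_ ?_ ?_
  · intro x hx
    rw [onLoop_iff h] at hx
    rw [id, onLoop_iff hm, mirror_half_zero]
    exact hx
  · rintro ⟨i, e⟩ x' hx -
    rw [onLoop_iff h] at hx
    obtain ⟨-, h1, h2⟩ := hx
    simp only at h1 h2
    subst h1
    refine exists_congr fun k => ?_
    rw [stack_conn_iff h h2, id, stack_conn_iff hm (by rwa [mirror_half_zero]), mirror_half_zero,
      id, hc]
  · intro y hy
    rw [onLoop_iff hm, mirror_half_zero] at hy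
    refine ⟨y, (onLoop_iff h True y).2 hy, (stack_good _ _).equiv.refl _⟩

theorem newLines_eq {A B : Diagram n} (h : A.half 1 = B.half 0) : A.newLines B = 0 := by
  by_contra hc
  obtain ⟨w, hw⟩ := exists_of_loopCount hc
  rw [onLoop_iff h] at hw
  exact hw.1

theorem comp_mate_of {A B : Diagram n} {i j k : ℤ} (hA : A.mate (j, 1) = (k, 0))
    (hB : B.mate (i, 1) = (j, 0)) : (A.comp B).mate (i, 1) = (k, 0) := by
  have h1 := Conn.step (S := stack A B) (f := place 1 2 B.mate) (by simp [stack]) (emb 1 2 (i, 1))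
  rw [place_emb (by decide), hB] at h1
  have h2 := Conn.step (S := stack A B) (f := place 0 1 A.mate) (by simp [stack]) (emb 0 1 (j, 1))
  rw [place_emb (by decide), hA] at h2
  have h3 : Conn (stack A B) (emb 0 2 (i, 1)) (emb 0 2 (k, 0)) := Conn.trans h1 h2
  rcases compMate_unique A B h3 with e | e
  · simp at e
  · exact e.symm

theorem comp_half_one {A B : Diagram n} (h : A.half 1 = B.half 0) :
    (A.comp B).half 1 = B.half 1 := by
  refine half_eq_of _ _ _ (fun i hi => compMate_bot A B (B.mate_arc 1 hi)) fun i hi => ?_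
  have h1 := fin2_ne_one ((B.arc_fix_iff 1).1 hi)
  have h2 : B.mate (i, 1) = ((B.mate (i, 1)).1, 0) := Prod.ext rfl h1
  have h3 := B.mate_mate (i, 1)
  rw [h2] at h3
  have h4 : (B.half 0).arc (B.mate (i, 1)).1 = (B.mate (i, 1)).1 := by
    rw [Diagram.half_arc, Diagram.arc_fix_iff, h3]; simp
  rw [← h] at h4
  have h5 := fin2_ne_one ((A.arc_fix_iff 1).1 h4)
  have h6 : A.mate ((B.mate (i, 1)).1, 1) = ((A.mate ((B.mate (i, 1)).1, 1)).1, 0) :=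
    Prod.ext rfl h5
  rw [comp_mate_of h6 h2]
  simp

theorem comp_half_zero {A B : Diagram n} (h : A.half 1 = B.half 0) :
    (A.comp B).half 0 = A.half 0 := by
  refine half_eq_of _ _ _ (fun i hi => compMate_top A B (A.mate_arc 0 hi)) fun i hi => ?_
  have h1 := fin2_ne_zero ((A.arc_fix_iff 0).1 hi)
  have h2 : A.mate (i, 0) = ((A.mate (i, 0)).1, 1) := Prod.ext rfl h1
  have h3 := A.mate_mate (i, 0)
  rw [h2] at h3
  have h4 : (A.half 1).arc (A.mate (i, 0)).1 = (A.mate (i, 0)).1 := by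
    rw [Diagram.half_arc, Diagram.arc_fix_iff, h3]; simp
  rw [h] at h4
  have h5 := fin2_ne_zero ((B.arc_fix_iff 0).1 h4)
  have h6 : B.mate ((A.mate (i, 0)).1, 0) = ((B.mate ((A.mate (i, 0)).1, 0)).1, 1) :=
    Prod.ext rfl h5
  have h7 := B.mate_mate ((A.mate (i, 0)).1, 0)
  rw [h6] at h7
  have h8 := comp_mate_of h3 h7
  have h9 := (A.comp B).mate_mate ((B.mate ((A.mate (i, 0)).1, 0)).1, 1)
  rw [h8] at h9
  rw [h9]
  simp

/-- Up to a power of `δ` this writes a diagram as a product of two with equally many vertical edges,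
even if there are none. It is the reason why the ideals `I_s` are idempotent. -/
theorem comp_mirror (D : Diagram n) : D.comp (mirror (D.half 1)) = D := by
  have hh : D.half 1 = (mirror (D.half 1)).half 0 := by simp
  refine half_ext (comp_half_zero hh) ((comp_half_one hh).trans (by simp)) ?_ fun i hi => ?_
  · show D.lines + 0 + D.newLines _ = D.lines
    rw [newLines_eq hh]
    rfl
  · rw [comp_half_one hh, mirror_half_one] at hi
    have h1 := fin2_ne_one ((D.arc_fix_iff 1).1 hi)
    have h2 : D.mate (i, 1) = ((D.mate (i, 1)).1, 0) := Prod.ext rfl h1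
    rw [h2]
    exact comp_mate_of h2 (Matching.mate_bot _ hi)

variable {a b c d : Half n}

theorem glue_congr {a' b' : Half n} {hab : a.thr = b.thr} {hb : 0 < b.thr} {w w' : ℤ} (ha : a = a')
    (h : b = b') (hw : w = w') :
    glue a b hab hb w = glue a' b' (ha ▸ h ▸ hab) (h ▸ hb) w' := by
  subst ha h hw; rfl

theorem glue_comp_glue (hab : a.thr = b.thr) (hbc : b.thr = c.thr) (hc : 0 < c.thr) (w w' : ℤ) :
    (glue a b hab (hbc ▸ hc) w).comp (glue b c hbc hc w') =
      glue a c (hab.trans hbc) hc (w + w') := by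
  have hh : (glue a b hab (hbc ▸ hc) w).half 1 = (glue b c hbc hc w').half 0 := by simp
  refine half_ext ((comp_half_zero hh).trans (by simp)) ((comp_half_one hh).trans (by simp)) ?_ ?_
  · show 0 + 0 + Diagram.newLines _ _ = 0
    rw [newLines_eq hh]
  · intro i hi
    rw [comp_half_one hh, glue_half_one] at hi
    obtain ⟨-, k, rfl⟩ := c.exists_en hi
    rw [glue_bot, comp_mate_of (glue_bot hab (hbc ▸ hc) w (k + w')) (glue_bot hbc hc w' k)]
    congr 2
    ring

/-- Stacking a diagram on `[a, b, w]` loses vertical edges or yields some `[c, b, w']`. -/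
theorem comp_glue (A : Diagram n) (hab : a.thr = b.thr) (hb : 0 < b.thr) (w : ℤ) :
    (A.comp (glue a b hab hb w)).through < b.thr ∨
      ∃ (c : Half n) (hcb : c.thr = b.thr) (w' : ℤ),
        A.comp (glue a b hab hb w) = glue c b hcb hb w' := by
  set D := A.comp (glue a b hab hb w) with hD
  by_cases h : D.through < b.thr
  · exact Or.inl h
  · right
    have h1 : D.half 1 = b := by
      refine Half.eq_of_thr_le (fun i hi => ?_) (by rw [← through_eq]; omega)
      have := comp_arc_bot A (glue a b hab hb w) i
      rw [glue_half_one] at this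
      exact this hi
    obtain ⟨h2, h3, h4⟩ := exists_glue D (by omega)
    exact ⟨_, by rw [h2, h1], _, h4.trans (glue_congr rfl h1 rfl)⟩

/-- The upper arcs of the first factor and the lower arcs of the second one survive; if no vertical
edges are lost, they are all the arcs of the product. -/
theorem glue_comp_glue' (hab : a.thr = b.thr) (hb : 0 < b.thr) (hcd : c.thr = d.thr)
    (hd : 0 < d.thr) (had : a.thr = d.thr) (w w' : ℤ) :
    ((glue a b hab hb w).comp (glue c d hcd hd w')).through < d.thr ∨
      ∃ w'', (glue a b hab hb w).comp (glue c d hcd hd w') = glue a d had hd w'' := by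
  rcases comp_glue (glue a b hab hb w) hcd hd w' with h | ⟨c', hc', w'', h⟩
  · exact Or.inl h
  · right
    have h1 : c' = a := by
      refine Half.eq_of_thr_le (fun i hi => ?_) (by omega)
      have := comp_arc_top (glue a b hab hb w) (glue c d hcd hd w') i
      rw [h, glue_half_zero, glue_half_zero] at this
      exact this hi
    subst h1
    exact ⟨w'', h⟩

end composition

/-! ### Rotations, and why `u ^ n` is central. -/

section turning

variable {n : ℕ}

/-- The diagram joining the point `j` below to the point `j + c` above. -/
def turn (n : ℕ) (c : ℤ) : Diagram n where
  mate x := if x.2 = 0 then (x.1 - c, 1) else (x.1 + c, 0)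
  lines := 0
  mate_mate := by rintro ⟨i, e⟩; fin_cases e <;> simp
  mate_ne := by rintro ⟨i, e⟩; fin_cases e <;> simp
  mate_shift := by rintro k ⟨i, e⟩; fin_cases e <;> (simp [shift]; ring)
  noncrossing := by
    rintro ⟨i, e⟩ ⟨j, f⟩
    fin_cases e <;> fin_cases f <;> (simp; try omega)
  lines_vertical h := absurd rfl h

/-- Moving the nodes of the row `e`. -/
def slide (e : Fin 2) (c : ℤ) (x : ℤ × Fin 2) : ℤ × Fin 2 := (x.1 + if x.2 = e then c else 0, x.2)

theorem slide_slide (e : Fin 2) (c d : ℤ) (x : ℤ × Fin 2) :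
    slide e c (slide e d x) = slide e (c + d) x := by
  obtain ⟨i, f⟩ := x
  by_cases h : f = e
  · simp only [slide, h, if_true, Prod.mk.injEq, and_true]; ring
  · simp only [slide, h, if_false, add_zero]

theorem slide_zero (e : Fin 2) (x : ℤ × Fin 2) : slide e 0 x = x := by
  simp [slide]

theorem slide_injective (e : Fin 2) (c : ℤ) : Function.Injective (slide e c) := fun x y h => by
  have := congrArg (slide e (-c)) h
  simpa [slide_slide, slide_zero] using this

variable [NeZero n]

theorem turn_place {r : ℕ} {a b : Fin r} (hab : a ≠ b) (c i : ℤ) :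
    place a b (turn n c).mate (i, a) = (i - c, b) ∧
      place a b (turn n c).mate (i, b) = (i + c, a) := by
  simp [place, turn, emb, hab.symm]

theorem turn_loops (c : ℤ) (A : Diagram n) (t : Prop) :
    loopCount n (stack (turn n c) A) {x | x.2 ≠ 1} t = 0 := by
  refine loopCount_eq_zero fun x => ?_
  by_cases h : x.2 = 1
  · refine ⟨(x.1 + c, 0), ?_, by simp⟩
    have e : x = (x.1, 1) := Prod.ext rfl (by simp only [h])
    have h1 := Conn.step (S := stack (turn n c) A) (f := place 0 1 (turn n c).mate)
      (by simp [stack]) (x.1, 1)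
    rw [(turn_place (by decide) c x.1).2, ← e] at h1
    exact h1
  · exact ⟨x, Conn.refl _, h⟩

theorem loops_turn (c : ℤ) (A : Diagram n) (t : Prop) :
    loopCount n (stack A (turn n c)) {x | x.2 ≠ 1} t = 0 := by
  refine loopCount_eq_zero fun x => ?_
  by_cases h : x.2 = 1
  · refine ⟨(x.1 - c, 2), ?_, by simp⟩
    have e : x = (x.1, 1) := Prod.ext rfl (by simp only [h])
    have h1 := Conn.step (S := stack A (turn n c)) (f := place 1 2 (turn n c).mate)
      (by simp [stack]) (x.1, 1)
    rw [(turn_place (by decide) c x.1).1, ← e] at h1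
    exact h1
  · exact ⟨x, Conn.refl _, h⟩

/-- A rotation put on top only moves the upper end points by `c`; the product is `A` with its nodes
relabelled. -/
theorem turn_comp_mate (c : ℤ) (A : Diagram n) (x : ℤ × Fin 2) :
    ((turn n c).comp A).mate (slide 0 c x) = slide 0 c (A.mate x) := by
  have hG := stack_good (turn n c) A
  have s1 : ∀ x, Conn (stack (turn n c) A) (emb 0 2 (slide 0 c x)) (emb 1 2 x) := by
    rintro ⟨i, e⟩
    fin_cases e
    · have h1 := Conn.step (S := stack (turn n c) A) (f := place 0 1 (turn n c).mate)
        (by simp [stack]) (i + c, 0)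
      rw [(turn_place (by decide) c _).1, add_sub_cancel_right] at h1
      exact h1
    · have : slide 0 c (i, 1) = (i, 1) := by simp [slide]
      show Conn _ (emb 0 2 (slide 0 c (i, 1))) _
      rw [this]
      exact Conn.refl _
  have h1 := Conn.step (S := stack (turn n c) A) (f := place 1 2 A.mate)
    (by simp [stack]) (emb 1 2 x)
  rw [place_emb (by decide)] at h1
  have h2 := ((s1 x).trans h1).trans (hG.symm (s1 _))
  exact ((compMate_unique _ _ h2).resolve_left
    fun e => A.mate_ne x (slide_injective 0 c e)).symm

theorem comp_turn_mate (c : ℤ) (A : Diagram n) (x : ℤ × Fin 2) :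
    (A.comp (turn n c)).mate (slide 1 (-c) x) = slide 1 (-c) (A.mate x) := by
  have hG := stack_good A (turn n c)
  have s1 : ∀ x, Conn (stack A (turn n c)) (emb 0 2 (slide 1 (-c) x)) (emb 0 1 x) := by
    rintro ⟨i, e⟩
    fin_cases e
    · have : slide 1 (-c) (i, 0) = (i, 0) := by simp [slide]
      show Conn _ (emb 0 2 (slide 1 (-c) (i, 0))) _
      rw [this]
      exact Conn.refl _
    · have h1 := Conn.step (S := stack A (turn n c)) (f := place 1 2 (turn n c).mate)
        (by simp [stack]) (i + -c, 2)
      rw [(turn_place (by decide) c _).2, neg_add_cancel_right] at h1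
      exact h1
  have h1 := Conn.step (S := stack A (turn n c)) (f := place 0 1 A.mate)
    (by simp [stack]) (emb 0 1 x)
  rw [place_emb (by decide)] at h1
  have h2 := ((s1 x).trans h1).trans (hG.symm (s1 _))
  exact ((compMate_unique _ _ h2).resolve_left
    fun e => A.mate_ne x (slide_injective 1 (-c) e)).symm

/-- Moving the upper nodes forward by `n` and the lower nodes back by `n` differ by a full shift,
which leaves diagrams unchanged. Hence `u ^ n` has the same effect on either side. -/
theorem slide_shift (x : ℤ × Fin 2) : slide 0 n x = shift n 1 (slide 1 (-n) x) := by
  obtain ⟨i, e⟩ := x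
  fin_cases e <;> simp [slide, shift]

theorem turn_comp_comm (A : Diagram n) : (turn n n).comp A = A.comp (turn n n) := by
  ext1
  · funext x
    obtain ⟨y, rfl⟩ : ∃ y, x = slide 0 n y := ⟨slide 0 (-n) x, by simp [slide_slide, slide_zero]⟩
    rw [turn_comp_mate, slide_shift, slide_shift, Diagram.mate_shift, comp_turn_mate]
  · show 0 + A.lines + loopCount n (stack (turn n n) A) {x | x.2 ≠ 1} False =
      A.lines + 0 + loopCount n (stack A (turn n n)) {x | x.2 ≠ 1} False
    rw [turn_loops, loops_turn]; omega

theorem turn_comp_turn (c d : ℤ) : (turn n c).comp (turn n d) = turn n (c + d) := by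
  ext1
  · funext x
    obtain ⟨y, rfl⟩ : ∃ y, x = slide 0 c y := ⟨slide 0 (-c) x, by simp [slide_slide, slide_zero]⟩
    rw [turn_comp_mate]
    obtain ⟨i, e⟩ := y
    fin_cases e
    · simp [turn, slide]; ring
    · simp [turn, slide]; ring
  · show 0 + 0 + loopCount n (stack (turn n c) (turn n d)) {x | x.2 ≠ 1} False = 0
    rw [turn_loops]

theorem turn_zero_comp (A : Diagram n) : (turn n 0).comp A = A := by
  have : turn n 0 = Diagram.id n := by
    ext1
    · funext ⟨i, e⟩
      fin_cases e <;> simp [turn, Diagram.id]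
    · rfl
  rw [this, id_comp]

/-- Moving the upper end points by `n` raises their numbers by the number of fixed points per
period. This is the source of `u ^ n = τ ^ t`. -/
theorem turn_comp_glue {a b : Half n} (hab : a.thr = b.thr) (hb : 0 < b.thr) (w : ℤ) :
    (turn n n).comp (glue a b hab hb w) = glue a b hab hb (w + b.thr) := by
  have h0 : ∀ i, slide 0 n (i, 0) = (i + n, 0) := fun i => by simp [slide]
  have h1 : ∀ c i, slide 0 c (i, 1) = (i, 1) := fun c i => by simp [slide]
  have m0 : ∀ i, ((turn n n).comp (glue a b hab hb w)).mate (i, 0) =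
      slide 0 n ((glue a b hab hb w).mate (i - n, 0)) := fun i => by
    rw [← turn_comp_mate, h0, sub_add_cancel]
  have m1 : ∀ i, ((turn n n).comp (glue a b hab hb w)).mate (i, 1) =
      slide 0 n ((glue a b hab hb w).mate (i, 1)) := fun i => by rw [← turn_comp_mate, h1]
  have hbot : ((turn n n).comp (glue a b hab hb w)).half 1 = b := by
    refine half_eq_of _ _ _ (fun i hi => ?_) fun i hi => ?_
    · rw [m1]
      refine (congrArg _ (Matching.mate_bot_arc _ hi)).trans (h1 _ _)
    · rw [m1]
      obtain ⟨-, k, rfl⟩ := b.exists_en hi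
      rw [glue_bot, h0]
      simp
  refine half_ext ?_ (hbot.trans (by simp)) ?_ ?_
  · rw [glue_half_zero]
    have e : ∀ i : ℤ, i - n = i + n * (-1) := fun i => by ring
    refine half_eq_of _ _ _ (fun i hi => ?_) fun i hi => ?_
    · rw [m0]
      have h2 : a.arc (i - n) ≠ i - n := by rw [e, a.arc_add_ne]; exact hi
      refine (congrArg _ (Matching.mate_top_arc _ h2)).trans ((h0 _).trans ?_)
      rw [e, a.arc_add]
      congr 1
      ring
    · rw [m0]
      have h2 : a.arc (i - n) = i - n := by rw [e, a.arc_add_fix]; exact hi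
      have := congrArg (slide 0 n) (Matching.mate_top (Matching.rotate a b hab hb w) h2)
      rw [h1] at this
      refine fun h' => ?_
      have h'' := (congrArg Prod.snd this).symm.trans h'
      simp at h''
  · show 0 + 0 + loopCount n (stack (turn n n) _) {x | x.2 ≠ 1} False = 0
    rw [turn_loops]
  · intro i hi
    rw [hbot] at hi
    obtain ⟨-, k, rfl⟩ := b.exists_en hi
    rw [m1, glue_bot, glue_bot, h0]
    have := a.en_add (hab ▸ hb) (k + w) 1
    rw [mul_one, mul_one] at this
    rw [← this, hab, add_assoc]

end turning

/-! ### Annular involutions with fixed points are the same as halves with fixed points. -/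

section annular

variable {n : ℕ} [NeZero n]

/-- `Exchanges` speaks only of distinct points; the fixed points of `S` are determined as those
exchanged with no other point. -/
theorem exchanges_iff (D : Diagram n) (e : Fin 2) (S : Equiv.Perm (Fin n)) :
    D.Exchanges e S ↔ (D.half e).perm = S := by
  have h : ∀ i j : Fin n, i ≠ j → ((D.half e).perm i = j ↔
      ∃ k : ℤ, D.mate ((i : ℤ) + 1, e) = ((j : ℤ) + 1 + n * k, e)) := by
    intro i j hij
    rw [Half.perm_eq_iff]
    refine exists_congr fun k => D.arc_eq_iff e fun h => hij ?_
    refine (fin_eq_of_add (k := 0) (l := k) ?_).1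
    rw [mul_zero, add_zero, h]
  constructor
  · intro hS
    ext1 i
    by_cases hi : S i = i
    · rw [hi]
      by_contra hc
      exact hc (hi.symm.trans ((hS i _ (Ne.symm hc)).2 ((h i _ (Ne.symm hc)).1 rfl))).symm
    · exact (h i _ (Ne.symm hi)).2 ((hS i _ (Ne.symm hi)).1 rfl)
  · rintro rfl i j hij
    exact h i j hij

theorem glue_is {a b : Half n} (hab : a.thr = b.thr) (hb : 0 < b.thr) (w : ℤ) :
    (glue a b hab hb w).Is a.perm b.perm w := by
  refine ⟨by rwa [glue_through], ?_, ?_, glue_winding hab hb w⟩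
  · rw [exchanges_iff, glue_half_zero]
  · rw [exchanges_iff, glue_half_one]

/-- Points congruent modulo `n` that can both be reached from `x` without meeting a periodic set
are equal. -/
theorem window_unique {F : ℤ → Prop} (hF : ∀ z k, F (z + n * k) ↔ F z) (hne : ∃ z, F z)
    {x y k : ℤ} (h : ∀ z, (x ≤ z ∧ z ≤ y) ∨ (y ≤ z ∧ z ≤ x) → ¬ F z)
    (h' : ∀ z, (x ≤ z ∧ z ≤ y + n * k) ∨ (y + n * k ≤ z ∧ z ≤ x) → ¬ F z) : k = 0 := by
  have hn : 0 < (n : ℤ) := by exact_mod_cast NeZero.pos n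
  have hwin : ∀ x : ℤ, ∃ z, x ≤ z ∧ z < x + n ∧ F z := by
    intro x
    obtain ⟨z, hz⟩ := hne
    have h1 := Int.emod_nonneg (z - x) hn.ne'
    have h2 := Int.emod_lt_of_pos (z - x) hn
    have h3 := Int.emod_add_mul_ediv (z - x) n
    refine ⟨(z - x) % n + x, by omega, by omega, ?_⟩
    rw [← hF _ ((z - x) / n)]
    convert hz using 1
    linarith
  -- The intervals from `x` to `y` and from `x` to `y + n * k` together cover all points between `y`
  -- and `y + n * k`. For `k ≠ 0` that is a full period, so it meets `F`.
  obtain ⟨f, f1, f2, f3⟩ := hwin x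
  obtain ⟨g, g1, g2, g3⟩ := hwin y
  obtain ⟨e, e1, e2, e3⟩ := hwin (y + n * k)
  have hf : ¬ ((x ≤ f ∧ f ≤ y) ∨ (y ≤ f ∧ f ≤ x)) := fun hz => h f hz f3
  have hf' : ¬ ((x ≤ f ∧ f ≤ y + n * k) ∨ (y + n * k ≤ f ∧ f ≤ x)) := fun hz => h' f hz f3
  have hg : ¬ ((x ≤ g ∧ g ≤ y) ∨ (y ≤ g ∧ g ≤ x)) := fun hz => h g hz g3
  have hg' : ¬ ((x ≤ g ∧ g ≤ y + n * k) ∨ (y + n * k ≤ g ∧ g ≤ x)) := fun hz => h' g hz g3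
  have he : ¬ ((x ≤ e ∧ e ≤ y) ∨ (y ≤ e ∧ e ≤ x)) := fun hz => h e hz e3
  have he' : ¬ ((x ≤ e ∧ e ≤ y + n * k) ∨ (y + n * k ≤ e ∧ e ≤ x)) := fun hz => h' e hz e3
  rcases lt_trichotomy k 0 with hk | hk | hk
  · have : n * k ≤ -n := by nlinarith
    omega
  · exact hk
  · have : n ≤ n * k := by nlinarith
    omega

namespace Half

theorem perm_res (h : Half n) (x : ℤ) : h.perm (res x) = res (h.arc x) := by
  rw [perm_apply, res_arc_res]

theorem perm_res_fix (h : Half n) (x : ℤ) : h.perm (res x) = res x ↔ h.arc x = x := by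
  rw [perm_res]
  constructor
  · intro e
    obtain ⟨k, hk⟩ := res_eq_iff.1 e.symm
    rw [hk, h.eq_zero_of_arc hk]; ring
  · intro e; rw [e]

theorem between_ne (h : Half n) {x : ℤ} (hx : h.arc x ≠ x) {z : ℤ}
    (hz : (x ≤ z ∧ z ≤ h.arc x) ∨ (h.arc x ≤ z ∧ z ≤ x)) : h.arc z ≠ z := by
  intro hc
  have h1 : z ≠ x := fun e => hx (e ▸ hc)
  have h2 : z ≠ h.arc x := fun e => by
    rw [e, h.arc_arc] at hc; exact hx hc.symm
  have h3 := h.arc_ne x z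
  have h4 := h.arc_ne (h.arc x) z
  rw [h.arc_arc] at h4
  rcases hz with hz | hz
  · exact h3 (by omega) (by omega) hc
  · exact h4 (by omega) (by omega) hc

/-- A half with fixed points is determined by the involution that it induces modulo `n`. -/
theorem perm_injective {a b : Half n} (ha : 0 < a.thr) (h : a.perm = b.perm) : a = b := by
  have hfix : ∀ x, a.arc x = x ↔ b.arc x = x := fun x => by
    rw [← a.perm_res_fix, h, b.perm_res_fix]
  ext x
  by_cases hx : a.arc x = x
  · rw [hx, (hfix x).1 hx]
  · have h1 : (res (a.arc x) : Fin n) = res (b.arc x) := by rw [← perm_res, h, perm_res]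
    obtain ⟨k, hk⟩ := res_eq_iff.1 h1
    have := window_unique (F := fun z => a.arc z = z) (fun z k => a.arc_add_fix z k)
      ⟨_, a.arc_en ha 0⟩ (fun z hz => a.between_ne hx hz) (k := k) (fun z hz => by
        rw [← hk] at hz
        rw [hfix]
        exact b.between_ne (fun e => hx ((hfix x).2 e)) hz)
    rw [hk, this]; ring

end Half

theorem image_eq_iff {S : Equiv.Perm (Fin n)} (hS : S * S = 1) (A : Set (Fin n)) :
    S '' A = A ↔ ∀ x ∈ A, S x ∈ A := by
  have hSS : ∀ x, S (S x) = x := fun x => by rw [← Equiv.Perm.mul_apply, hS]; rfl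
  constructor
  · intro h x hx
    have : S x ∈ S '' A := ⟨x, hx, rfl⟩
    rwa [h] at this
  · intro h
    ext x
    constructor
    · rintro ⟨y, hy, rfl⟩; exact h y hy
    · intro hx; exact ⟨S x, h x hx, hSS x⟩

theorem reverse_apply (S : Equiv.Perm (Fin n)) (i : Fin n) : reverse S i = (S i.rev).rev := by
  simp [reverse, Equiv.Perm.mul_apply]

theorem reverse_reverse (S : Equiv.Perm (Fin n)) : reverse (reverse S) = S := by
  ext1 i
  rw [reverse_apply, reverse_apply, Fin.rev_rev, Fin.rev_rev]

/-- Reversal maps intervals to intervals and fixed points to fixed points. It is needed since the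
cell elements carry `reverse S₂` on the lower circle. -/
theorem IsAnnular.reverse {t : ℕ} {S : Equiv.Perm (Fin n)} (h : IsAnnular t S) :
    IsAnnular t (AffineTL.reverse S) := by
  obtain ⟨h1, h2, h3⟩ := h
  have hSS : ∀ x, S (S x) = x := fun x => by rw [← Equiv.Perm.mul_apply, h1]; rfl
  have hfix : ∀ i, i ∈ Function.fixedPoints (AffineTL.reverse S) ↔
      i.rev ∈ Function.fixedPoints S := by
    intro i
    rw [Function.mem_fixedPoints_iff, Function.mem_fixedPoints_iff, reverse_apply, Fin.rev_eq_iff]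
  have hone : AffineTL.reverse S * AffineTL.reverse S = 1 := by
    ext1 i
    rw [Equiv.Perm.mul_apply, reverse_apply, reverse_apply, Fin.rev_rev, hSS, Fin.rev_rev]
    rfl
  refine ⟨hone, fun i j hij e => ?_, ?_⟩
  · rw [reverse_apply, Fin.rev_eq_iff] at e
    have e' : S j.rev = i.rev := by rw [← e, hSS]
    have hmem : ∀ x, x ∈ Set.Icc i j ↔ x.rev ∈ Set.Icc j.rev i.rev := by
      intro x
      rw [Set.mem_Icc, Set.mem_Icc, Fin.rev_le_rev, Fin.rev_le_rev, and_comm]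
    obtain ⟨g1, g2⟩ := h2 _ _ (Fin.rev_lt_rev.2 hij) e'
    rw [image_eq_iff h1] at g1
    refine ⟨?_, ?_⟩
    · rw [image_eq_iff hone]
      intro x hx
      rw [hmem] at hx ⊢
      rw [reverse_apply, Fin.rev_rev]
      exact g1 _ hx
    · rcases g2 with g2 | g2
      · left
        rw [Set.eq_empty_iff_forall_notMem] at g2 ⊢
        rintro x ⟨hx, hx'⟩
        exact g2 x.rev ⟨(hmem x).1 hx, (hfix x).1 hx'⟩
      · right
        intro x hx
        rw [hmem]
        exact g2 ((hfix x).1 hx)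
  · rw [← h3, ← Set.ncard_image_of_injective _ Fin.rev_injective]
    congr 1
    ext x
    constructor
    · rintro ⟨y, hy, rfl⟩
      exact (hfix y).1 hy
    · intro hx
      exact ⟨x.rev, by rw [hfix, Fin.rev_rev]; exact hx, Fin.rev_rev x⟩

/-- `x` and `y` lie over points exchanged by `S`, and there is no fixed point between them. -/
def Linked (S : Equiv.Perm (Fin n)) (x y : ℤ) : Prop :=
  S (res x) = res y ∧ ∀ z, (x ≤ z ∧ z ≤ y) ∨ (y ≤ z ∧ z ≤ x) → S (res z) ≠ res z

namespace Linked

variable {S : Equiv.Perm (Fin n)} {x y y' : ℤ}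

theorem add (h : Linked S x y) (k : ℤ) : Linked S (x + n * k) (y + n * k) := by
  refine ⟨by rw [res_add, res_add, h.1], fun z hz => ?_⟩
  have := h.2 (z + n * (-k)) (by
    rw [mul_neg]; omega)
  rwa [res_add] at this

theorem symm (hS : S * S = 1) (h : Linked S x y) : Linked S y x := by
  refine ⟨?_, fun z hz => h.2 z hz.symm⟩
  rw [← h.1, ← Equiv.Perm.mul_apply, hS]; rfl

theorem unique (hne : ∃ i, S i = i) (h : Linked S x y) (h' : Linked S x y') : y' = y := by
  obtain ⟨k, hk⟩ := res_eq_iff.1 (h.1.symm.trans h'.1)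
  have := window_unique (F := fun z => S (res z) = res z) (fun z k => by rw [res_add])
    (by
      obtain ⟨i, hi⟩ := hne
      refine ⟨(i : ℤ) + 1 + n * 0, ?_⟩
      rw [res_eq, hi]) h.2 (k := k) (hk ▸ h'.2)
  rw [hk, this]; ring

end Linked

/-- `l` and `m` number the blocks of length `n` in which the points lie; a step to the right by less
than `n` ends in the same block or in the next one. -/
theorem block_cases {i j : Fin n} {l m : ℤ} (h1 : (i : ℤ) + 1 + n * m ≤ j + 1 + n * l)
    (h2 : (j : ℤ) + 1 + n * l < i + 1 + n * m + n) : l = m ∨ l = m + 1 := by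
  have hi : ((i : ℕ) : ℤ) < n := by exact_mod_cast i.2
  have hj : ((j : ℕ) : ℤ) < n := by exact_mod_cast j.2
  have hl : m - 1 < l := by nlinarith
  have hm : l < m + 2 := by nlinarith
  omega

/-- If `[i, j]` contains no fixed points, the arc is drawn inside it. If it contains all of them,
the arc goes the other way round, from `i` leftwards to `j - n`. Hence `k` is `0` or `-1`. -/
theorem exists_linked_of_lt {t : ℕ} {S : Equiv.Perm (Fin n)} (h : IsAnnular t S) {i j : Fin n}
    (hij : i < j) (e : S i = j) : ∃ k : ℤ, Linked S ((i : ℤ) + 1 + n * 0) (j + 1 + n * k) := by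
  have hj : ((j : ℕ) : ℤ) < n := by exact_mod_cast j.2
  have e' : S j = i := by rw [← e, ← Equiv.Perm.mul_apply, h.1]; rfl
  have hij' : (i : ℕ) < j := hij
  rcases (h.2.1 i j hij e).2 with g | g
  · refine ⟨0, by rw [res_eq, res_eq, e], fun z hz => ?_⟩
    obtain ⟨l, hl⟩ := res_spec (n := n) z
    intro hc
    rw [Set.eq_empty_iff_forall_notMem] at g
    refine g (res z) ⟨?_, hc⟩
    have hz' : (res z : Fin n).1 < n := (res z : Fin n).2
    rw [hl] at hz
    rw [Set.mem_Icc, Fin.le_def, Fin.le_def]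
    have hl0 := block_cases (i := i) (j := (res z : Fin n)) (l := l) (m := 0) (by omega) (by omega)
    rcases hl0 with rfl | rfl <;> constructor <;> omega
  · refine ⟨-1, by rw [res_eq, res_eq, e], fun z hz => ?_⟩
    obtain ⟨l, hl⟩ := res_spec (n := n) z
    intro hc
    have hmem := Set.mem_Icc.1 (g (show res z ∈ Function.fixedPoints S from hc))
    rw [Fin.le_def, Fin.le_def] at hmem
    have n1 : (res z : Fin n).1 ≠ i := fun h' => by
      rw [Fin.ext h', e] at hc; exact hij.ne hc.symm
    have n2 : (res z : Fin n).1 ≠ j := fun h' => by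
      rw [Fin.ext h', e'] at hc; exact hij.ne hc
    rw [hl] at hz
    have hl0 := block_cases (i := j) (j := (res z : Fin n)) (l := l) (m := -1) (by omega) (by omega)
    rcases hl0 with rfl | rfl <;> omega

theorem exists_linked {t : ℕ} {S : Equiv.Perm (Fin n)} (h : IsAnnular t S) {x : ℤ}
    (hx : S (res x) ≠ res x) : ∃ y, Linked S x y := by
  obtain ⟨m, hm⟩ := res_spec (n := n) x
  set i : Fin n := res x
  rcases lt_or_gt_of_ne hx with hlt | hlt
  · obtain ⟨k, hk⟩ := exists_linked_of_lt h hlt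
      (show S (S i) = i by rw [← Equiv.Perm.mul_apply, h.1]; rfl)
    have := (hk.symm h.1).add (m - k)
    refine ⟨(((S i : Fin n) : ℕ) : ℤ) + 1 + n * 0 + n * (m - k), ?_⟩
    convert this using 1
    rw [hm]; ring
  · obtain ⟨k, hk⟩ := exists_linked_of_lt h hlt rfl
    have := hk.add m
    refine ⟨(((S i : Fin n) : ℕ) : ℤ) + 1 + n * k + n * m, ?_⟩
    convert this using 1
    rw [hm]; ring

theorem linked_noncrossing {t : ℕ} {S : Equiv.Perm (Fin n)} (h : IsAnnular t S)
    (hne : ∃ i, S i = i) {a b c d : ℤ} (hac : Linked S a c) (hbd : Linked S b d) (h1 : a < b)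
    (h2 : b < c) (h3 : c < d) : False := by
  have hn : 0 < (n : ℤ) := by exact_mod_cast NeZero.pos n
  -- The intervals `[a, c]` and `[b, d]` overlap, so there is no fixed point over `[a, d]`, whereas
  -- every window of length `n` contains one.
  have hd : d < a + n := by
    by_contra hc
    obtain ⟨i, hi⟩ := hne
    have e1 := Int.emod_nonneg ((i : ℤ) + 1 - a) hn.ne'
    have e2 := Int.emod_lt_of_pos ((i : ℤ) + 1 - a) hn
    have e3 := Int.emod_add_mul_ediv ((i : ℤ) + 1 - a) n
    have e4 : ((i : ℤ) + 1 - a) % n + a = i + 1 + n * (-(((i : ℤ) + 1 - a) / n)) := by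
      linarith
    have e5 := hac.2 (((i : ℤ) + 1 - a) % n + a)
    have e6 := hbd.2 (((i : ℤ) + 1 - a) % n + a)
    have e7 : S (res (((i : ℤ) + 1 - a) % n + a)) = res (((i : ℤ) + 1 - a) % n + a) := by
      rw [e4, res_eq, hi]
    by_cases hle : ((i : ℤ) + 1 - a) % n + a ≤ c
    · exact e5 (Or.inl ⟨by omega, hle⟩) e7
    · exact e6 (Or.inl ⟨by omega, by omega⟩) e7
  obtain ⟨ma, ha⟩ := res_spec (n := n) a
  obtain ⟨mb, hb⟩ := res_spec (n := n) b
  obtain ⟨mc, hc⟩ := res_spec (n := n) c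
  obtain ⟨md, hd'⟩ := res_spec (n := n) d
  have hSac := hac.1
  have hSca := (hac.symm h.1).1
  have hSbd := hbd.1
  have hSdb := (hbd.symm h.1).1
  have hfa := hac.2 a (Or.inl ⟨le_rfl, by omega⟩)
  have ub := block_cases (i := res a) (j := res b) (l := mb) (m := ma) (by omega) (by omega)
  have uc := block_cases (i := res a) (j := res c) (l := mc) (m := ma) (by omega) (by omega)
  have ud := block_cases (i := res a) (j := res d) (l := md) (m := ma) (by omega) (by omega)
  generalize hA : (res a : Fin n) = A at *
  generalize hB : (res b : Fin n) = B at *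
  generalize hC : (res c : Fin n) = C at *
  generalize hD : (res d : Fin n) = D at *
  have hA' := A.2
  have hB' := B.2
  have hC' := C.2
  have hD' := D.2
  -- An interval between exchanged points is stable under `S`, so it contains both of `B`, `D` or
  -- neither.
  have key : ∀ i j : Fin n, i < j → S i = j → (B ∈ Set.Icc i j ↔ D ∈ Set.Icc i j) := by
    intro i j hij e
    have := (image_eq_iff h.1 _).1 (h.2.1 i j hij e).1
    exact ⟨fun hx => hSbd ▸ this _ hx, fun hx => hSdb ▸ this _ hx⟩
  simp only [Set.mem_Icc, Fin.le_def, Fin.lt_def] at key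
  have hAC : A.1 ≠ C.1 := fun e => hfa (by rw [hSac, Fin.ext e])
  have k1 := fun hh => key A C hh hSac
  have k2 := fun hh => key C A hh hSca
  clear key
  -- In each position of the block boundary, exactly one of `B`, `D` lies between `A` and `C`.
  rcases ub with rfl | rfl <;> rcases uc with rfl | rfl <;> rcases ud with rfl | rfl <;>
    (try simp only [mul_add, mul_one] at *) <;> rcases lt_or_gt_of_ne hAC with hlt | hlt
  all_goals first
    | (have := k1 hlt; omega)
    | (have := k2 hlt; omega)

/-- Every annular involution with fixed points comes from a half. -/
theorem exists_half {t : ℕ} (ht : 0 < t) {S : Equiv.Perm (Fin n)} (h : IsAnnular t S) :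
    ∃ a : Half n, a.perm = S ∧ a.thr = t := by
  classical
  have hne : ∃ i, S i = i := by
    by_contra hc
    have : Function.fixedPoints S = ∅ := by
      rw [Set.eq_empty_iff_forall_notMem]
      exact fun i hi => hc ⟨i, hi⟩
    have h3 := h.2.2
    rw [this, Set.ncard_empty] at h3
    omega
  -- The lift: trivial over fixed points, and otherwise the end point of an arc avoiding them, which
  -- is unique by `Linked.unique`.
  have hex : ∀ x : ℤ, ∃ y, (S (res x) = res x → y = x) ∧ (S (res x) ≠ res x → Linked S x y) := by
    intro x
    by_cases hx : S (res x) = res x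
    · exact ⟨x, fun _ => rfl, fun h' => absurd hx h'⟩
    · obtain ⟨y, hy⟩ := exists_linked h hx
      exact ⟨y, fun h' => absurd h' hx, fun _ => hy⟩
  choose f hf hf' using hex
  have hfix : ∀ x, f x = x ↔ S (res x) = res x := by
    intro x
    refine ⟨fun e => ?_, hf x⟩
    by_contra hc
    have := (hf' x hc).1
    rw [e] at this
    exact hc this
  have hL : ∀ x, f x ≠ x → Linked S x (f x) := fun x hx => hf' x fun e => hx ((hfix x).2 e)
  have hends : ∀ {x y}, Linked S x y → S (res y) ≠ res y := fun {x y} hxy =>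
    hxy.2 y (by rcases le_total x y with h | h <;> simp [h])
  let a : Half n :=
    { arc := f
      arc_arc := fun i => by
        by_cases hi : f i = i
        · rw [hi, hi]
        · have h1 := hL i hi
          exact (h1.symm h.1).unique hne (hf' _ (hends h1))
      arc_add := fun i k => by
        by_cases hi : f i = i
        · rw [hi, hfix, res_add, ← hfix, hi]
        · refine ((hL i hi).add k).unique hne (hL _ ?_)
          rwa [ne_eq, hfix, res_add, ← hfix]
      noncrossing := fun i j hij =>
        linked_noncrossing h hne (hL i (by omega)) (hL j (by omega)) hij.1 hij.2.1 hij.2.2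
      arc_ne := fun i j h1 h2 => by
        rw [ne_eq, hfix]
        exact (hL i (by omega)).2 j (Or.inl ⟨h1.le, h2.le⟩) }
  have hperm : a.perm = S := by
    ext1 i
    have hi : (res ((i : ℤ) + 1) : Fin n) = i := by
      have := res_eq i 0
      rwa [mul_zero, add_zero] at this
    rw [Half.perm_apply]
    show res (f ((i : ℤ) + 1)) = S i
    by_cases hx : f ((i : ℤ) + 1) = (i : ℤ) + 1
    · have := (hfix _).1 hx
      rw [hx, ← this, hi]
    · rw [← (hL _ hx).1, hi]
  refine ⟨a, hperm, ?_⟩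
  have h3 := h.2.2
  rw [← h3, Set.ncard_eq_toFinset_card', Half.thr]
  congr 1
  ext i
  simp only [Finset.mem_filter, Finset.mem_univ, true_and, Set.mem_toFinset,
    Function.mem_fixedPoints_iff]
  rw [← a.perm_fix_iff, hperm]

end annular

open DAlg

/-! ### Coefficients and the filtration by vertical edges. -/

section coefficients

variable {n : ℕ} [NeZero n] {K : Type*} [Field K] {δ : K}

/-- The coefficient of a diagram. -/
noncomputable def coeff (D : Diagram n) : DAlg n δ →ₗ[K] K :=
  (Finsupp.lapply D : (Diagram n →₀ K) →ₗ[K] K)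

open Classical in
theorem coeff_of (D A : Diagram n) : coeff D (of δ A) = if A = D then 1 else 0 :=
  Finsupp.single_apply

theorem finite_coeff (x : DAlg n δ) : {D : Diagram n | coeff D x ≠ 0}.Finite :=
  Finsupp.hasFiniteSupport (x : Diagram n →₀ K)

/-- The span of the diagrams with at most `s` vertical edges. -/
noncomputable def level (n : ℕ) [NeZero n] (δ : K) (s : ℤ) : Submodule K (DAlg n δ) :=
  Submodule.span K {a : DAlg n δ | ∃ D : Diagram n, (D.through : ℤ) ≤ s ∧ a = of δ D}

theorem mem_levelIdeal {s : ℤ} {x : DAlg n δ} : x ∈ levelIdeal n δ s ↔ x ∈ level n δ s := Iff.rfl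

theorem of_mem_level {s : ℤ} {D : Diagram n} (h : (D.through : ℤ) ≤ s) : of δ D ∈ level n δ s :=
  Submodule.subset_span ⟨D, h, rfl⟩

theorem level_le {s : ℤ} {W : Submodule K (DAlg n δ)}
    (h : ∀ D : Diagram n, (D.through : ℤ) ≤ s → of δ D ∈ W) : level n δ s ≤ W := by
  refine Submodule.span_le.2 ?_
  rintro _ ⟨D, hD, rfl⟩
  exact h D hD

theorem level_mono {s s' : ℤ} (h : s ≤ s') : level n δ s ≤ level n δ s' :=
  level_le fun _ hD => of_mem_level (hD.trans h)

theorem mem_level_iff {s : ℤ} {x : DAlg n δ} :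
    x ∈ level n δ s ↔ ∀ D : Diagram n, ¬ (D.through : ℤ) ≤ s → coeff D x = 0 := by
  constructor
  · intro hx D hD
    have : level n δ s ≤ LinearMap.ker (coeff (δ := δ) D) := level_le fun A hA => by
      rw [LinearMap.mem_ker, coeff_of, if_neg]
      rintro rfl; exact hD hA
    exact this hx
  · intro h
    have key : ∀ y : Diagram n →₀ K, (∀ D : Diagram n, ¬ (D.through : ℤ) ≤ s → y D = 0) →
        y ∈ Submodule.span K ((fun D => Finsupp.single D 1) ''
          {D : Diagram n | (D.through : ℤ) ≤ s}) := by
      intro y hy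
      rw [← Finsupp.supported_eq_span_single, Finsupp.mem_supported]
      intro D hD
      by_contra hc
      exact (Finsupp.mem_support_iff.1 hD) (hy D hc)
    refine Submodule.span_mono ?_ (key x h)
    rintro _ ⟨D, hD, rfl⟩
    exact ⟨D, hD, rfl⟩

theorem mul_mem_level {s : ℤ} (c : DAlg n δ) {x : DAlg n δ} (hx : x ∈ level n δ s) :
    c * x ∈ level n δ s := (levelIdeal n δ s).mul_mem_left c hx

/-- `levelIdeal` is a left ideal by construction. The right-hand side needs `through_comp_le_left`,
that is, the number of vertical edges seen from above. -/
theorem mem_level_mul {s : ℤ} {x : DAlg n δ} (hx : x ∈ level n δ s) (c : DAlg n δ) :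
    x * c ∈ level n δ s := by
  have : level n δ s ≤ (level n δ s).comap (LinearMap.mulRight K c) := level_le fun D hD => by
    rw [Submodule.mem_comap, LinearMap.mulRight_apply]
    induction c using DAlg.ind with
    | zero => rw [mul_zero]; exact zero_mem _
    | add a b ha hb => rw [mul_add]; exact add_mem ha hb
    | smul k A =>
      rw [mul_smul_comm, of_mul_of]
      refine Submodule.smul_mem _ _ (Submodule.smul_mem _ _ (of_mem_level (le_trans ?_ hD)))
      exact_mod_cast through_comp_le_left D A
  exact this hx

/-- An injective map acting freely on the diagrams with property `P` has no eigenvectors on their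
span. -/
theorem coeff_eq_zero_of_free (φ : Diagram n → Diagram n) (hφ : Function.Injective φ)
    (P : Diagram n → Prop) (hP : ∀ D, P D → P (φ D))
    (hfree : ∀ D, P D → Function.Injective fun k : ℕ => φ^[k] D) {q : K}
    {x : DAlg n δ} (hx : ∀ D, P D → coeff D (extend δ (fun D => of δ (φ D)) x - q • x) = 0)
    {D : Diagram n} (hD : P D) : coeff D x = 0 := by
  classical
  have h1 : ∀ D, coeff (φ D) (extend δ (fun D => of δ (φ D)) x) = coeff D x := by
    intro D
    have : (coeff (φ D)) ∘ₗ (extend δ (fun D => of δ (φ D))) = coeff (δ := δ) D :=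
      hom_ext fun A => by
        rw [LinearMap.comp_apply, extend_of, coeff_of, coeff_of]
        simp only [hφ.eq_iff]
    exact congrArg (fun f => f x) this
  by_contra hc
  -- A nonzero coefficient at a diagram forces one at its image under `φ`, hence along a whole
  -- infinite orbit, against finite support.
  have h2 : ∀ k : ℕ, P (φ^[k] D) ∧ coeff (φ^[k] D) x ≠ 0 := by
    intro k
    induction k with
    | zero => exact ⟨hD, hc⟩
    | succ k ih =>
      rw [Function.iterate_succ_apply']
      refine ⟨hP _ ih.1, fun h0 => ih.2 ?_⟩
      have := hx _ (hP _ ih.1)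
      rw [map_sub, h1, map_smul, h0, smul_zero, sub_zero] at this
      exact this
  exact Set.infinite_of_injective_forall_mem (hfree D hD) (fun k => (h2 k).2) (finite_coeff x)

end coefficients

/-! ### Diagrams with `t` vertical edges as matrix units. -/

section units

variable {n : ℕ} [NeZero n] {K : Type*} [Field K] {δ : K} {t : ℕ}

/-- The halves with `t` fixed points. -/
abbrev Level (n t : ℕ) : Type := {h : Half n // h.thr = t}

theorem Level.eq_thr (a b : Level n t) : a.1.thr = b.1.thr := a.2.trans b.2.symm

theorem Level.pos (ht : 0 < t) (a : Level n t) : 0 < a.1.thr := a.2.symm ▸ ht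

variable (δ) in
/-- A multiple of `[a, b, w]`; these elements multiply like matrix units. -/
noncomputable def gunit (ht : 0 < t) (a b : Level n t) (w : ℤ) : DAlg n δ :=
  (δ ^ b.1.loopNumber)⁻¹ • of δ (glue a.1 b.1 (a.eq_thr b) (b.pos ht) w)

theorem of_glue (hδ : δ ≠ 0) (ht : 0 < t) (a b : Level n t) (w : ℤ) :
    of δ (glue a.1 b.1 (a.eq_thr b) (b.pos ht) w) = δ ^ b.1.loopNumber • gunit δ ht a b w := by
  rw [gunit, smul_smul, mul_inv_cancel₀ (pow_ne_zero _ hδ), one_smul]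

/-- The loops that arise are those of the common circle `b`, and their factor is removed by the
normalisation of the first factor; the winding numbers add. -/
theorem gunit_mul (hδ : δ ≠ 0) (ht : 0 < t) (a b c : Level n t) (w w' : ℤ) :
    gunit δ ht a b w * gunit δ ht b c w' = gunit δ ht a c (w + w') := by
  have h := of_mul_of (δ := δ) (glue a.1 b.1 (a.eq_thr b) (b.pos ht) w)
    (glue b.1 c.1 (b.eq_thr c) (c.pos ht) w')
  rw [loops_eq (by simp), glue_half_zero, glue_comp_glue (a.eq_thr b) (b.eq_thr c) (c.pos ht)] at h
  rw [gunit, gunit, smul_mul_smul_comm, h, smul_smul, gunit]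
  congr 1
  field_simp [hδ]

theorem gunit_mem_level (ht : 0 < t) (a b : Level n t) (w : ℤ) :
    gunit δ ht a b w ∈ level n δ t :=
  Submodule.smul_mem _ _ (of_mem_level (by rw [glue_through, b.2]))

/-- The span of the diagrams with bottom `b`, together with those having less vertical edges. -/
noncomputable def columnSpan (δ : K) (ht : 0 < t) (b : Level n t) : Submodule K (DAlg n δ) :=
  Submodule.span K {x | ∃ c w, x = gunit δ ht c b w} ⊔ level n δ ((t : ℤ) - 2)

/-- The span of the diagrams with top `a` and bottom `b`, together with those having less vertical
edges. -/
noncomputable def cellSpan (δ : K) (ht : 0 < t) (a b : Level n t) : Submodule K (DAlg n δ) :=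
  Submodule.span K {x | ∃ w, x = gunit δ ht a b w} ⊔ level n δ ((t : ℤ) - 2)

theorem gunit_mem_columnSpan (ht : 0 < t) (a b : Level n t) (w : ℤ) :
    gunit δ ht a b w ∈ columnSpan δ ht b :=
  Submodule.mem_sup_left (Submodule.subset_span ⟨a, w, rfl⟩)

theorem gunit_mem_cellSpan (ht : 0 < t) (a b : Level n t) (w : ℤ) :
    gunit δ ht a b w ∈ cellSpan δ ht a b :=
  Submodule.mem_sup_left (Submodule.subset_span ⟨w, rfl⟩)

theorem columnSpan_le {ht : 0 < t} {b : Level n t} {W : Submodule K (DAlg n δ)}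
    (h1 : level n δ ((t : ℤ) - 2) ≤ W) (h2 : ∀ c w, gunit δ ht c b w ∈ W) :
    columnSpan δ ht b ≤ W := by
  refine sup_le (Submodule.span_le.2 ?_) h1
  rintro _ ⟨c, w, rfl⟩
  exact h2 c w

theorem cellSpan_le {ht : 0 < t} {a b : Level n t} {W : Submodule K (DAlg n δ)}
    (h1 : level n δ ((t : ℤ) - 2) ≤ W) (h2 : ∀ w, gunit δ ht a b w ∈ W) :
    cellSpan δ ht a b ≤ W := by
  refine sup_le (Submodule.span_le.2 ?_) h1
  rintro _ ⟨w, rfl⟩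
  exact h2 w

/-- By parity the number of vertical edges drops in steps of two; so whatever leaves level `t` lies
in `I_{t-2}`. -/
theorem through_le_of_lt (hpar : t % 2 = n % 2) {D : Diagram n} (h : D.through < t) :
    (D.through : ℤ) ≤ (t : ℤ) - 2 := by
  have := through_mod_two D
  omega

theorem through_pos_of_lt (ht : 0 < t) (hpar : t % 2 = n % 2) {D : Diagram n}
    (h : ¬ (D.through : ℤ) ≤ (t : ℤ) - 2) : 0 < D.through := by
  have := through_mod_two D
  omega

theorem exists_of_eq_glue (D : Diagram n) (ht : 0 < t) (hD : D.through = t) :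
    ∃ a b : Level n t, ∃ w, D = glue a.1 b.1 (a.eq_thr b) (b.pos ht) w := by
  obtain ⟨hab, hb, h⟩ := exists_glue D (by omega)
  have h1 : (D.half 1).thr = t := by rw [← through_eq, hD]
  exact ⟨⟨_, hab.trans h1⟩, ⟨_, h1⟩, _, h⟩

theorem level_le_of (hδ : δ ≠ 0) (ht : 0 < t) (hpar : t % 2 = n % 2) {W : Submodule K (DAlg n δ)}
    (h1 : level n δ ((t : ℤ) - 2) ≤ W) (h2 : ∀ a b w, gunit δ ht a b w ∈ W) :
    level n δ t ≤ W := by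
  refine level_le fun D hD => ?_
  by_cases h : D.through < t
  · exact h1 (of_mem_level (through_le_of_lt hpar h))
  · obtain ⟨a, b, w, rfl⟩ := exists_of_eq_glue D ht (by omega)
    rw [of_glue hδ ht]
    exact W.smul_mem _ (h2 a b w)

theorem mul_gunit_mem (hδ : δ ≠ 0) (ht : 0 < t) (hpar : t % 2 = n % 2) (x : DAlg n δ)
    (a b : Level n t) (w : ℤ) : x * gunit δ ht a b w ∈ columnSpan δ ht b := by
  induction x using DAlg.ind with
  | zero => rw [zero_mul]; exact zero_mem _
  | add x y hx hy => rw [add_mul]; exact add_mem hx hy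
  | smul k A =>
    rw [gunit, smul_mul_smul_comm, of_mul_of]
    refine Submodule.smul_mem _ _ (Submodule.smul_mem _ _ ?_)
    rcases comp_glue A (a.eq_thr b) (b.pos ht) w with h | ⟨c, hc, w', h⟩
    · rw [b.2] at h
      exact Submodule.mem_sup_right (of_mem_level (through_le_of_lt hpar h))
    · rw [h]
      have := of_glue (w := w') hδ ht ⟨c, hc.trans b.2⟩ b
      rw [this]
      exact Submodule.smul_mem _ _ (gunit_mem_columnSpan ht _ b w')

theorem gunit_mul_mem (hδ : δ ≠ 0) (ht : 0 < t) (hpar : t % 2 = n % 2) (a b c d : Level n t)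
    (w w' : ℤ) : gunit δ ht a b w * gunit δ ht c d w' ∈ cellSpan δ ht a d := by
  rw [gunit, gunit, smul_mul_smul_comm, of_mul_of]
  refine Submodule.smul_mem _ _ (Submodule.smul_mem _ _ ?_)
  rcases glue_comp_glue' (a.eq_thr b) (b.pos ht) (c.eq_thr d) (d.pos ht) (a.eq_thr d) w w' with
    h | ⟨w'', h⟩
  · rw [d.2] at h
    exact Submodule.mem_sup_right (of_mem_level (through_le_of_lt hpar h))
  · rw [h, of_glue hδ ht a d]
    exact Submodule.smul_mem _ _ (gunit_mem_cellSpan ht a d w'')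

/-- Multiplication by `x` stays in the column `d`, and the top circle is then forced to be `a` by
the factor on the left. -/
theorem gunit_mul_mul_mem (hδ : δ ≠ 0) (ht : 0 < t) (hpar : t % 2 = n % 2) (a b c d : Level n t)
    (w w' : ℤ) (x : DAlg n δ) :
    gunit δ ht a b w * (x * gunit δ ht c d w') ∈ cellSpan δ ht a d := by
  have h : columnSpan δ ht d ≤
      (cellSpan δ ht a d).comap (LinearMap.mulLeft K (gunit δ ht a b w)) := by
    refine columnSpan_le (fun y hy => ?_) fun c w'' => ?_
    · exact Submodule.mem_sup_right (mul_mem_level _ hy)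
    · exact gunit_mul_mem hδ ht hpar a b c d w w''
  exact h (mul_gunit_mem hδ ht hpar x c d w')

end units

/-! ### The operator `τ` and its compatibility with the left action. -/

section brackets

variable {n : ℕ} [NeZero n] {K : Type*} [Field K] {δ : K} {t : ℕ}

/-- `bracket` chooses some diagram with the given data. The choice is unique, because diagrams are
determined by their halves and winding number, and halves with fixed points by their involutions. -/
theorem bracket_eq {a b : Half n} (hab : a.thr = b.thr) (hb : 0 < b.thr) (w : ℤ) :
    bracket δ a.perm b.perm w = of δ (glue a b hab hb w) := by
  have h : ∃ D : Diagram n, D.Is a.perm b.perm w := ⟨_, glue_is hab hb w⟩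
  rw [bracket, dif_pos h]
  congr 1
  obtain ⟨h1, h2, h3, h4⟩ := h.choose_spec
  rw [exchanges_iff] at h2 h3
  obtain ⟨h5, h6, h7⟩ := exists_glue _ h1
  rw [h7]
  exact glue_congr (Half.perm_injective (h5 ▸ h6) h2) (Half.perm_injective h6 h3) h4

/-- The diagram with winding number increased by one. -/
noncomputable def twist (D : Diagram n) : Diagram n :=
  if h : 0 < D.through then
    glue _ _ (exists_glue D h).choose (exists_glue D h).choose_spec.choose (D.winding + 1)
  else D

theorem twist_glue {a b : Half n} (hab : a.thr = b.thr) (hb : 0 < b.thr) (w : ℤ) :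
    twist (glue a b hab hb w) = glue a b hab hb (w + 1) := by
  rw [twist, dif_pos (by rwa [glue_through])]
  exact glue_congr (by simp) (by simp) (by rw [glue_winding])

theorem twist_of_eq_zero {D : Diagram n} (h : ¬ 0 < D.through) : twist D = D := dif_neg h

theorem twist_through (D : Diagram n) : (twist D).through = D.through := by
  by_cases h : 0 < D.through
  · rw [twist, dif_pos h, glue_through, through_eq]
  · rw [twist_of_eq_zero h]

theorem twist_winding {D : Diagram n} (h : 0 < D.through) :
    (twist D).winding = D.winding + 1 := by
  rw [twist, dif_pos h, glue_winding]

theorem twist_injective : Function.Injective (twist (n := n)) := by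
  intro D D' h
  have h1 := congrArg Diagram.through h
  rw [twist_through, twist_through] at h1
  by_cases hD : 0 < D.through
  · have hD' : 0 < D'.through := h1 ▸ hD
    obtain ⟨e1, e2, e3⟩ := exists_glue D hD
    obtain ⟨e1', e2', e3'⟩ := exists_glue D' hD'
    have hw : D.winding = D'.winding := by
      have := congrArg Diagram.winding h
      rw [twist_winding hD, twist_winding hD'] at this
      omega
    have h0 : D.half 0 = D'.half 0 := by
      have := congrArg (fun D => D.half 0) h
      rw [e3, e3', twist_glue, twist_glue] at this
      simpa using this
    have h1 : D.half 1 = D'.half 1 := by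
      have := congrArg (fun D => D.half 1) h
      rw [e3, e3', twist_glue, twist_glue] at this
      simpa using this
    rw [e3, e3']
    exact glue_congr h0 h1 hw
  · rwa [twist_of_eq_zero hD, twist_of_eq_zero (h1 ▸ hD)] at h

theorem tau_of (D : Diagram n) : tau n δ (of δ D) = of δ (twist D) := by
  rw [tau, extend_of]
  by_cases hD : 0 < D.through
  · obtain ⟨h1, h2, h3⟩ := exists_glue D hD
    have h : ∃ S₁ S₂ : Equiv.Perm (Fin n), D.Is S₁ S₂ D.winding :=
      ⟨(D.half 0).perm, (D.half 1).perm, hD, (exchanges_iff D 0 _).2 rfl,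
        (exchanges_iff D 1 _).2 rfl, rfl⟩
    rw [dif_pos h]
    obtain ⟨-, g1, g2, -⟩ := h.choose_spec.choose_spec
    rw [exchanges_iff] at g1 g2
    have h4 := bracket_eq (δ := δ) h1 h2 (D.winding + 1)
    rw [g1, g2] at h4
    refine h4.trans ?_
    conv_rhs => rw [h3, twist_glue]
  · rw [dif_neg, twist_of_eq_zero hD]
    rintro ⟨S₁, S₂, h, -⟩
    exact hD h

theorem tau_eq : tau n δ = extend δ fun D => of δ (twist D) :=
  hom_ext fun D => by rw [tau_of, extend_of]

theorem tau_gunit (ht : 0 < t) (a b : Level n t) (w : ℤ) :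
    tau n δ (gunit δ ht a b w) = gunit δ ht a b (w + 1) := by
  rw [gunit, map_smul, tau_of, twist_glue, gunit]

theorem tau_pow_gunit (ht : 0 < t) (a b : Level n t) (w : ℤ) (k : ℕ) :
    (tau n δ ^ k) (gunit δ ht a b w) = gunit δ ht a b (w + k) := by
  induction k with
  | zero => simp
  | succ k ih =>
    rw [pow_succ', Module.End.mul_apply, ih, tau_gunit]
    congr 1; push_cast; ring

theorem tau_mem_level {s : ℤ} {x : DAlg n δ} (hx : x ∈ level n δ s) :
    tau n δ x ∈ level n δ s := by
  have : level n δ s ≤ (level n δ s).comap (tau n δ) := level_le fun D hD => by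
    rw [Submodule.mem_comap, tau_of]
    exact of_mem_level (by rwa [twist_through])
  exact this hx

theorem aeval_mem_level {s : ℤ} (f : K[X]) {x : DAlg n δ} (hx : x ∈ level n δ s) :
    aeval (tau n δ) f x ∈ level n δ s := by
  induction f using Polynomial.induction_on' with
  | add p q hp hq => rw [map_add, LinearMap.add_apply]; exact add_mem hp hq
  | monomial k c =>
    rw [aeval_monomial, Module.End.mul_apply, Module.algebraMap_end_apply]
    refine Submodule.smul_mem _ _ ?_
    induction k with
    | zero => exact hx
    | succ k ih => rw [pow_succ', Module.End.mul_apply]; exact tau_mem_level ih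

theorem iterate_twist_injective {D : Diagram n} (hD : 0 < D.through) :
    Function.Injective fun k : ℕ => twist^[k] D := by
  have h : ∀ k : ℕ, 0 < (twist^[k] D).through ∧ (twist^[k] D).winding = D.winding + k := by
    intro k
    induction k with
    | zero => simpa using hD
    | succ k ih =>
      rw [Function.iterate_succ_apply', twist_through, twist_winding ih.1, ih.2]
      exact ⟨ih.1, by push_cast; ring⟩
  intro k l e
  have := congrArg Diagram.winding e
  simp only [(h _).2] at this
  omega

/-- `τ - r` is injective modulo `I_{t-2}`. -/
theorem mem_level_of_tau_sub (ht : 0 < t) (hpar : t % 2 = n % 2) {r : K}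
    {x : DAlg n δ} (hx : tau n δ x - r • x ∈ level n δ ((t : ℤ) - 2)) :
    x ∈ level n δ ((t : ℤ) - 2) := by
  rw [mem_level_iff] at hx ⊢
  intro D hD
  rw [tau_eq] at hx
  -- Repeated twisting increases the winding number, so it acts freely on the diagrams outside
  -- `I_{t-2}`, all of which have vertical edges.
  exact coeff_eq_zero_of_free twist twist_injective (fun D => ¬ (D.through : ℤ) ≤ (t : ℤ) - 2)
    (fun D h => by rwa [twist_through])
    (fun D h => iterate_twist_injective (through_pos_of_lt ht hpar h)) hx hD

/-- `τ` commutes with the left action modulo `I_{t-2}`. -/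
theorem tau_mul_sub_mem (hδ : δ ≠ 0) (ht : 0 < t) (hpar : t % 2 = n % 2) (d : DAlg n δ)
    {y : DAlg n δ} (hy : y ∈ level n δ t) :
    tau n δ (d * y) - d * tau n δ y ∈ level n δ ((t : ℤ) - 2) := by
  have key : level n δ t ≤ (level n δ ((t : ℤ) - 2)).comap
      (tau n δ ∘ₗ LinearMap.mulLeft K d - LinearMap.mulLeft K d ∘ₗ tau n δ) := by
    refine level_le_of hδ ht hpar (fun l hl => ?_) fun a b w => ?_
    · show tau n δ (d * l) - d * tau n δ l ∈ level n δ ((t : ℤ) - 2)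
      exact sub_mem (tau_mem_level (mul_mem_level d hl)) (mul_mem_level d (tau_mem_level hl))
    · show tau n δ (d * gunit δ ht a b w) - d * tau n δ (gunit δ ht a b w) ∈ level n δ ((t : ℤ) - 2)
      -- On the column `b` the map `τ` is right multiplication by `gunit b b 1`, which commutes with
      -- every left multiplication.
      rw [tau_gunit, ← gunit_mul hδ ht a b b w 1, ← mul_assoc]
      have h2 : columnSpan δ ht b ≤ (level n δ ((t : ℤ) - 2)).comap
          (tau n δ - LinearMap.mulRight K (gunit δ ht b b 1)) := by
        refine columnSpan_le (fun l hl => ?_) fun c w => ?_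
        · show tau n δ l - l * gunit δ ht b b 1 ∈ level n δ ((t : ℤ) - 2)
          exact sub_mem (tau_mem_level hl) (mem_level_mul hl _)
        · show tau n δ (gunit δ ht c b w) - gunit δ ht c b w * gunit δ ht b b 1 ∈ level n δ ((t : ℤ) - 2)
          rw [tau_gunit, gunit_mul hδ, sub_self]
          exact zero_mem _
      exact h2 (mul_gunit_mem hδ ht hpar d a b w)
  exact key hy

theorem aeval_mul_sub_mem (hδ : δ ≠ 0) (ht : 0 < t) (hpar : t % 2 = n % 2) (f : K[X])
    (d : DAlg n δ) {y : DAlg n δ} (hy : y ∈ level n δ t) :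
    aeval (tau n δ) f (d * y) - d * aeval (tau n δ) f y ∈ level n δ ((t : ℤ) - 2) := by
  induction f using Polynomial.induction_on' with
  | add p q hp hq =>
    rw [map_add, LinearMap.add_apply, LinearMap.add_apply, mul_add, add_sub_add_comm]
    exact add_mem hp hq
  | monomial k c =>
    rw [aeval_monomial, Module.End.mul_apply, Module.End.mul_apply, Module.algebraMap_end_apply,
      Module.algebraMap_end_apply, mul_smul_comm, ← smul_sub]
    refine Submodule.smul_mem _ _ ?_
    -- The induction also records that `τ ^ k y` stays in `I_t`, where `tau_mul_sub_mem` applies.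
    have : (tau n δ ^ k) (d * y) - d * (tau n δ ^ k) y ∈ level n δ ((t : ℤ) - 2) ∧
        (tau n δ ^ k) y ∈ level n δ t := by
      induction k with
      | zero => exact ⟨by simp, hy⟩
      | succ k ih =>
        rw [pow_succ', Module.End.mul_apply, Module.End.mul_apply]
        refine ⟨?_, tau_mem_level ih.2⟩
        have h1 := tau_mem_level ih.1
        have h2 := tau_mul_sub_mem hδ ht hpar d ih.2
        rw [map_sub] at h1
        have := add_mem h1 h2
        rwa [sub_add_sub_cancel] at this
    exact this.1

end brackets

/-! ### The element `u ^ n` in the algebra and on the layers of the filtration. -/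

section rotation

variable {n : ℕ} [NeZero n] {K : Type*} [Field K] {δ : K} {t : ℕ}

theorem rot_eq : Diagram.rot n = turn n 1 := by
  ext1
  · rfl
  · rfl

theorem turn_mul (c : ℤ) (A : Diagram n) : of δ (turn n c) * of δ A = of δ ((turn n c).comp A) := by
  rw [of_mul_of, Diagram.loops, turn_loops, pow_zero, one_smul]

theorem rot_pow : of δ (Diagram.rot n) ^ n = of δ (turn n n) := by
  have : ∀ k : ℕ, of δ (Diagram.rot n) ^ k = of δ (turn n k) := by
    intro k
    induction k with
    | zero =>
      rw [pow_zero, one_def]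
      have := turn_zero_comp (Diagram.id n)
      rw [comp_id] at this
      rw [← this]; rfl
    | succ k ih =>
      rw [pow_succ, ih, rot_eq, turn_mul, turn_comp_turn]
      push_cast; rfl
  exact this n

theorem rot_pow_comm (x : DAlg n δ) :
    of δ (Diagram.rot n) ^ n * x = x * of δ (Diagram.rot n) ^ n := by
  rw [rot_pow]
  induction x using DAlg.ind with
  | zero => rw [zero_mul, mul_zero]
  | add x y hx hy => rw [mul_add, add_mul, hx, hy]
  | smul k A =>
    rw [mul_smul_comm, smul_mul_assoc, turn_mul, turn_comp_comm, of_mul_of, Diagram.loops,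
      loops_turn, pow_zero, one_smul]

theorem turn_comp_injective (c : ℤ) : Function.Injective (turn n c).comp := by
  intro A B h
  have := congrArg (turn n (-c)).comp h
  rwa [← comp_assoc, ← comp_assoc, turn_comp_turn, neg_add_cancel, turn_zero_comp,
    turn_zero_comp] at this

theorem turn_comp_through {D : Diagram n} (hD : 0 < D.through) :
    ((turn n n).comp D).through = D.through ∧
      ((turn n n).comp D).winding = D.winding + D.through := by
  obtain ⟨h1, h2, h3⟩ := exists_glue D hD
  rw [through_eq]
  generalize D.half 0 = a, D.half 1 = b, D.winding = w at *
  rw [h3, turn_comp_glue, glue_through, glue_winding, glue_half_one]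
  exact ⟨rfl, rfl⟩

/-- `u ^ n - q` is injective modulo `I_t`. -/
theorem mem_level_of_rot_sub {q : K} {x : DAlg n δ}
    (hx : (of δ (Diagram.rot n) ^ n - algebraMap K _ q) * x ∈ level n δ t) :
    x ∈ level n δ t := by
  have hP : ∀ D : Diagram n, ¬ (D.through : ℤ) ≤ t → 0 < D.through := fun D h => by omega
  rw [mem_level_iff] at hx ⊢
  intro D hD
  have h1 : of δ (Diagram.rot n) ^ n * x = extend δ (fun D => of δ ((turn n n).comp D)) x := by
    have : LinearMap.mulLeft K (of δ (Diagram.rot n) ^ n) =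
        extend δ (fun D => of δ ((turn n n).comp D)) := hom_ext fun A => by
      rw [LinearMap.mulLeft_apply, rot_pow, turn_mul, extend_of]
    exact congrArg (fun f => f x) this
  rw [sub_mul, h1, ← Algebra.smul_def] at hx
  refine coeff_eq_zero_of_free _ (turn_comp_injective n) (fun D => ¬ (D.through : ℤ) ≤ t)
    (fun D h => by rwa [(turn_comp_through (hP D h)).1]) (fun D h => ?_) hx hD
  -- Each factor `u ^ n` adds the number of vertical edges, which is positive here, to the winding
  -- number; so the iterates are distinct.
  have h2 : ∀ k : ℕ, ((turn n n).comp^[k] D).through = D.through ∧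
      ((turn n n).comp^[k] D).winding = D.winding + k * D.through := by
    intro k
    induction k with
    | zero => simp
    | succ k ih =>
      have h3 := turn_comp_through (D := (turn n n).comp^[k] D) (by rw [ih.1]; exact hP D h)
      rw [Function.iterate_succ_apply', h3.1, h3.2, ih.1, ih.2]
      exact ⟨rfl, by push_cast; ring⟩
  intro k l e
  have := congrArg Diagram.winding e
  simp only [(h2 _).2] at this
  have h0 : (D.through : ℤ) ≠ 0 := by have := hP D h; omega
  have h5 : (k : ℤ) = l := mul_right_cancel₀ h0 (by omega)
  exact_mod_cast h5

/-- `u ^ n` acts as `τ ^ t` on `I_t` modulo `I_{t-2}`. -/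
theorem rot_mul_sub_mem (hδ : δ ≠ 0) (ht : 0 < t) (hpar : t % 2 = n % 2) {y : DAlg n δ}
    (hy : y ∈ level n δ t) :
    of δ (Diagram.rot n) ^ n * y - (tau n δ ^ t) y ∈ level n δ ((t : ℤ) - 2) := by
  have key : level n δ t ≤ (level n δ ((t : ℤ) - 2)).comap
      (LinearMap.mulLeft K (of δ (Diagram.rot n) ^ n) - tau n δ ^ t) := by
    refine level_le_of hδ ht hpar (fun l hl => ?_) fun a b w => ?_
    · show of δ (Diagram.rot n) ^ n * l - (tau n δ ^ t) l ∈ level n δ ((t : ℤ) - 2)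
      refine sub_mem (mul_mem_level _ hl) ?_
      have := aeval_mem_level (X ^ t : K[X]) hl
      rwa [map_pow, aeval_X] at this
    · show of δ (Diagram.rot n) ^ n * gunit δ ht a b w - (tau n δ ^ t) (gunit δ ht a b w) ∈ level n δ ((t : ℤ) - 2)
      rw [tau_pow_gunit, gunit, mul_smul_comm, rot_pow, turn_mul, turn_comp_glue, gunit, b.2,
        sub_self]
      exact zero_mem _
  exact key hy

end rotation

open DAlg

/-! ### The left ideal behind `𝓘_M`. -/

section square

variable {n : ℕ} [NeZero n] {K : Type*} [Field K] {δ : K} {t : ℕ}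

variable (δ) in
/-- The element that acts as `τ - α` on the diagrams with bottom `b`. -/
noncomputable def nilp (ht : 0 < t) (α : K) (b : Level n t) : DAlg n δ :=
  gunit δ ht b b 1 - α • gunit δ ht b b 0

theorem gunit_mul_nilp (hδ : δ ≠ 0) (ht : 0 < t) (α : K) (a b : Level n t) (w : ℤ) :
    gunit δ ht a b w * nilp δ ht α b = gunit δ ht a b (w + 1) - α • gunit δ ht a b w := by
  rw [nilp, mul_sub, mul_smul_comm, gunit_mul hδ, gunit_mul hδ, add_zero]

/-- `nilp` is the scalar `X - α` in the picture of matrices over `K[X, X⁻¹]`, so it passes through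
matrix units from one index to the other. -/
theorem nilp_mul_gunit (hδ : δ ≠ 0) (ht : 0 < t) (α : K) (a b : Level n t) (w : ℤ) :
    nilp δ ht α a * gunit δ ht a b w = gunit δ ht a b w * nilp δ ht α b := by
  rw [gunit_mul_nilp hδ, nilp, sub_mul, smul_mul_assoc, gunit_mul hδ, gunit_mul hδ, zero_add,
    add_comm]

theorem gunit_zero_mul_nilp (hδ : δ ≠ 0) (ht : 0 < t) (α : K) (b : Level n t) :
    gunit δ ht b b 0 * nilp δ ht α b = nilp δ ht α b := by
  rw [gunit_mul_nilp hδ, zero_add, nilp]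

theorem tau_sub_gunit (hδ : δ ≠ 0) (ht : 0 < t) (α : K) (a b : Level n t) (w : ℤ) :
    (tau n δ - algebraMap K _ α) (gunit δ ht a b w) = gunit δ ht a b w * nilp δ ht α b := by
  rw [gunit_mul_nilp hδ, LinearMap.sub_apply, tau_gunit, Module.algebraMap_end_apply]

theorem tau_sub_sq_gunit (hδ : δ ≠ 0) (ht : 0 < t) (α : K) (a b : Level n t) (w : ℤ) :
    ((tau n δ - algebraMap K _ α) ^ 2 : Module.End K (DAlg n δ)) (gunit δ ht a b w) =
      gunit δ ht a b w * (nilp δ ht α b * nilp δ ht α b) := by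
  rw [pow_two, Module.End.mul_apply, tau_sub_gunit hδ, gunit_mul_nilp hδ, map_sub, map_smul,
    tau_sub_gunit hδ, tau_sub_gunit hδ, ← mul_assoc]
  simp only [gunit_mul_nilp hδ, sub_mul, smul_mul_assoc]

theorem tau_sub_mem_level {s : ℤ} (α : K) {x : DAlg n δ} (hx : x ∈ level n δ s) :
    (tau n δ - algebraMap K _ α) x ∈ level n δ s := by
  rw [LinearMap.sub_apply, Module.algebraMap_end_apply]
  exact sub_mem (tau_mem_level hx) (Submodule.smul_mem _ _ hx)

theorem level_le_squareIdeal (α : K) {x : DAlg n δ} (hx : x ∈ level n δ ((t : ℤ) - 2)) :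
    x ∈ squareIdeal n δ t α := Submodule.mem_sup_left hx

theorem nilp_sq_mem_squareIdeal (hδ : δ ≠ 0) (ht : 0 < t) (α : K) (b : Level n t) :
    nilp δ ht α b * nilp δ ht α b ∈ squareIdeal n δ t α := by
  refine Submodule.mem_sup_right (Ideal.subset_span ⟨gunit δ ht b b 0, gunit_mem_level ht b b 0, ?_⟩)
  rw [tau_sub_sq_gunit hδ, ← mul_assoc, gunit_zero_mul_nilp hδ]

/-- On the column `b` the map `(τ - α)²` is right multiplication by the square of `nilp b`. So
`I_{t-2}` and these squares generate the whole ideal. -/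
theorem squareIdeal_le (hδ : δ ≠ 0) (ht : 0 < t) (hpar : t % 2 = n % 2) (α : K)
    {J : Ideal (DAlg n δ)} (h1 : ∀ x ∈ level n δ ((t : ℤ) - 2), x ∈ J)
    (h2 : ∀ b, nilp δ ht α b * nilp δ ht α b ∈ J) : squareIdeal n δ t α ≤ J := by
  refine sup_le h1 (Ideal.span_le.2 ?_)
  rintro _ ⟨y, hy, rfl⟩
  have key : level n δ t ≤ (J.restrictScalars K).comap
      ((tau n δ - algebraMap K _ α) ^ 2 : Module.End K (DAlg n δ)) := by
    refine level_le_of hδ ht hpar (fun l hl => ?_) fun a b w => ?_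
    · refine h1 _ ?_
      rw [pow_two, Module.End.mul_apply]
      exact tau_sub_mem_level α (tau_sub_mem_level α hl)
    · rw [Submodule.mem_comap, tau_sub_sq_gunit hδ]
      exact J.mul_mem_left _ (h2 b)
  exact key hy

end square

/-! ### Division by `τ - α` within a single column. -/

section projection

variable {n : ℕ} [NeZero n] {K : Type*} [Field K] {δ : K} {t : ℕ}

open Classical in
/-- The projection onto the span of the diagrams with bottom `b`. -/
noncomputable def proj (b : Level n t) : DAlg n δ →ₗ[K] DAlg n δ :=
  extend δ fun D => if D.half 1 = b.1 then of δ D else 0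

theorem proj_of_mem_level {b : Level n t} {x : DAlg n δ} (hx : x ∈ level n δ ((t : ℤ) - 2)) :
    proj b x = 0 := by
  have : level n δ ((t : ℤ) - 2) ≤ LinearMap.ker (proj (δ := δ) b) := level_le fun D hD => by
    rw [LinearMap.mem_ker, proj, extend_of, if_neg]
    intro h
    rw [through_eq, h, b.2] at hD
    omega
  exact this hx

open Classical in
theorem proj_gunit (ht : 0 < t) (a b c : Level n t) (w : ℤ) :
    proj b (gunit δ ht a c w) = if c = b then gunit δ ht a c w else 0 := by
  rw [gunit, map_smul, proj, extend_of, glue_half_one]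
  by_cases h : c = b
  · rw [if_pos h, if_pos (by rw [h])]
  · rw [if_neg h, if_neg (fun h' => h (Subtype.ext h')), smul_zero]

theorem sub_proj_mem (ht : 0 < t) {b : Level n t} {x : DAlg n δ} (hx : x ∈ columnSpan δ ht b) :
    x - proj b x ∈ level n δ ((t : ℤ) - 2) := by
  have : columnSpan δ ht b ≤
      (level n δ ((t : ℤ) - 2)).comap (LinearMap.id - proj (δ := δ) b) := by
    refine columnSpan_le (fun l hl => ?_) fun c w => ?_
    · show l - proj b l ∈ level n δ ((t : ℤ) - 2)
      rw [proj_of_mem_level hl, sub_zero]; exact hl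
    · show gunit δ ht c b w - proj b (gunit δ ht c b w) ∈ level n δ ((t : ℤ) - 2)
      rw [proj_gunit, if_pos rfl, sub_self]; exact zero_mem _
  exact this hx

theorem proj_tau_sub (hδ : δ ≠ 0) (ht : 0 < t) (hpar : t % 2 = n % 2) (α : K) (b : Level n t)
    {y : DAlg n δ} (hy : y ∈ level n δ t) :
    proj b ((tau n δ - algebraMap K _ α) y) = proj b y * nilp δ ht α b := by
  have : level n δ t ≤ LinearMap.ker (proj (δ := δ) b ∘ₗ (tau n δ - algebraMap K _ α) -
      LinearMap.mulRight K (nilp δ ht α b) ∘ₗ proj b) := by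
    refine level_le_of hδ ht hpar (fun l hl => ?_) fun a c w => ?_
    · rw [LinearMap.mem_ker]
      show proj b ((tau n δ - algebraMap K _ α) l) - proj b l * nilp δ ht α b = 0
      rw [proj_of_mem_level hl, proj_of_mem_level (tau_sub_mem_level α hl), zero_mul, sub_zero]
    · rw [LinearMap.mem_ker]
      show proj b ((tau n δ - algebraMap K _ α) (gunit δ ht a c w)) -
        proj b (gunit δ ht a c w) * nilp δ ht α b = 0
      rw [tau_sub_gunit hδ, gunit_mul_nilp hδ, map_sub, map_smul, proj_gunit, proj_gunit]
      by_cases h : c = b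
      · subst h
        rw [if_pos rfl, if_pos rfl, gunit_mul_nilp hδ, sub_self]
      · rw [if_neg h, if_neg h, smul_zero, zero_mul, sub_zero, sub_zero]
  exact sub_eq_zero.1 (this hy)

/-- The solution `y` may involve all columns. Its projection to the column of `x` is still a
solution, and there `τ - α` is right multiplication by `nilp b`. -/
theorem exists_mul_nilp (hδ : δ ≠ 0) (ht : 0 < t) (hpar : t % 2 = n % 2) (α : K) {b : Level n t}
    {x y : DAlg n δ} (hx : x ∈ columnSpan δ ht b) (hy : y ∈ level n δ t)
    (h : x - (tau n δ - algebraMap K _ α) y ∈ level n δ ((t : ℤ) - 2)) :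
    ∃ d, x - d * nilp δ ht α b ∈ level n δ ((t : ℤ) - 2) := by
  refine ⟨proj b y, ?_⟩
  have h1 := proj_of_mem_level (b := b) h
  rw [map_sub, proj_tau_sub hδ ht hpar α b hy, sub_eq_zero] at h1
  rw [← h1]
  exact sub_proj_mem ht hx

theorem mem_level_of_aeval_prod (ht : 0 < t) (hpar : t % 2 = n % 2) {ι : Type*} (s : Finset ι)
    (r : ι → K) {y : DAlg n δ}
    (hy : aeval (tau n δ) (∏ i ∈ s, (X - C (r i))) y ∈ level n δ ((t : ℤ) - 2)) :
    y ∈ level n δ ((t : ℤ) - 2) := by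
  classical
  induction s using Finset.induction_on with
  | empty => simpa using hy
  | insert i s hi ih =>
    rw [Finset.prod_insert hi, map_mul, Module.End.mul_apply, map_sub, aeval_X, aeval_C,
      LinearMap.sub_apply, Module.algebraMap_end_apply] at hy
    exact ih (mem_level_of_tau_sub ht hpar hy)

end projection

/-! ### Cell ideals of `D_n(q)` and the relations of a standard module. -/

section cells

variable {n : ℕ} [NeZero n] {K : Type*} [Field K] {δ : K} {t : ℕ}

theorem polyBracket_eq (hδ : δ ≠ 0) (ht : 0 < t) (a b : Level n t) (f : K[X]) :
    polyBracket δ f a.1.perm b.1.perm =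
      δ ^ b.1.loopNumber • aeval (tau n δ) f (gunit δ ht a b 0) := by
  rw [polyBracket, aeval_def, eval₂_eq_sum, Polynomial.sum, Polynomial.sum, LinearMap.sum_apply,
    Finset.smul_sum]
  refine Finset.sum_congr rfl fun k _ => ?_
  rw [Module.End.mul_apply, Module.algebraMap_end_apply, tau_pow_gunit, smul_comm, zero_add,
    ← of_glue hδ, bracket_eq]

theorem level_zero_le (ht : 0 < t) (hpar : t % 2 = n % 2) :
    level n δ 0 ≤ level n δ ((t : ℤ) - 2) :=
  level_le fun D hD => of_mem_level (through_le_of_lt hpar (by omega))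

/-- As `c = u ^ n - q` is central, the elements `c * x + l` with `l` in `I_0` already form a
two-sided ideal. -/
theorem exists_of_mem_omegaIdeal {q : K} {d : DAlg n δ} (hd : d ∈ omegaIdeal n δ q) :
    ∃ x, d - (of δ (Diagram.rot n) ^ n - algebraMap K _ q) * x ∈ level n δ 0 := by
  set c := of δ (Diagram.rot n) ^ n - algebraMap K _ q with hc
  have hcomm : ∀ x, c * x = x * c := fun x => by
    rw [hc, sub_mul, mul_sub, rot_pow_comm, Algebra.commutes]
  let J : TwoSidedIdeal (DAlg n δ) := TwoSidedIdeal.mk' {d | ∃ x, d - c * x ∈ level n δ 0}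
    ⟨0, by rw [mul_zero, sub_zero]; exact zero_mem _⟩
    (by
      rintro a b ⟨x, hx⟩ ⟨y, hy⟩
      refine ⟨x + y, ?_⟩
      rw [mul_add, add_sub_add_comm]
      exact add_mem hx hy)
    (by
      rintro a ⟨x, hx⟩
      refine ⟨-x, ?_⟩
      rw [mul_neg, ← neg_sub', ]
      exact neg_mem hx)
    (by
      rintro a b ⟨x, hx⟩
      refine ⟨a * x, ?_⟩
      rw [← mul_assoc, hcomm, mul_assoc, ← mul_sub]
      exact mul_mem_level a hx)
    (by
      rintro a b ⟨x, hx⟩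
      refine ⟨x * b, ?_⟩
      rw [← mul_assoc, ← sub_mul]
      exact mem_level_mul hx b)
  have hle : omegaIdeal n δ q ≤ J := by
    refine TwoSidedIdeal.span_le.2 ?_
    rintro x (rfl | hx)
    · refine (TwoSidedIdeal.mem_mk' _ _ _ _ _ _ _).2 ⟨1, ?_⟩
      rw [mul_one, sub_self]; exact zero_mem _
    · refine (TwoSidedIdeal.mem_mk' _ _ _ _ _ _ _).2 ⟨0, ?_⟩
      rw [mul_zero, sub_zero]; exact hx
  exact (TwoSidedIdeal.mem_mk' _ _ _ _ _ _ d).1 (hle hd)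

theorem toDQuot_eq_zero_iff {q : K} {d : DAlg n δ} :
    toDQuot n δ q d = 0 ↔ d ∈ omegaIdeal n δ q := by
  rw [toDQuot, Ideal.Quotient.eq_zero_iff_mem, TwoSidedIdeal.mem_asIdeal]

theorem toDQuot_surjective (q : K) : Function.Surjective (toDQuot n δ q) :=
  Ideal.Quotient.mk_surjective

/-- For `i < j` the product `f_i` contains `X - r_j` and all factors of `f_j`. So the cells below
`(t, j)` lie in the image of `(τ - r_j) f_j(τ)`. -/
theorem cellPoly_dvd (r : Fin t → K) {j i : Fin t} (hij : i < j) :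
    (X - C (r j)) * cellPoly r j ∣ cellPoly r i := by
  classical
  rw [cellPoly, cellPoly, ← Finset.prod_insert (f := fun i => (X - C (r i) : K[X])) (by simp)]
  refine Finset.prod_dvd_prod_of_subset _ _ _ fun k hk => ?_
  rw [Finset.mem_insert, Finset.mem_filter] at hk
  rw [Finset.mem_filter]
  refine ⟨Finset.mem_univ _, ?_⟩
  rcases hk with rfl | hk
  · exact hij
  · exact hij.trans hk.2

/-- The elements of the cell ideal below a weight, lifted to `D_n`. -/
theorem exists_of_mem_cellIdealBelow (hδ : δ ≠ 0) (ht : 0 < t) (hpar : t % 2 = n % 2) {q : K}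
    (r : Fin t → K) (j : Fin t) {d : DAlg n δ}
    (hd : toDQuot n δ q d ∈ cellIdealBelow n δ q r j) :
    ∃ x, ∃ y ∈ level n δ t, d - (of δ (Diagram.rot n) ^ n - algebraMap K _ q) * x -
      aeval (tau n δ) ((X - C (r j)) * cellPoly r j) y ∈ level n δ ((t : ℤ) - 2) := by
  set c := of δ (Diagram.rot n) ^ n - algebraMap K _ q with hc
  set F := (X - C (r j)) * cellPoly r j with hF
  have hcomm : ∀ x, c * x = x * c := fun x => by
    rw [hc, sub_mul, mul_sub, rot_pow_comm, Algebra.commutes]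
  clear_value c
  -- `W` is a left ideal because `c` is central and `F(τ)` commutes with left multiplications modulo
  -- `I_{t-2}`.
  let W : Ideal (DAlg n δ) :=
    { carrier := {d | ∃ x, ∃ y ∈ level n δ t,
        d - c * x - aeval (tau n δ) F y ∈ level n δ ((t : ℤ) - 2)}
      zero_mem' := ⟨0, 0, zero_mem _, by simp⟩
      add_mem' := by
        rintro a b ⟨x, y, hy, h⟩ ⟨x', y', hy', h'⟩
        refine ⟨x + x', y + y', add_mem hy hy', ?_⟩
        rw [mul_add, map_add]
        convert add_mem h h' using 1
        abel
      smul_mem' := by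
        rintro e a ⟨x, y, hy, h⟩
        refine ⟨e * x, e * y, mul_mem_level e hy, ?_⟩
        have h1 := sub_mem (mul_mem_level e h) (aeval_mul_sub_mem hδ ht hpar F e hy)
        convert h1 using 1
        rw [smul_eq_mul, ← mul_assoc c, hcomm e, mul_sub, mul_sub, mul_assoc]
        abel }
  have hlevel : ∀ l ∈ level n δ ((t : ℤ) - 2), l ∈ W := fun l hl => ⟨0, 0, zero_mem _, by simpa using hl⟩
  have homega : ∀ l ∈ omegaIdeal n δ q, l ∈ W := by
    intro l hl
    obtain ⟨x, hx⟩ := exists_of_mem_omegaIdeal hl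
    rw [← hc] at hx
    exact ⟨x, 0, zero_mem _, by rw [map_zero, sub_zero]; exact level_zero_le ht hpar hx⟩
  have hle : cellIdealBelow n δ q r j ≤ W.map (toDQuot n δ q) := by
    refine Ideal.span_le.2 ?_
    rintro _ (⟨l, hl, rfl⟩ | ⟨i, S₁, S₂, hij, hS₁, hS₂, rfl⟩)
    · exact Ideal.mem_map_of_mem _ (hlevel l hl)
    · obtain ⟨a, rfl, ha⟩ := exists_half ht hS₁
      obtain ⟨b, hb, hb'⟩ := exists_half ht hS₂.reverse
      rw [cellElement, ← hb]
      refine Ideal.mem_map_of_mem _ ?_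
      rw [polyBracket_eq hδ ht ⟨a, ha⟩ ⟨b, hb'⟩]
      obtain ⟨G, hG⟩ := cellPoly_dvd r hij
      refine ⟨0, δ ^ b.loopNumber • aeval (tau n δ) G (gunit δ ht ⟨a, ha⟩ ⟨b, hb'⟩ 0),
        Submodule.smul_mem _ _ (aeval_mem_level _ (gunit_mem_level ht _ _ _)), ?_⟩
      rw [mul_zero, sub_zero, map_smul, hG, map_mul, Module.End.mul_apply, sub_self]
      exact zero_mem _
  -- `d` has the same image as some `w` in `W`, and the difference lies in `omegaIdeal`, which is
  -- part of `W`.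
  obtain ⟨w, hw, hwd⟩ := (Ideal.mem_map_iff_of_surjective _ (toDQuot_surjective q)).1 (hle hd)
  have h1 : d - w ∈ omegaIdeal n δ q := by
    rw [← toDQuot_eq_zero_iff, map_sub, hwd, sub_self]
  have h2 : d ∈ W := by
    have := W.add_mem (homega _ h1) hw
    rwa [sub_add_cancel] at this
  exact h2

/-- The relations of the generator of a standard module. -/
theorem exists_of_mul_polyBracket_mem (hδ : δ ≠ 0) (ht : 0 < t) (hpar : t % 2 = n % 2) {q : K}
    (r : Fin t → K) (j : Fin t) (hr : (X ^ t - C q : K[X]) = ∏ i, (X - C (r i)))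
    (b : Level n t) {d : DAlg n δ}
    (hd : toDQuot n δ q (d * polyBracket δ (cellPoly r j) b.1.perm b.1.perm) ∈
      cellIdealBelow n δ q r j) :
    ∃ d', d * gunit δ ht b b 0 - d' * nilp δ ht (r j) b ∈ level n δ ((t : ℤ) - 2) := by
  obtain ⟨x, y, hy, h⟩ := exists_of_mem_cellIdealBelow hδ ht hpar r j hd
  set u := of δ (Diagram.rot n) ^ n with hu
  set F := cellPoly r j with hF
  set c := δ ^ b.1.loopNumber with hc
  have hc0 : c ≠ 0 := pow_ne_zero _ hδ
  set e := gunit δ ht b b 0 with he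
  have hel : e ∈ level n δ t := gunit_mem_level ht b b 0
  have hle : level n δ ((t : ℤ) - 2) ≤ level n δ t := level_mono (by omega)
  rw [polyBracket_eq hδ ht b b, ← hc, ← he] at h
  have h1 := aeval_mul_sub_mem hδ ht hpar F d hel
  -- All other terms of the relation lie in `I_t`, and `u ^ n - q` is injective modulo `I_t`.
  have hx : x ∈ level n δ t := by
    refine mem_level_of_rot_sub (q := q) ?_
    have h2 : d * c • aeval (tau n δ) F e ∈ level n δ t :=
      mul_mem_level _ (Submodule.smul_mem _ _ (aeval_mem_level _ hel))
    have h3 := aeval_mem_level ((X - C (r j)) * F) hy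
    have h4 := sub_mem (sub_mem h2 h3) (hle h)
    convert h4 using 1
    rw [Algebra.smul_def, sub_mul]
    abel
  -- Now `u ^ n - q` acts on `x` as `τ ^ t - q`, a multiple of `(τ - r_j) F(τ)`; its contribution is
  -- absorbed into `y'`.
  obtain ⟨G, hG⟩ : ∃ G : K[X], X ^ t - C q = ((X - C (r j)) * F) * G := by
    classical
    rw [hr, hF, cellPoly, ← Finset.prod_insert (f := fun i => (X - C (r i) : K[X])) (by simp)]
    exact Finset.prod_dvd_prod_of_subset _ _ _ (Finset.subset_univ _)
  have h2 := rot_mul_sub_mem hδ ht hpar hx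
  rw [← hu] at h2
  have h3 : (tau n δ ^ t) x - q • x =
      aeval (tau n δ) ((X - C (r j)) * F) (aeval (tau n δ) G x) := by
    rw [← Module.End.mul_apply, ← map_mul, ← hG, map_sub, map_pow, aeval_X, aeval_C,
      LinearMap.sub_apply, Module.algebraMap_end_apply]
  set y' := aeval (tau n δ) G x + y with hy'
  have hy'l : y' ∈ level n δ t := add_mem (aeval_mem_level G hx) hy
  have h4 : aeval (tau n δ) F (d * (c • e) - (tau n δ - algebraMap K _ (r j)) y') ∈
      level n δ ((t : ℤ) - 2) := by
    have h5 := add_mem (add_mem (Submodule.smul_mem _ c h1) h) h2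
    convert h5 using 1
    have e1 : (tau n δ - algebraMap K _ (r j)) = aeval (tau n δ) (X - C (r j)) := by
      rw [map_sub, aeval_X, aeval_C]
    have e2 : (u - algebraMap K _ q) * x = u * x - q • x := by rw [sub_mul, ← Algebra.smul_def]
    rw [map_sub, e1, ← Module.End.mul_apply, ← map_mul, mul_comm F, hy', map_add, ← h3, e2,
      mul_smul_comm, mul_smul_comm, map_smul, smul_sub]
    abel
  -- The whole relation stands under `F(τ)`, a product of maps injective modulo `I_{t-2}`, so `F(τ)`
  -- is cancelled.
  have h5 := mem_level_of_aeval_prod ht hpar _ r h4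
  obtain ⟨d', hd'⟩ := exists_mul_nilp hδ ht hpar (r j) (b := b) (by
    rw [mul_smul_comm]
    exact Submodule.smul_mem _ _ (mul_gunit_mem hδ ht hpar d b b 0)) hy'l h5
  refine ⟨c⁻¹ • d', ?_⟩
  have := Submodule.smul_mem _ c⁻¹ hd'
  rwa [mul_smul_comm, smul_sub, smul_smul, inv_mul_cancel₀ hc0, one_smul, ← smul_mul_assoc] at this

theorem level_mem_cellIdealBelow {q : K} (r : Fin t → K) (j : Fin t)
    {l : DAlg n δ} (hl : l ∈ level n δ ((t : ℤ) - 2)) :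
    toDQuot n δ q l ∈ cellIdealBelow n δ q r j := Ideal.subset_span (Or.inl ⟨l, hl, rfl⟩)

/-- `τ - r_j` maps the generator of the standard module into the cell ideal below. -/
theorem aeval_gunit_mem_cellIdealBelow (hδ : δ ≠ 0) (ht : 0 < t) (hpar : t % 2 = n % 2) {q : K}
    (r : Fin t → K) (j : Fin t) (hr : (X ^ t - C q : K[X]) = ∏ i, (X - C (r i)))
    (b : Level n t) (hb : IsAnnular t b.1.perm) :
    toDQuot n δ q (aeval (tau n δ) ((X - C (r j)) * cellPoly r j) (gunit δ ht b b 0)) ∈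
      cellIdealBelow n δ q r j := by
  classical
  have hins : (X - C (r j)) * cellPoly r j =
      ∏ i ∈ insert j (Finset.univ.filter fun i => j < i), (X - C (r i)) := by
    rw [cellPoly, Finset.prod_insert (by simp)]
  -- For the first index `(X - r_j) f_j` is `X ^ t - q`, which gives the relation `u ^ n = q`; for
  -- any other index it is the polynomial of the preceding cell.
  by_cases h0 : (j : ℕ) = 0
  · have : insert j (Finset.univ.filter fun i => j < i) = Finset.univ := by
      ext i
      simp only [Finset.mem_insert, Finset.mem_filter, Finset.mem_univ, true_and, iff_true]
      rw [Fin.lt_def, Fin.ext_iff]; omega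
    rw [hins, this, ← hr, map_sub, map_pow, aeval_X, aeval_C, LinearMap.sub_apply,
      Module.algebraMap_end_apply]
    have h1 := rot_mul_sub_mem hδ ht hpar (gunit_mem_level (δ := δ) ht b b 0)
    have h2 : of δ (Diagram.rot n) ^ n - algebraMap K _ q ∈ omegaIdeal n δ q :=
      TwoSidedIdeal.subset_span (Or.inl rfl)
    have h3 := (omegaIdeal n δ q).mul_mem_right _ (gunit δ ht b b 0) h2
    rw [← toDQuot_eq_zero_iff, sub_mul, ← Algebra.smul_def] at h3
    have h4 := level_mem_cellIdealBelow (q := q) r j h1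
    have h5 := sub_mem (zero_mem (cellIdealBelow n δ q r j)) h4
    rw [← h3, ← map_sub] at h5
    convert h5 using 2
    abel
  · have hlt : (j : ℕ) - 1 < t := by omega
    set i : Fin t := ⟨(j : ℕ) - 1, hlt⟩ with hi
    have hset : insert j (Finset.univ.filter fun i => j < i) =
        Finset.univ.filter fun k => i < k := by
      ext k
      simp only [Finset.mem_insert, Finset.mem_filter, Finset.mem_univ, true_and]
      rw [Fin.lt_def, Fin.lt_def, Fin.ext_iff, hi]; simp only; omega
    rw [hins, hset]
    have h1 : cellElement δ q r i b.1.perm (reverse b.1.perm) ∈ cellIdealBelow n δ q r j :=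
      Ideal.subset_span (Or.inr ⟨i, _, _, by rw [Fin.lt_def, hi]; simp only; omega, hb,
        hb.reverse, rfl⟩)
    rw [cellElement, reverse_reverse, polyBracket_eq hδ ht b b] at h1
    have h2 := (cellIdealBelow n δ q r j).mul_mem_left
      (toDQuot n δ q (algebraMap K _ (δ ^ b.1.loopNumber)⁻¹)) h1
    rwa [← map_mul, ← Algebra.smul_def, smul_smul, inv_mul_cancel₀ (pow_ne_zero _ hδ),
      one_smul] at h2

/-- `nilp b` annihilates the standard module. -/
theorem nilp_mul_mem_cellIdealBelow (hδ : δ ≠ 0) (ht : 0 < t) (hpar : t % 2 = n % 2) {q : K}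
    (r : Fin t → K) (j : Fin t) (hr : (X ^ t - C q : K[X]) = ∏ i, (X - C (r i)))
    (a b : Level n t) (hb : IsAnnular t b.1.perm) (d : DAlg n δ) :
    toDQuot n δ q (nilp δ ht (r j) a *
      (d * polyBracket δ (cellPoly r j) b.1.perm b.1.perm)) ∈ cellIdealBelow n δ q r j := by
  set F := cellPoly r j with hF
  set c := δ ^ b.1.loopNumber with hc
  set e := gunit δ ht b b 0 with he
  have hel : e ∈ level n δ t := gunit_mem_level ht b b 0
  -- Modulo `I_{t-2}` the element `v` has top `a` and bottom `b`, and there left multiplication by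
  -- `nilp a` agrees with `τ - r_j`.
  set v := gunit δ ht a a 0 * (d * e) with hv
  have hve : v * e = v := by
    rw [hv, mul_assoc, mul_assoc, he, gunit_mul hδ, zero_add]
  have h1 : nilp δ ht (r j) a * (d * e) - (tau n δ - algebraMap K _ (r j)) v ∈
      level n δ ((t : ℤ) - 2) := by
    have h2 : cellSpan δ ht a b ≤ (level n δ ((t : ℤ) - 2)).comap
        (LinearMap.mulLeft K (nilp δ ht (r j) a) - (tau n δ - algebraMap K _ (r j))) := by
      refine cellSpan_le (fun l hl => ?_) fun w => ?_
      · exact Submodule.sub_mem (level n δ ((t : ℤ) - 2)) (mul_mem_level _ hl)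
          (tau_sub_mem_level (r j) hl)
      · show nilp δ ht (r j) a * gunit δ ht a b w -
          (tau n δ - algebraMap K _ (r j)) (gunit δ ht a b w) ∈ level n δ ((t : ℤ) - 2)
        rw [tau_sub_gunit hδ, nilp_mul_gunit hδ, sub_self]
        exact zero_mem _
    have h3 : nilp δ ht (r j) a * v - (tau n δ - algebraMap K _ (r j)) v ∈
        level n δ ((t : ℤ) - 2) := h2 (gunit_mul_mul_mem hδ ht hpar a a b b 0 0 d)
    have h4 : nilp δ ht (r j) a * v = nilp δ ht (r j) a * (d * e) := by
      rw [hv, ← mul_assoc, nilp_mul_gunit hδ, gunit_zero_mul_nilp hδ]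
    rwa [h4] at h3
  have h2 := aeval_mul_sub_mem hδ ht hpar F (nilp δ ht (r j) a * d) hel
  have h3 := aeval_mem_level F h1
  -- Because `v * e = v`, applying `(τ - r_j) F(τ)` to `v` amounts to multiplying `(τ - r_j) F(τ)
  -- e`, an element of the ideal below, by `v` from the left.
  have h4 := aeval_mul_sub_mem hδ ht hpar ((X - C (r j)) * F) v hel
  have h5 : aeval (tau n δ) ((X - C (r j)) * F) v =
      aeval (tau n δ) F ((tau n δ - algebraMap K _ (r j)) v) := by
    have e1 : (tau n δ - algebraMap K _ (r j)) = aeval (tau n δ) (X - C (r j)) := by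
      rw [map_sub, aeval_X, aeval_C]
    rw [e1, mul_comm (X - C (r j)) F, map_mul (aeval (tau n δ)), Module.End.mul_apply]
  rw [hve, h5] at h4
  have h6 := (cellIdealBelow n δ q r j).mul_mem_left (toDQuot n δ q v)
    (aeval_gunit_mem_cellIdealBelow hδ ht hpar r j hr b hb)
  rw [← map_mul] at h6
  have h7 := level_mem_cellIdealBelow (q := q) r j (add_mem (sub_mem h3 h2) h4)
  have h8 := (cellIdealBelow n δ q r j).mul_mem_left (toDQuot n δ q (algebraMap K _ c))
    (add_mem h7 h6)
  rw [← map_add, ← map_mul, ← Algebra.smul_def] at h8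
  convert h8 using 2
  rw [polyBracket_eq hδ ht b b, mul_smul_comm, mul_smul_comm, map_sub, mul_assoc]
  congr 1
  rw [mul_assoc]
  abel

end cells

/-! ### Indecomposable self-extensions of a simple module over any ring. -/

section selfExtension

variable {R M N : Type*} [Ring R] [AddCommGroup M] [Module R M] [AddCommGroup N] [Module R N]

theorem exists_smul_eq (hM : IsSimpleModule R M) {z : M} (hz : z ≠ 0) (m : M) : ∃ d : R, d • z = m := by
  have h : Submodule.span R {z} = ⊤ :=
    (eq_bot_or_eq_top _).resolve_left fun h => hz (Submodule.span_singleton_eq_bot.1 h)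
  exact Submodule.mem_span_singleton.1 (h ▸ Submodule.mem_top (x := m))

/-- The kernel of an indecomposable self-extension has no complement. -/
theorem not_isCompl_range (hM : IsSimpleModule R M) {f : M →ₗ[R] N} {g : N →ₗ[R] M}
    (hf : Function.Injective f) (hfg : Function.Exact f g)
    (hN : IsIndecomposable R N) {Q : Submodule R N} (h0 : ∀ y ∈ Q, g y = 0 → y = 0)
    (h1 : ∀ m, ∃ y ∈ Q, g y = m) : False := by
  have := IsSimpleModule.nontrivial R M
  obtain ⟨m, hm⟩ := exists_ne (0 : M)
  have hc : IsCompl (LinearMap.range f) Q := by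
    constructor
    · rw [Submodule.disjoint_def]
      intro y hy hyQ
      exact h0 y hyQ ((hfg y).2 hy)
    · rw [codisjoint_iff, eq_top_iff]
      intro y _
      obtain ⟨y', hy', h⟩ := h1 (g y)
      rw [← sub_add_cancel y y']
      refine Submodule.add_mem_sup ((hfg _).1 ?_) hy'
      rw [map_sub, h, sub_self]
  rcases hN.2 _ _ hc with h | h
  · have : f m ∈ LinearMap.range f := ⟨m, rfl⟩
    rw [h, Submodule.mem_bot] at this
    exact hm (hf (this.trans (map_zero f).symm))
  · obtain ⟨y, hy, h2⟩ := h1 m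
    rw [h, Submodule.mem_bot] at hy
    rw [hy, map_zero] at h2
    exact hm h2.symm

/-- The structure of an indecomposable self-extension of a simple module `M` with an element `z`
whose annihilator is generated, up to elements annihilating the extension, by an element `x` that
annihilates `M`. -/
theorem exists_generator (hM : IsSimpleModule R M) {f : M →ₗ[R] N} {g : N →ₗ[R] M}
    (hf : Function.Injective f) (hfg : Function.Exact f g) (hg : Function.Surjective g)
    (hN : IsIndecomposable R N) {e x : R} (hee : e * e = e) (hex : e * x = x)
    {I : Ideal R} (hI : ∀ l ∈ I, ∀ y : N, l • y = 0) (hIx : ∀ l ∈ I, l * x ∈ I)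
    (hx : ∀ m : M, x • m = 0) {z : M} (hz : z ≠ 0) (hez : e • z = z)
    (hann : ∀ d : R, d • z = 0 → ∃ d', d * e - d' * x ∈ I) :
    ∃ y : N, e • y = y ∧ (∀ y', ∃ d : R, d • y = y') ∧
      ∀ d : R, d • y = 0 → ∃ d', d * e - d' * (x * x) ∈ I := by
  obtain ⟨y₀, hy₀⟩ := hg z
  set y := e • y₀ with hy
  have hey : e • y = y := by rw [hy, smul_smul, hee]
  have hgy : g y = z := by rw [hy, map_smul, hy₀, hez]
  have hIM : ∀ l ∈ I, ∀ m : M, l • m = 0 := fun l hl m => hf (by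
    rw [map_smul, hI l hl, map_zero])
  obtain ⟨m', hm'⟩ : ∃ m', f m' = x • y := (hfg _).1 (by rw [map_smul, hx])
  have hem : e • m' = m' := hf (by rw [map_smul, hm', smul_smul, hex])
  have hd : ∀ d d' : R, d * e - d' * x ∈ I → d • y = d' • f m' := by
    intro d d' h
    have h1 := hI _ h y
    rwa [sub_smul, mul_smul, mul_smul, hey, ← hm', sub_eq_zero] at h1
  have hzm : ∀ d : R, d • z = 0 → d • m' = 0 := by
    intro d h
    obtain ⟨d', hd'⟩ := hann d h
    have h1 := hIM _ hd' m'
    rwa [sub_smul, mul_smul, mul_smul, hem, hx, smul_zero, sub_zero] at h1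
  -- If `x • y = 0`, then `y` satisfies the relations of `z`, so its span maps isomorphically onto
  -- `M` and splits the extension.
  by_cases hm0 : m' = 0
  · refine (not_isCompl_range hM hf hfg hN (Q := Submodule.span R {y}) ?_ ?_).elim
    · intro w hw hgw
      obtain ⟨d, rfl⟩ := Submodule.mem_span_singleton.1 hw
      rw [map_smul, hgy] at hgw
      obtain ⟨d', hd'⟩ := hann d hgw
      rw [hd _ _ hd', hm0, map_zero, smul_zero]
    · intro m
      obtain ⟨d, rfl⟩ := exists_smul_eq hM hz m
      exact ⟨d • y, Submodule.smul_mem _ _ (Submodule.mem_span_singleton_self y), by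
        rw [map_smul, hgy]⟩
  have hmz : ∀ d : R, d • m' = 0 → d • z = 0 := by
    intro d h
    -- If `a d z = z`, then `a d - 1` kills `z`, hence `m'`; together with `d m' = 0` this gives `m'
    -- = 0`.
    by_contra hne
    obtain ⟨a, ha⟩ := exists_smul_eq hM hne z
    have h2 := hzm (a * d - 1) (by rw [sub_smul, mul_smul, ha, one_smul, sub_self])
    rw [sub_smul, mul_smul, h, smul_zero, one_smul, zero_sub, neg_eq_zero] at h2
    exact hm0 h2
  refine ⟨y, hey, fun y' => ?_, fun d h => ?_⟩
  -- The element `y` generates `N` modulo the image of `f`, and this image is generated by `f m' = x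
  -- • y`.
  · obtain ⟨d, hdz⟩ := exists_smul_eq hM hz (g y')
    obtain ⟨m, hm⟩ : ∃ m, f m = y' - d • y := (hfg _).1 (by
      rw [map_sub, map_smul, hgy, hdz, sub_self])
    obtain ⟨c, hc⟩ := exists_smul_eq hM hm0 m
    refine ⟨c * x + d, ?_⟩
    rw [add_smul, mul_smul, ← hm', ← map_smul, hc, hm, sub_add_cancel]
  -- First `d e ≡ d' x`; then `d'` kills `m'`, hence `z`, so that `d' e ≡ d'' x` and `d e ≡ d'' x²`.
  · obtain ⟨d', hd'⟩ := hann d (by rw [← hgy, ← map_smul, h, map_zero])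
    have h1 : d' • m' = 0 := hf (by rw [map_smul, ← hd _ _ hd', h, map_zero])
    obtain ⟨d'', hd''⟩ := hann d' (hmz d' h1)
    refine ⟨d'', ?_⟩
    have h2 := I.add_mem hd' (hIx _ hd'')
    rwa [sub_mul, mul_assoc d' e x, hex, mul_assoc d'' x x, sub_add_sub_cancel] at h2

/-- Cyclic modules with the same annihilator are isomorphic. -/
theorem nonempty_equiv_of_ann {y : M} {z : N} (hy : ∀ m, ∃ d : R, d • y = m)
    (hz : ∀ m, ∃ d : R, d • z = m) (h : ∀ d : R, d • y = 0 ↔ d • z = 0) :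
    Nonempty (M ≃ₗ[R] N) := by
  have hk : LinearMap.ker (LinearMap.toSpanSingleton R M y) =
      LinearMap.ker (LinearMap.toSpanSingleton R N z) := by
    ext d
    exact h d
  exact ⟨(LinearMap.quotKerEquivOfSurjective (LinearMap.toSpanSingleton R M y) hy).symm ≪≫ₗ
    Submodule.quotEquivOfEq _ _ hk ≪≫ₗ
    LinearMap.quotKerEquivOfSurjective (LinearMap.toSpanSingleton R N z) hz⟩

end selfExtension

/-! ### Passing from a quotient ring to the ring itself. -/

section quotient

variable {R : Type*} [Ring R] {I : Ideal R} [I.IsTwoSided] {M : Type w} [AddCommGroup M]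
  [Module (R ⧸ I) M]
  [Module R M] [IsScalarTower R (R ⧸ I) M] {N : Type w'} [AddCommGroup N] [Module R N]

theorem mk_smul_eq (a : R) (m : M) : Ideal.Quotient.mk I a • m = a • m := by
  have h : a • (1 : R ⧸ I) = Ideal.Quotient.mk I a := by
    show Ideal.Quotient.mk I (a * 1) = _
    rw [mul_one]
  rw [← h, smul_assoc, one_smul]

/-- If all self-extensions over a quotient ring split, then so does every self-extension over the
ring itself on which the ideal acts as zero. -/
theorem exists_splitting
    (hext : ∀ (E : Type w) [AddCommGroup E] [Module (R ⧸ I) E]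
      (f : M →ₗ[R ⧸ I] E) (g : E →ₗ[R ⧸ I] M),
      Function.Injective f → Function.Exact f g → Function.Surjective g →
        ∃ s : M →ₗ[R ⧸ I] E, g ∘ₗ s = LinearMap.id)
    {f : M →ₗ[R] N} {g : N →ₗ[R] M} (hf : Function.Injective f) (hfg : Function.Exact f g)
    (hg : Function.Surjective g) (hI : ∀ l ∈ I, ∀ y : N, l • y = 0) :
    ∃ s : M →ₗ[R] N, g ∘ₗ s = LinearMap.id := by
  have htor : Module.IsTorsionBySet R N I := fun y l => hI l.1 l.2 y
  let _ : Module (R ⧸ I) N := htor.module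
  have hmk : ∀ (a : R) (y : N), Ideal.Quotient.mk I a • y = a • y := fun a y => rfl
  -- A set-theoretic section of `g` shows that `N` is an image of the set `M × M`; so `N` can be
  -- moved into the universe over which `hext` quantifies.
  have hsmall : Small.{w} N := by
    refine small_of_surjective (f := fun p : M × M => f p.1 + Function.surjInv hg p.2) fun y => ?_
    obtain ⟨m, hm⟩ := (hfg (y - Function.surjInv hg (g y))).1 (by
      rw [map_sub, Function.surjInv_eq hg, sub_self])
    exact ⟨(m, g y), by simp only [hm, sub_add_cancel]⟩
  let σ : Shrink.{w} N ≃ₗ[R ⧸ I] N := Shrink.linearEquiv (R ⧸ I) N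
  let f' : M →ₗ[R ⧸ I] N :=
    { toFun := f
      map_add' := map_add f
      map_smul' := fun c m => by
        obtain ⟨a, rfl⟩ := Ideal.Quotient.mk_surjective c
        rw [mk_smul_eq, map_smul, RingHom.id_apply, hmk] }
  let g' : N →ₗ[R ⧸ I] M :=
    { toFun := g
      map_add' := map_add g
      map_smul' := fun c y => by
        obtain ⟨a, rfl⟩ := Ideal.Quotient.mk_surjective c
        rw [hmk, map_smul, RingHom.id_apply, mk_smul_eq] }
  obtain ⟨s, hs⟩ := hext (Shrink.{w} N) (σ.symm.toLinearMap ∘ₗ f') (g' ∘ₗ σ.toLinearMap)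
    (σ.symm.injective.comp hf)
    (fun y => by
      show g (σ y) = 0 ↔ _
      rw [hfg]
      exact ⟨fun ⟨m, hm⟩ => ⟨m, σ.symm_apply_eq.2 hm⟩, fun ⟨m, hm⟩ => ⟨m, σ.symm_apply_eq.1 hm⟩⟩)
    (hg.comp σ.surjective)
  refine ⟨
    { toFun := fun m => σ (s m)
      map_add' := fun m m' => by rw [map_add, map_add]
      map_smul' := fun a m => by
        rw [← mk_smul_eq (I := I), map_smul, map_smul, RingHom.id_apply, hmk] }, ?_⟩
  ext m
  exact LinearMap.congr_fun hs m

end quotient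

/-! ### Ideals that kill a self-extension, and the generator of `𝓘_M(S)`. -/

section extension

open DAlg

variable {n : ℕ} [NeZero n] {K : Type*} [Field K] {δ : K} {M : Type*} [AddCommGroup M]
  [Module (DAlg n δ) M] {N : Type*} [AddCommGroup N] [Module (DAlg n δ) N]
  {f : M →ₗ[DAlg n δ] N} {g : N →ₗ[DAlg n δ] M}

/-- The ideals spanned by the diagrams with few vertical edges are idempotent. -/
theorem level_smul_eq_zero (hδ : δ ≠ 0) (hfg : Function.Exact f g) {s : ℤ}
    (hM : ∀ l ∈ level n δ s, ∀ m : M, l • m = 0) {l : DAlg n δ} (hl : l ∈ level n δ s) (y : N) :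
    l • y = 0 := by
  have h : level n δ s ≤ (Module.annihilator (DAlg n δ) N).restrictScalars K := by
    refine level_le fun D hD => ?_
    -- `D` is a multiple of `D * mirror`; the right factor sends `N` into the image of `M`, which
    -- the left factor kills.
    have h1 := of_mul_of (δ := δ) D (mirror (D.half 1))
    rw [comp_mirror, loops_eq (by simp)] at h1
    have h2 : of δ D * of δ (mirror (D.half 1)) ∈ Module.annihilator (DAlg n δ) N := by
      refine Module.mem_annihilator.2 fun y => ?_
      have h3 : of δ (mirror (D.half 1)) ∈ level n δ s :=
        of_mem_level (by rwa [mirror_through, ← through_eq])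
      obtain ⟨m, hm⟩ := (hfg (of δ (mirror (D.half 1)) • y)).1 (by rw [map_smul, hM _ h3])
      rw [mul_smul, ← hm, ← map_smul, hM _ (of_mem_level hD), map_zero]
    have h4 := Submodule.smul_mem ((Module.annihilator (DAlg n δ) N).restrictScalars K)
      (δ ^ ((mirror (D.half 1)).half 0).loopNumber)⁻¹ h2
    rwa [h1, smul_smul, inv_mul_cancel₀ (pow_ne_zero _ hδ), one_smul] at h4
  exact Module.mem_annihilator.1 (h hl) y

variable {t : ℕ}

/-- One factor `nilp b` maps `N` into the image of `M`, and a second one kills that image. -/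
theorem squareIdeal_smul_eq_zero (hδ : δ ≠ 0) (ht : 0 < t) (hpar : t % 2 = n % 2)
    (hfg : Function.Exact f g) {α : K}
    (hM : ∀ l ∈ level n δ ((t : ℤ) - 2), ∀ m : M, l • m = 0)
    (hnil : ∀ (b : Level n t) (m : M), nilp δ ht α b • m = 0) {l : DAlg n δ}
    (hl : l ∈ squareIdeal n δ t α) (y : N) : l • y = 0 := by
  have h : squareIdeal n δ t α ≤ Module.annihilator (DAlg n δ) N := by
    refine squareIdeal_le hδ ht hpar α
      (fun x hx => Module.mem_annihilator.2 (level_smul_eq_zero hδ hfg hM hx)) fun b => ?_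
    refine Module.mem_annihilator.2 fun y => ?_
    obtain ⟨m, hm⟩ := (hfg (nilp δ ht α b • y)).1 (by rw [map_smul, hnil])
    rw [mul_smul, ← hm, ← map_smul, hnil, map_zero]
  exact Module.mem_annihilator.1 (h hl) y

/-- The generator of `𝓘_M(S)` and its annihilator. -/
theorem exists_selfExtAt_generator (hδ : δ ≠ 0) (ht : 0 < t) (α : K) (b : Level n t)
    (hb : IsAnnular t b.1.perm) : ∃ z : selfExtAt δ t α b.1.perm, (∀ x, ∃ d : DAlg n δ, d • z = x) ∧
      ∀ d : DAlg n δ, d • z = 0 ↔ d * gunit δ ht b b 0 ∈ squareIdeal n δ t α := by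
  set z₀ : selfExt n δ t α :=
    Submodule.Quotient.mk ⟨gunit δ ht b b 0, gunit_mem_level ht b b 0⟩ with hz₀
  have hgen : selfExtAt δ t α b.1.perm ≤ Submodule.span (DAlg n δ) {z₀} := by
    refine Submodule.span_le.2 ?_
    rintro _ ⟨S₁, w, h, hS₁, rfl⟩
    obtain ⟨a, rfl, ha⟩ := exists_half ht hS₁
    refine Submodule.mem_span_singleton.2 ⟨bracket δ a.perm b.1.perm w, ?_⟩
    rw [hz₀, ← Submodule.Quotient.mk_smul]
    congr 1
    refine Subtype.ext ?_
    show bracket δ a.perm b.1.perm w * gunit δ ht b b 0 = bracket δ a.perm b.1.perm w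
    -- Each `[S₁, S, w]` is reproduced by right multiplication with the idempotent `gunit b b 0`, so
    -- it is a left multiple of it.
    rw [bracket_eq (ha.trans b.2.symm) (b.pos ht), of_glue hδ ht ⟨a, ha⟩ b, smul_mul_assoc,
      gunit_mul hδ, add_zero]
  have hmem : z₀ ∈ selfExtAt δ t α b.1.perm := by
    have hbr : bracket δ b.1.perm b.1.perm 0 = δ ^ b.1.loopNumber • gunit δ ht b b 0 := by
      rw [bracket_eq rfl (b.pos ht), of_glue hδ ht b b]
    have hl : bracket δ b.1.perm b.1.perm 0 ∈ levelIdeal n δ (t : ℤ) := by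
      rw [mem_levelIdeal, hbr]
      exact Submodule.smul_mem _ _ (gunit_mem_level ht b b 0)
    have h1 : (Submodule.Quotient.mk ⟨bracket δ b.1.perm b.1.perm 0, hl⟩ : selfExt n δ t α) ∈
        selfExtAt δ t α b.1.perm := Submodule.subset_span ⟨_, 0, hl, hb, rfl⟩
    have h2 := Submodule.smul_mem _ (algebraMap K (DAlg n δ) (δ ^ b.1.loopNumber)⁻¹) h1
    rw [← Submodule.Quotient.mk_smul] at h2
    convert h2 using 2
    refine Subtype.ext ?_
    show _ = algebraMap K (DAlg n δ) (δ ^ b.1.loopNumber)⁻¹ * bracket δ b.1.perm b.1.perm 0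
    rw [← Algebra.smul_def, hbr, smul_smul, inv_mul_cancel₀ (pow_ne_zero _ hδ), one_smul]
  refine ⟨⟨z₀, hmem⟩, fun x => ?_, fun d => ?_⟩
  · obtain ⟨d, hd⟩ := Submodule.mem_span_singleton.1 (hgen x.2)
    exact ⟨d, Subtype.ext hd⟩
  · rw [← Subtype.coe_inj]
    show d • z₀ = 0 ↔ _
    rw [hz₀, ← Submodule.Quotient.mk_smul, Submodule.Quotient.mk_eq_zero]
    rfl

end extension

/-! ### The generator of a simple standard module and its annihilator. -/

section standard

open DAlg

variable {n : ℕ} [NeZero n] {K : Type*} [Field K] {δ q : K} {t : ℕ} {M : Type*} [AddCommGroup M]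
  [Module (DQuot n δ q) M] [Module (DAlg n δ) M] [IsScalarTower (DAlg n δ) (DQuot n δ q) M]

theorem toDQuot_smul (a : DAlg n δ) (m : M) : toDQuot n δ q a • m = a • m := mk_smul_eq a m

/-- The generator of a nonzero standard module. -/
theorem exists_standard_generator (hδ : δ ≠ 0) (ht : 0 < t) (hpar : t % 2 = n % 2) (r : Fin t → K)
    (j : Fin t) (b : Level n t) (hb : IsAnnular t b.1.perm) (hM : Nontrivial M)
    (e : M ≃ₗ[DQuot n δ q] standardModule δ q r j (reverse b.1.perm)) :
    ∃ z : M, z ≠ 0 ∧ ∀ d : DAlg n δ, d • z = 0 ↔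
      toDQuot n δ q (d * polyBracket δ (cellPoly r j) b.1.perm b.1.perm) ∈
        cellIdealBelow n δ q r j := by
  -- Left multiplication by `gunit a b 0` carries the cell element with top `b` to the one with top
  -- `a`, so the former generates the standard module.
  have hgen : ∀ a : Level n t, polyBracket δ (cellPoly r j) a.1.perm b.1.perm -
      gunit δ ht a b 0 * polyBracket δ (cellPoly r j) b.1.perm b.1.perm ∈
        level n δ ((t : ℤ) - 2) := fun a => by
    have h := aeval_mul_sub_mem hδ ht hpar (cellPoly r j) (gunit δ ht a b 0)
      (gunit_mem_level (δ := δ) ht b b 0)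
    rw [gunit_mul hδ, add_zero] at h
    rw [polyBracket_eq hδ ht a b, polyBracket_eq hδ ht b b, mul_smul_comm, ← smul_sub]
    exact Submodule.smul_mem _ _ h
  have hcell : cellElement δ q r j b.1.perm (reverse b.1.perm) =
      toDQuot n δ q (polyBracket δ (cellPoly r j) b.1.perm b.1.perm) := by
    rw [cellElement, reverse_reverse]
  set z₀ : standardModule δ q r j (reverse b.1.perm) :=
    ⟨Submodule.Quotient.mk (cellElement δ q r j b.1.perm (reverse b.1.perm)),
      Submodule.subset_span ⟨_, hb, rfl⟩⟩ with hz₀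
  have hann : ∀ d : DAlg n δ, d • e.symm z₀ = 0 ↔
      toDQuot n δ q (d * polyBracket δ (cellPoly r j) b.1.perm b.1.perm) ∈
        cellIdealBelow n δ q r j := fun d => by
    rw [← toDQuot_smul (q := q), ← map_smul, e.symm.map_eq_zero_iff, ← Subtype.coe_inj]
    show toDQuot n δ q d • (Submodule.Quotient.mk _ : DQuot n δ q ⧸ cellIdealBelow n δ q r j) = 0 ↔ _
    rw [← Submodule.Quotient.mk_smul, Submodule.Quotient.mk_eq_zero, hcell, smul_eq_mul, ← map_mul]
  refine ⟨e.symm z₀, fun h0 => ?_, hann⟩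
  have h1 := (hann 1).1 (by rw [h0, smul_zero])
  rw [one_mul] at h1
  have hbot : standardModule δ q r j (reverse b.1.perm) = ⊥ := by
    refine Submodule.span_eq_bot.2 ?_
    rintro _ ⟨S, hS, rfl⟩
    obtain ⟨a, rfl, ha⟩ := exists_half ht hS
    rw [Submodule.Quotient.mk_eq_zero, cellElement, reverse_reverse]
    have h2 := level_mem_cellIdealBelow (q := q) r j (hgen ⟨a, ha⟩)
    have h3 := (cellIdealBelow n δ q r j).add_mem h2
      ((cellIdealBelow n δ q r j).mul_mem_left (toDQuot n δ q (gunit δ ht ⟨a, ha⟩ b 0)) h1)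
    rwa [← map_mul, ← map_add, sub_add_cancel] at h3
  obtain ⟨m, hm⟩ := exists_ne (0 : M)
  refine hm (e.map_eq_zero_iff.1 (Subtype.ext ?_))
  exact (Submodule.mem_bot _).1 (hbot.le (e m).2)

/-- The structure of a simple standard module. -/
theorem standard_facts (hδ : δ ≠ 0) (ht : 0 < t) (hpar : t % 2 = n % 2) (r : Fin t → K)
    (hr : (X ^ t - C q : K[X]) = ∏ i, (X - C (r i)))
    (j : Fin t) (b : Level n t) (hb : IsAnnular t b.1.perm)
    (hM : IsSimpleModule (DAlg n δ) M)
    (e : M ≃ₗ[DQuot n δ q] standardModule δ q r j (reverse b.1.perm)) :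
    (∀ l ∈ level n δ ((t : ℤ) - 2), ∀ m : M, l • m = 0) ∧
    (∀ (a : Level n t) (m : M), nilp δ ht (r j) a • m = 0) ∧
    ∃ z : M, z ≠ 0 ∧ gunit δ ht b b 0 • z = z ∧ ∀ d : DAlg n δ, d • z = 0 →
      ∃ d', d * gunit δ ht b b 0 - d' * nilp δ ht (r j) b ∈ level n δ ((t : ℤ) - 2) := by
  obtain ⟨z, hz, hann⟩ := exists_standard_generator hδ ht hpar r j b hb
    (IsSimpleModule.nontrivial (DAlg n δ) M) e
  refine ⟨fun l hl m => ?_, fun a m => ?_, z, hz, ?_, fun d hd => ?_⟩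
  · obtain ⟨d, rfl⟩ := exists_smul_eq hM hz m
    rw [smul_smul, hann]
    exact level_mem_cellIdealBelow r j (mem_level_mul (mem_level_mul hl _) _)
  · obtain ⟨d, rfl⟩ := exists_smul_eq hM hz m
    rw [smul_smul, hann, mul_assoc]
    exact nilp_mul_mem_cellIdealBelow hδ ht hpar r j hr a b hb d
  · rw [← sub_eq_zero]
    have h : (gunit δ ht b b 0 - 1) • z = 0 := by
      rw [hann]
      refine level_mem_cellIdealBelow r j ?_
      have h := aeval_mul_sub_mem hδ ht hpar (cellPoly r j) (gunit δ ht b b 0)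
        (gunit_mem_level (δ := δ) ht b b 0)
      rw [gunit_mul hδ, add_zero] at h
      replace h := neg_mem h
      rw [neg_sub] at h
      rw [polyBracket_eq hδ ht b b, mul_smul_comm, sub_mul, one_mul]
      exact Submodule.smul_mem _ _ h
    rwa [sub_smul, one_smul] at h
  · exact exists_of_mul_polyBracket_mem hδ ht hpar r j hr b ((hann d).1 hd)

/-- Matrix units move `z` from one circle to another, with `gunit b c 0` undoing `gunit c b 0`. This
frees the index `S` of `𝓘_M(S)` from the index `T` of the standard module. -/
theorem exists_element_of_bottom (hδ : δ ≠ 0) (ht : 0 < t) (α : K) (b c : Level n t) {z : M}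
    (hz : z ≠ 0) (hbz : gunit δ ht b b 0 • z = z)
    (hann : ∀ d : DAlg n δ, d • z = 0 →
      ∃ d', d * gunit δ ht b b 0 - d' * nilp δ ht α b ∈ level n δ ((t : ℤ) - 2)) :
    ∃ z : M, z ≠ 0 ∧ gunit δ ht c c 0 • z = z ∧ ∀ d : DAlg n δ, d • z = 0 →
      ∃ d', d * gunit δ ht c c 0 - d' * nilp δ ht α c ∈ level n δ ((t : ℤ) - 2) := by
  refine ⟨gunit δ ht c b 0 • z, fun h => hz ?_, ?_, fun d hd => ?_⟩
  · have h1 := congrArg (gunit δ ht b c 0 • ·) h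
    simpa only [smul_smul, gunit_mul hδ, add_zero, hbz, smul_zero] using h1
  · rw [smul_smul, gunit_mul hδ, add_zero]
  · rw [smul_smul] at hd
    obtain ⟨d', hd'⟩ := hann _ hd
    refine ⟨d' * gunit δ ht b c 0, ?_⟩
    have h := mem_level_mul hd' (gunit δ ht b c 0)
    rwa [sub_mul, mul_assoc, mul_assoc, gunit_mul hδ, gunit_mul hδ, add_zero, add_zero, mul_assoc d',
      nilp_mul_gunit hδ, ← mul_assoc d'] at h

end standard

/-! ### Proof of the proposition. -/

section main

/-- The result for an arbitrary nonzero loop parameter. -/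
theorem equiv_selfExtAt_and_range_eq {K : Type u} [Field K] {δ : K} (hδ : δ ≠ 0) (n : ℕ) [NeZero n] (q : K)
    (t : ℕ) (ht : 0 < t) (hpar : t % 2 = n % 2)
    (r : Fin t → K) (hr : (X ^ t - C q : K[X]) = ∏ i, (X - C (r i))) (j : Fin t)
    (T : Equiv.Perm (Fin n)) (hT : IsAnnular t T)
    {M : Type w} [AddCommGroup M] [Module (DQuot n δ q) M] [Module (DAlg n δ) M]
    [IsScalarTower (DAlg n δ) (DQuot n δ q) M]
    (e : M ≃ₗ[DQuot n δ q] standardModule δ q r j T)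
    (hsimple : IsSimpleModule (DAlg n δ) M)
    (hext : ∀ (E : Type w) [AddCommGroup E] [Module (DQuot n δ q) E]
      (f : M →ₗ[DQuot n δ q] E) (g : E →ₗ[DQuot n δ q] M),
      Function.Injective f → Function.Exact f g → Function.Surjective g →
        ∃ s : M →ₗ[DQuot n δ q] E, g ∘ₗ s = LinearMap.id)
    {N : Type w'} [AddCommGroup N] [Module (DAlg n δ) N]
    (f : M →ₗ[DAlg n δ] N) (g : N →ₗ[DAlg n δ] M)
    (hf : Function.Injective f) (hfg : Function.Exact f g) (hg : Function.Surjective g)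
    (hN : IsIndecomposable (DAlg n δ) N) :
    (∀ S : Equiv.Perm (Fin n), IsAnnular t S →
      Nonempty (N ≃ₗ[DAlg n δ] selfExtAt δ t (r j) S)) ∧
    ∀ a : K,
      (∀ x : M, (DAlg.of δ (Diagram.rot n) ^ n - algebraMap K _ a) • x = 0) →
      ∃ φ : M →ₗ[DAlg n δ] N, Function.Injective φ ∧
        Set.range φ =
          Set.range fun y : N => (DAlg.of δ (Diagram.rot n) ^ n - algebraMap K _ a) • y := by
  -- Cell elements with second index `T` have the lower circle `reverse T`, and `b` is the half of
  -- this involution.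
  obtain ⟨b₀, hb₀, hb₀t⟩ := exists_half ht hT.reverse
  obtain ⟨b, rfl⟩ : ∃ b : Level n t, T = reverse b.1.perm :=
    ⟨⟨b₀, hb₀t⟩, by rw [hb₀, reverse_reverse]⟩
  have hb : IsAnnular t b.1.perm := by
    have := hT.reverse
    rwa [reverse_reverse] at this
  obtain ⟨hlM, hnM, z, hz, hbz, hann⟩ := standard_facts hδ ht hpar r hr j b hb hsimple e
  have hlN : ∀ l ∈ level n δ ((t : ℤ) - 2), ∀ y : N, l • y = 0 :=
    fun l hl y => level_smul_eq_zero hδ hfg hlM hl y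
  have hsq : ∀ l ∈ squareIdeal n δ t (r j), ∀ y : N, l • y = 0 :=
    fun l hl y => squareIdeal_smul_eq_zero hδ ht hpar hfg hlM hnM hl y
  constructor
  · intro S hS
    obtain ⟨c, rfl⟩ : ∃ c : Level n t, S = c.1.perm := by
      obtain ⟨c, hc, hct⟩ := exists_half ht hS
      exact ⟨⟨c, hct⟩, hc.symm⟩
    obtain ⟨z', hz', hcz, hann'⟩ := exists_element_of_bottom hδ ht (r j) b c hz hbz hann
    obtain ⟨y, hey, hy, hyann⟩ := exists_generator hsimple hf hfg hg hN
      (e := gunit δ ht c c 0) (x := nilp δ ht (r j) c) (I := levelIdeal n δ ((t : ℤ) - 2))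
      (by rw [gunit_mul hδ, add_zero]) (gunit_zero_mul_nilp hδ ht (r j) c)
      hlN (fun l hl => mem_level_mul hl _) (hnM c) hz' hcz hann'
    obtain ⟨x, hx, hxann⟩ := exists_selfExtAt_generator hδ ht (r j) c hS
    -- For both generators the annihilator consists of those `d` for which `d * gunit c c 0` lies in
    -- `squareIdeal`.
    refine nonempty_equiv_of_ann hy hx fun d => ?_
    rw [hxann]
    constructor
    · intro h
      obtain ⟨d', hd'⟩ := hyann d h
      have h1 := Ideal.add_mem _ (level_le_squareIdeal (r j) hd')
        (Ideal.mul_mem_left _ d' (nilp_sq_mem_squareIdeal hδ ht (r j) c))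
      rwa [sub_add_cancel] at h1
    · intro h
      rw [← hey, smul_smul, hsq _ h]
  · intro a ha
    set c := DAlg.of δ (Diagram.rot n) ^ n - algebraMap K (DAlg n δ) q with hc
    have hcM : ∀ m : M, c • m = 0 := fun m => by
      rw [← toDQuot_smul (q := q), toDQuot_eq_zero_iff.2
        (TwoSidedIdeal.subset_span (Or.inl rfl)), zero_smul]
    -- `u ^ n` acts on `z ≠ 0` by both scalars.
    have haq : a = q := by
      by_contra hne
      have h1 : (algebraMap K (DAlg n δ) (a - q)) • z = 0 := by
        have h2 : algebraMap K (DAlg n δ) (a - q) =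
            c - (DAlg.of δ (Diagram.rot n) ^ n - algebraMap K (DAlg n δ) a) := by
          rw [hc, sub_sub_sub_cancel_left, map_sub]
        rw [h2, sub_smul, hcM, ha, sub_zero]
      have h3 := congrArg ((algebraMap K (DAlg n δ) (a - q)⁻¹) • ·) h1
      simp only [smul_smul, smul_zero] at h3
      rw [← map_mul, inv_mul_cancel₀ (sub_ne_zero.2 hne), map_one, one_smul] at h3
      exact hz h3
    subst haq
    rw [← hc]
    have hcomm : ∀ d, c * d = d * c := fun d => by
      rw [hc, sub_mul, mul_sub, rot_pow_comm, Algebra.commutes]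
    refine ⟨f, hf, ?_⟩
    have hsub : ∀ y : N, ∃ m, f m = c • y := fun y => (hfg _).1 (by rw [map_smul, hcM])
    -- If `c` killed `N`, so would the whole kernel of `D_n → D_n(q)`, since `I_0` is contained in
    -- `I_{t-2}`; the extension would then split over `D_n(q)`.
    by_cases h0 : ∀ y : N, c • y = 0
    · exfalso
      have hI : ∀ l ∈ (omegaIdeal n δ a).asIdeal, ∀ y : N, l • y = 0 := by
        intro l hl y
        obtain ⟨x, hx⟩ := exists_of_mem_omegaIdeal (TwoSidedIdeal.mem_asIdeal.1 hl)
        rw [← hc] at hx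
        have h1 := hlN _ (level_zero_le ht hpar hx) y
        rwa [sub_smul, mul_smul, h0, sub_zero] at h1
      obtain ⟨s, hs⟩ := exists_splitting hext hf hfg hg hI
      refine not_isCompl_range hsimple hf hfg hN (Q := LinearMap.range s) ?_ fun m =>
        ⟨s m, ⟨m, rfl⟩, LinearMap.congr_fun hs m⟩
      rintro _ ⟨m, rfl⟩ h
      have h1 : g (s m) = m := LinearMap.congr_fun hs m
      rw [h1] at h
      rw [h, map_zero]
    -- A nonzero `c • y` is the image of some `m ≠ 0`. As `m` generates `M` and `c` is central, `c
    -- N` is the whole image of `f`, so `f` itself serves as `φ`.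
    · push Not at h0
      obtain ⟨y, hy⟩ := h0
      obtain ⟨m, hm⟩ := hsub y
      ext x
      constructor
      · rintro ⟨m', rfl⟩
        have hm0 : m ≠ 0 := fun h => hy (by rw [← hm, h, map_zero])
        obtain ⟨d, rfl⟩ := exists_smul_eq hsimple hm0 m'
        refine ⟨d • y, ?_⟩
        show c • d • y = _
        rw [smul_smul, hcomm, mul_smul, ← hm, map_smul]
      · rintro ⟨y', rfl⟩
        exact hsub y'

end main

end AffineTL

theorem proposition3p4p1 {K : Type u} [Field K] [IsAlgClosed K] (v : K) (hv : v ≠ 0)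
    (hδ : v + v⁻¹ ≠ 0) (n : ℕ) [NeZero n] (hn : 3 ≤ n) (q : K) (hq : q ≠ 0)
    (t : ℕ) (ht : 0 < t) (htn : t ≤ n) (hpar : t % 2 = n % 2)
    (r : Fin t → K) (hr : (X ^ t - C q : K[X]) = ∏ i, (X - C (r i))) (j : Fin t)
    (T : Equiv.Perm (Fin n)) (hT : IsAnnular t T)
    {M : Type w} [AddCommGroup M] [Module (DQuot n (v + v⁻¹) q) M] [Module (DAlg n (v + v⁻¹)) M]
    [IsScalarTower (DAlg n (v + v⁻¹)) (DQuot n (v + v⁻¹) q) M]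
    (e : M ≃ₗ[DQuot n (v + v⁻¹) q] standardModule (v + v⁻¹) q r j T)
    (hsimple : IsSimpleModule (DAlg n (v + v⁻¹)) M)
    (hext : ∀ (E : Type w) [AddCommGroup E] [Module (DQuot n (v + v⁻¹) q) E]
      (f : M →ₗ[DQuot n (v + v⁻¹) q] E) (g : E →ₗ[DQuot n (v + v⁻¹) q] M),
      Function.Injective f → Function.Exact f g → Function.Surjective g →
        ∃ s : M →ₗ[DQuot n (v + v⁻¹) q] E, g ∘ₗ s = LinearMap.id)
    {N : Type w'} [AddCommGroup N] [Module (DAlg n (v + v⁻¹)) N]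
    (f : M →ₗ[DAlg n (v + v⁻¹)] N) (g : N →ₗ[DAlg n (v + v⁻¹)] M)
    (hf : Function.Injective f) (hfg : Function.Exact f g) (hg : Function.Surjective g)
    (hN : IsIndecomposable (DAlg n (v + v⁻¹)) N) :
    (∀ S : Equiv.Perm (Fin n), IsAnnular t S →
      Nonempty (N ≃ₗ[DAlg n (v + v⁻¹)] selfExtAt (v + v⁻¹) t (r j) S)) ∧
    ∀ a : K,
      (∀ x : M, (DAlg.of (v + v⁻¹) (Diagram.rot n) ^ n - algebraMap K _ a) • x = 0) →
      ∃ φ : M →ₗ[DAlg n (v + v⁻¹)] N, Function.Injective φ ∧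
        Set.range φ =
          Set.range fun y : N => (DAlg.of (v + v⁻¹) (Diagram.rot n) ^ n - algebraMap K _ a) • y := by
  exact equiv_selfExtAt_and_range_eq hδ n q t ht hpar r hr j T hT e hsimple hext f g hf hfg hg hN
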